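/- Let $d,N,M\ge 1$, $\beta>0$, and let $\rho$ be a probability measure on the sphere $\mathbb S^{d-1}$ with $\int \sigma\otimes\sigma\,d\rho(\sigma)=\frac1d\mathbf 1_d$. For a particle velocity vector $u=(u_1,\dots,u_{N+M})\in\mathbb R^{d(N+M)}$ and $\sigma\in\mathbb S^{d-1}$ let $M^{(i,j)}_\sigma u$ be obtained from $u$ by replacing $u_i$ by $u_i-(\sigma\cdot(u_i-u_j))\sigma$ and $u_j$ by $u_j+(\sigma\cdot(u_i-u_j))\sigma$. On $L^1(\mathbb R^{d(N+M)})$ define the bounded operators $$R_{ij}[F](u)=\int_{\mathbb S^{d-1}}F\big(M^{(i,j)}_\sigma u\big)\,d\rho(\sigma),\qquad \mathcal L_{\rm cl}=\frac{2}{N+M-1}\sum_{1\le i<j\le N+M}(R_{ij}-\mathbf 1).$$ Write $\gamma_n(v)=\left(\frac{\beta}{2\pi}\right)^{dn/2}e^{-\frac\beta2|v|^2}$ for $v\in\mathbb R^{dn}$. Let $f_0$ be a probability density on $\mathbb R^{dN}$ with $\sqrt{f_0}\in H^1(\mathbb R^{dN})$, put $F_0(v,w)=f_0(v)\gamma_M(w)$,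 and assume that the kinetic energy $\frac12\int |u|^2F_0(u)\,du$ is finite. For $t\ge0$ let $$f_t(v)=\int_{\mathbb R^{dM}}\big[e^{t\mathcal L_{\rm cl}}F_0\big](v,w)\,dw,\qquad h_t(v)=\frac{f_t(v)}{\gamma_N(v)},$$ $$I(h)=\int_{\mathbb R^{dN}}\frac{|\nabla h|^2}{h}\,\gamma_N\,dv,\qquad S(f|\gamma_N)=\int_{\mathbb R^{dN}} f\ln\frac{f}{\gamma_N}\,dv ,$$ with $\nabla$ the weak gradient. Then for every $t\ge0$ the function $f_t$ is a probability density, $\sqrt{h_t}\in H^1(\mathbb R^{dN},\gamma_N\,dv)$, the information $I(h_t)$ and the entropy $S(f_t|\gamma_N)$ are well defined and finite, and $$I(h_t)\le\Big[\tfrac{N}{N+M}+\tfrac{M}{N+M}e^{-\frac{2(N+M)}{d\,(N+M-1)}t}\Big]I(h_0),\qquad S(f_t|\gamma_N)\le\Big[\tfrac{N}{N+M}+\tfrac{M}{N+M}e^{-\frac{2(N+M)}{d\,(N+M-1)}t}\Big]S(f_0|\gamma_N).$$ In particular, for $d=1$ the exponent is $-\frac{2(N+M)}{N+M-1}t$.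 -/

import Mathlib

open MeasureTheory
open scoped ENNReal ContDiff

namespace KacModel

/-! ### Velocities, collisions and Gaussians -/

/-- Master vectors of `n` particles in dimension `d`, i.e. points of `ℝ^{dn}`. The Lebesgue measure
on this space is `volume`. Euclidean norms and inner products of `ℝ^{dn}` are always
written out below as sums over the particles. -/
abbrev Vel (d n : ℕ) : Type := Fin n → EuclideanSpace ℝ (Fin d)

/-- The unit sphere of scattering angles. -/
abbrev Angle (d : ℕ) : Type := Metric.sphere (0 : EuclideanSpace ℝ (Fin d)) 1

/-- `∫ σ ⊗ σ dρ(σ) = (1/d) 1`, entry by entry. -/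
def SymmetryCondition {d : ℕ} (ρ : Measure (Angle d)) : Prop :=
  ∀ a b : Fin d, ∫ σ : Angle d, σ.1 a * σ.1 b ∂ρ = if a = b then 1 / (d : ℝ) else 0

/-- The collision map: the velocities of the particles `i` and `j` become
`v_i - (σ·(v_i - v_j)) σ` and `v_j + (σ·(v_i - v_j)) σ`; all others are unchanged. -/
noncomputable def collide {d n : ℕ} (i j : Fin n) (σ : Angle d) (u : Vel d n) : Vel d n :=
  fun k =>
    if k = i then u i - inner ℝ σ.1 (u i - u j) • σ.1
    else if k = j then u j + inner ℝ σ.1 (u i - u j) • σ.1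
    else u k

/-- The Maxwellian (centred Gaussian density) of `n` particles at inverse temperature `β`. -/
noncomputable def maxwell (β : ℝ) {d n : ℕ} (v : Vel d n) : ℝ :=
  (β / (2 * Real.pi)) ^ (((d * n : ℕ) : ℝ) / 2) * Real.exp (-(β / 2) * ∑ k, ‖v k‖ ^ 2)

/-- The Gaussian measure `γ(v) dv`. -/
noncomputable def gaussMeasure (β : ℝ) (d n : ℕ) : Measure (Vel d n) :=
  volume.withDensity fun v => ENNReal.ofReal (maxwell β v)

/-- Probability densities with respect to the Lebesgue measure. -/
structure IsDensity {d n : ℕ} (f : Vel d n → ℝ) : Prop where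
  integrable : Integrable f
  nonneg : ∀ᵐ v, 0 ≤ f v
  integral_eq_one : ∫ v, f v = 1

/-- The kinetic energy `½ ∫ |v|² f(v) dv` of a nonnegative density, with values in `[0, ∞]`. -/
noncomputable def kineticEnergy {d n : ℕ} (f : Vel d n → ℝ) : ℝ≥0∞ :=
  2⁻¹ * ∫⁻ v, ENNReal.ofReal ((∑ k, ‖v k‖ ^ 2) * f v)

/-! ### Weak gradients, Sobolev spaces, information and entropy -/

/-- `G` is a weak gradient of `g` on `ℝ^{dn}` (unique up to null sets if it exists). -/
structure HasWeakGradient {d n : ℕ} (g : Vel d n → ℝ) (G : Vel d n → Vel d n) : Prop where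
  locallyIntegrable : LocallyIntegrable g
  locallyIntegrable_gradient : LocallyIntegrable G
  integral_eq : ∀ φ : Vel d n → ℝ, ContDiff ℝ ∞ φ → HasCompactSupport φ → ∀ w : Vel d n,
    ∫ v, g v * fderiv ℝ φ v w = -∫ v, (∑ k, inner ℝ (G v k) (w k)) * φ v

/-- The Sobolev space `H¹(ℝ^{dn}, μ)`: functions in `L²(μ)` whose weak gradient is in `L²(μ)`. -/
def MemH1 {d n : ℕ} (g : Vel d n → ℝ) (μ : Measure (Vel d n)) : Prop :=
  MemLp g 2 μ ∧ ∃ G : Vel d n → Vel d n, HasWeakGradient g G ∧ MemLp G 2 μ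

/-- The Fisher information `∫ (|∇h|² / h) γ dv` with values in `[0, ∞]`; here `0/0 = 0` and
`x/0 = ∞` for `x > 0`. As the weak gradient is unique up to null sets, the infimum
is the value at the weak gradient of `h`, and `∞` if there is none. -/
noncomputable def fisherInfo (β : ℝ) {d n : ℕ} (h : Vel d n → ℝ) : ℝ≥0∞ :=
  ⨅ (G : Vel d n → Vel d n) (_ : HasWeakGradient h G),
    ∫⁻ v, ENNReal.ofReal (∑ k, ‖G v k‖ ^ 2) / ENNReal.ofReal (h v) ∂(gaussMeasure β d n)

/-- The integrand `f ln(f/g)` of the relative entropy. -/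
noncomputable def entropyIntegrand {d n : ℕ} (f g : Vel d n → ℝ) (v : Vel d n) : ℝ :=
  f v * Real.log (f v / g v)

/-- The relative entropy (with inverted sign) `S(f|g) = ∫ f ln(f/g) dv`. -/
noncomputable def relEntropy {d n : ℕ} (f g : Vel d n → ℝ) : ℝ :=
  ∫ v, entropyIntegrand f g v

/-! ### The collision operators on `L¹` -/

/-- States of `n` particles, as elements of `L¹(ℝ^{dn})`. -/
abbrev State (d n : ℕ) : Type := Lp ℝ 1 (volume : Measure (Vel d n))

theorem measurable_collide {d n : ℕ} (i j : Fin n) :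
    Measurable (Function.uncurry (collide (d := d) i j)) := by
  apply Continuous.measurable
  refine continuous_pi fun k => ?_
  unfold Function.uncurry collide
  split_ifs <;> fun_prop

theorem collide_collide {d n : ℕ} (i j : Fin n) (σ : Angle d) (u : Vel d n) :
    collide i j σ (collide i j σ u) = u := by
  have hσ : inner ℝ σ.1 σ.1 = (1 : ℝ) := by
    have := σ.2
    rw [mem_sphere_zero_iff_norm] at this
    rw [real_inner_self_eq_norm_sq, this]; norm_num
  funext k
  by_cases hij : i = j
  · subst hij
    by_cases hk : k = i
    · subst hk; simp [collide]
    · simp [collide, hk]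
  · have hji : ¬ j = i := fun h => hij h.symm
    have key : inner ℝ σ.1 ((u i - inner ℝ σ.1 (u i - u j) • σ.1)
        - (u j + inner ℝ σ.1 (u i - u j) • σ.1)) = -inner ℝ σ.1 (u i - u j) := by
      simp only [inner_sub_right, inner_add_right, inner_smul_right, hσ]; ring
    by_cases hk : k = i
    · subst hk; simp [collide, hji, key]
    · by_cases hk' : k = j
      · subst hk'; simp [collide, hji, key]
      · simp [collide, hk, hk']

theorem measurePreserving_collide {d n : ℕ} (i j : Fin n) (σ : Angle d) :
    MeasurePreserving (collide i j σ) (volume : Measure (Vel d n)) volume := by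
  let L : Vel d n →ₗ[ℝ] Vel d n :=
    { toFun := collide i j σ
      map_add' := by
        intro u v
        funext k
        simp only [collide, Pi.add_apply]
        split_ifs
        · rw [show u i + v i - (u j + v j) = (u i - u j) + (v i - v j) by abel, inner_add_right,
            add_smul]; abel
        · rw [show u i + v i - (u j + v j) = (u i - u j) + (v i - v j) by abel, inner_add_right,
            add_smul]; abel
        · rfl
      map_smul' := by
        intro c u
        funext k
        simp only [collide, Pi.smul_apply, RingHom.id_apply]
        split_ifs
        · rw [← smul_sub, inner_smul_right, smul_sub, smul_smul]
        · rw [← smul_sub, inner_smul_right, smul_add, smul_smul]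
        · rfl }
  have hLL : L * L = 1 := by
    exact LinearMap.ext fun u => collide_collide i j σ u
  have hdet : LinearMap.det L * LinearMap.det L = 1 := by
    rw [← map_mul, hLL, map_one]
  have hne : LinearMap.det L ≠ 0 := fun h => by simp [h] at hdet
  have habs : |(LinearMap.det L)⁻¹| = 1 := by
    rcases mul_self_eq_one_iff.1 hdet with h | h <;> simp [h]
  refine ⟨(measurable_collide i j).comp measurable_prodMk_left, ?_⟩
  have := Measure.map_linearMap_addHaar_eq_smul_addHaar (volume : Measure (Vel d n)) hne
  rw [habs, ENNReal.ofReal_one, one_smul] at this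
  exact this

theorem measurePreserving_collide_prod {d n : ℕ} (ρ : Measure (Angle d)) [IsProbabilityMeasure ρ]
    (i j : Fin n) :
    MeasurePreserving (fun p : Angle d × Vel d n => (p.1, collide i j p.1 p.2))
      (ρ.prod volume) (ρ.prod volume) :=
  (MeasurePreserving.id ρ).skew_product (g := collide i j) (measurable_collide i j)
    (Filter.Eventually.of_forall fun σ => (measurePreserving_collide i j σ).map_eq)

/-- The average `∫ F(M_σ^{(i,j)} u) dρ(σ)` over the collisions of the particles `i` and `j`. -/
noncomputable def collisionAverage {d n : ℕ} (ρ : Measure (Angle d)) (i j : Fin n)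
    (F : Vel d n → ℝ) (u : Vel d n) : ℝ :=
  ∫ σ, F (collide i j σ u) ∂ρ

section

variable {d n : ℕ} (ρ : Measure (Angle d)) [IsProbabilityMeasure ρ] (i j : Fin n)

theorem integrable_comp_collide {F : Vel d n → ℝ} (hF : Integrable F) :
    Integrable (fun p : Angle d × Vel d n => F (collide i j p.1 p.2)) (ρ.prod volume) :=
  (measurePreserving_collide_prod ρ i j).integrable_comp_of_integrable (hF.comp_snd ρ)

theorem integrable_collisionAverage {F : Vel d n → ℝ} (hF : Integrable F) :
    Integrable (collisionAverage ρ i j F) :=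
  (integrable_comp_collide ρ i j hF).integral_prod_right

theorem collisionAverage_congr {F G : Vel d n → ℝ} (h : F =ᵐ[volume] G) :
    collisionAverage ρ i j F =ᵐ[volume] collisionAverage ρ i j G := by
  have h1 : ∀ᵐ p ∂(ρ.prod volume), F (collide i j p.1 p.2) = G (collide i j p.1 p.2) := by
    have h2 : ∀ᵐ p ∂(ρ.prod (volume : Measure (Vel d n))), F p.2 = G p.2 :=
      Measure.quasiMeasurePreserving_snd.ae h
    exact (measurePreserving_collide_prod ρ i j).quasiMeasurePreserving.ae h2
  have h3 := Measure.ae_ae_of_ae_prod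
    ((Measure.measurePreserving_swap (μ := volume) (ν := ρ)).quasiMeasurePreserving.ae h1)
  filter_upwards [h3] with u hu
  exact integral_congr_ae hu

theorem collisionAverage_add {F G : Vel d n → ℝ} (hF : Integrable F) (hG : Integrable G) :
    collisionAverage ρ i j (F + G) =ᵐ[volume]
      collisionAverage ρ i j F + collisionAverage ρ i j G := by
  filter_upwards [(integrable_comp_collide ρ i j hF).prod_left_ae,
    (integrable_comp_collide ρ i j hG).prod_left_ae] with u h1 h2
  exact integral_add h1 h2

theorem integral_norm_collisionAverage_le {F : Vel d n → ℝ} (hF : Integrable F) :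
    ∫ u, ‖collisionAverage ρ i j F u‖ ≤ ∫ u, ‖F u‖ := by
  have hi := integrable_comp_collide ρ i j hF.norm
  calc ∫ u, ‖collisionAverage ρ i j F u‖
      ≤ ∫ u, ∫ σ, ‖F (collide i j σ u)‖ ∂ρ :=
        integral_mono (integrable_collisionAverage ρ i j hF).norm hi.integral_prod_right
          fun u => norm_integral_le_integral_norm _
    _ = ∫ σ, (∫ u, ‖F (collide i j σ u)‖) ∂ρ := (integral_integral_swap (f := fun σ u => ‖F (collide i j σ u)‖) hi).symm
    _ = ∫ _ : Angle d, (∫ u, ‖F u‖) ∂ρ := by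
        congr 1
        funext σ
        have hm := measurePreserving_collide i j σ
        have := integral_map (μ := volume) (φ := collide i j σ) (f := fun u => ‖F u‖)
          hm.measurable.aemeasurable (by rw [hm.map_eq]; exact hF.norm.aestronglyMeasurable)
        rw [hm.map_eq] at this
        exact this.symm
    _ = ∫ u, ‖F u‖ := by simp

/-- The collision operator `R_ij` as a bounded operator on `L¹(ℝ^{dn})`,
`R_ij[F](u) = ∫ F(M_σ^{(i,j)} u) dρ(σ)`. -/
noncomputable def collisionOp : State d n →L[ℝ] State d n :=
  LinearMap.mkContinuous
    { toFun := fun F =>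
        (integrable_collisionAverage ρ i j (L1.integrable_coeFn F)).toL1 (collisionAverage ρ i j F)
      map_add' := fun F G => by
        rw [← Integrable.toL1_add, Integrable.toL1_eq_toL1_iff]
        exact (collisionAverage_congr ρ i j (Lp.coeFn_add F G)).trans
          (collisionAverage_add ρ i j (L1.integrable_coeFn F) (L1.integrable_coeFn G))
      map_smul' := fun c F => by
        simp only [RingHom.id_apply]
        rw [← Integrable.toL1_smul, Integrable.toL1_eq_toL1_iff]
        refine (collisionAverage_congr ρ i j (Lp.coeFn_smul c F)).trans ?_
        refine Filter.Eventually.of_forall fun u => ?_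
        simp [collisionAverage, integral_const_mul] }
    1 (fun F => by
      rw [one_mul, L1.norm_eq_integral_norm F]
      refine le_trans (le_of_eq ?_)
        (integral_norm_collisionAverage_le ρ i j (L1.integrable_coeFn F))
      rw [L1.norm_eq_integral_norm]
      refine integral_congr_ae ?_
      filter_upwards [Integrable.coeFn_toL1
        (integrable_collisionAverage ρ i j (L1.integrable_coeFn F))] with u hu
      simp only [LinearMap.coe_mk, AddHom.coe_mk]
      rw [hu])

theorem collisionOp_coeFn (F : State d n) :
    collisionOp ρ i j F =ᵐ[volume] collisionAverage ρ i j F :=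
  Integrable.coeFn_toL1 (integrable_collisionAverage ρ i j (L1.integrable_coeFn F))

end

/-- The generator of the classic Kac model of `n` particles,
`L_cl = 2/(n-1) ∑_{i<j} (R_ij - 1)`. -/
noncomputable def classicGenerator {d : ℕ} (ρ : Measure (Angle d)) [IsProbabilityMeasure ρ]
    (n : ℕ) : State d n →L[ℝ] State d n :=
  (2 / ((n : ℝ) - 1)) • ∑ i : Fin n, ∑ j ∈ Finset.Ioi i, (collisionOp ρ i j - 1)

/-! ### Initial state and marginals -/

/-- The function `f₀(v) γ(w)` on `ℝ^{dN} × ℝ^{dM}`. -/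
noncomputable def initialDensity (β : ℝ) {d N : ℕ} (M : ℕ) (f₀ : Vel d N → ℝ)
    (u : Vel d (N + M)) : ℝ :=
  f₀ (fun k => u (Fin.castAdd M k)) * maxwell β (fun k => u (Fin.natAdd N k))

theorem integrable_maxwell {β : ℝ} (hβ : 0 < β) (d n : ℕ) :
    Integrable (maxwell β : Vel d n → ℝ) := by
  have h1 : Integrable (fun v : EuclideanSpace ℝ (Fin d) => Real.exp (-(β / 2) * ‖v‖ ^ 2)) := by
    have h := GaussianFourier.integrable_cexp_neg_mul_sq_norm_add (b := ((β / 2 : ℝ) : ℂ))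
      (by simpa using hβ) 0 (0 : EuclideanSpace ℝ (Fin d))
    refine h.norm.congr (Filter.Eventually.of_forall fun v => ?_)
    simp only [Complex.norm_exp]
    congr 1
    rw [zero_mul, add_zero, ← Complex.ofReal_neg, ← Complex.ofReal_pow, ← Complex.ofReal_mul,
      Complex.ofReal_re]
  have h2 : Integrable (fun v : Vel d n => ∏ k, Real.exp (-(β / 2) * ‖v k‖ ^ 2)) :=
    Integrable.fintype_prod fun _ => h1
  refine (h2.const_mul ((β / (2 * Real.pi)) ^ (((d * n : ℕ) : ℝ) / 2))).congr
    (Filter.Eventually.of_forall fun v => ?_)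
  simp only [maxwell, Finset.mul_sum, Real.exp_sum]

theorem measurePreserving_split (d N M : ℕ) :
    MeasurePreserving (fun u : Vel d (N + M) =>
      ((fun k => u (Fin.castAdd M k), fun k => u (Fin.natAdd N k)) : Vel d N × Vel d M))
      volume (volume.prod volume) :=
  (measurePreserving_sumPiEquivProdPi
    (fun _ : Fin N ⊕ Fin M => (volume : Measure (EuclideanSpace ℝ (Fin d))))).comp
    (volume_measurePreserving_piCongrLeft
      (fun _ : Fin (N + M) => EuclideanSpace ℝ (Fin d)) finSumFinEquiv).symm

theorem integrable_initialDensity {β : ℝ} (hβ : 0 < β) {d N : ℕ} (M : ℕ) {f₀ : Vel d N → ℝ}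
    (hf₀ : Integrable f₀) : Integrable (initialDensity β M f₀) :=
  (measurePreserving_split d N M).integrable_comp_of_integrable
    (hf₀.mul_prod (integrable_maxwell hβ d M))

/-- The initial state `F₀(v, w) = f₀(v) γ(w)` as an element of `L¹(ℝ^{d(N+M)})`. -/
noncomputable def initialState {β : ℝ} (hβ : 0 < β) {d N : ℕ} (M : ℕ) {f₀ : Vel d N → ℝ}
    (hf₀ : Integrable f₀) : State d (N + M) :=
  (integrable_initialDensity hβ M hf₀).toL1 (initialDensity β M f₀)

/-- The marginal `f(v) = ∫ F(v, w) dw` over the last `M` particles. -/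
noncomputable def marginal {d N M : ℕ} (F : Vel d (N + M) → ℝ) (v : Vel d N) : ℝ :=
  ∫ w : Vel d M, F (Fin.append v w)

/-- The marginal `f_t(v) = ∫ [e^{t L_cl} F₀](v, w) dw` of the classic Kac evolution. -/
noncomputable def marginalAt {d : ℕ} (ρ : Measure (Angle d)) [IsProbabilityMeasure ρ]
    {β : ℝ} (hβ : 0 < β) {N : ℕ} (M : ℕ) {f₀ : Vel d N → ℝ} (hf₀ : Integrable f₀) (t : ℝ) :
    Vel d N → ℝ :=
  marginal (M := M) (NormedSpace.exp (t • classicGenerator ρ (N + M)) (initialState hβ M hf₀))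

/-- The factor `N/(N+M) + M/(N+M) e^{-2(N+M)t/(d(N+M-1))}`. -/
noncomputable def decayFactor (d N M : ℕ) (t : ℝ) : ℝ :=
  (N : ℝ) / (N + M) + (M : ℝ) / (N + M) * Real.exp (-(2 * (N + M) / (d * (N + M - 1)) * t))

end KacModel

/-! Put `n = N + M`. The generator is `n (Q - 1)`, where `Q` is the mean of the `R_ij` over all
pairs, so the evolution is a mixture of the powers `Q ^ m` with Poisson weights of mean `n t`. A
collision is an orthogonal reflection of `ℝ^{dn}`. Hence the evolution at time `t` sends `F` to `u ↦
E F(O u)`, with `O` the product of a Poisson number of random collisions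
(`exp_classicGenerator_coeFn`). The Gaussian is invariant under `O`; dividing by it gives `h_t(v) =
E h₀(A v + b)`, where `A` is the block of `O` that belongs to the first `N` particles and `b` is the
first part of `O (0, w)`, with `w` Gaussian and independent of `O` (`marginalAt_eq`).

Information: `∇h_t(v) = E Aᵀ ∇h₀(A v + b)`, and Cauchy–Schwarz bounds `|∇h_t|² / h_t` by the mean of
`|Aᵀ ∇h₀|² / h₀` at `z = A v + b`. If `v` is Gaussian, then `O` is independent of `O (v, w)`, hence
of `z`, and `z` is again Gaussian. So only `E |Aᵀ y|²` for a fixed `y` is needed. This is the mean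
energy of the first `N` particles of `Oᵀ (y, 0)`. The total energy is conserved, while isotropy of
`ρ` makes a random collision multiply the mean of every weighted energy with weights of sum zero by
`1 - 2 / (d (n - 1))`. Summing over the Poisson law yields exactly `decayFactor`. The structure
`IsFlow` isolates these properties; see `integral_weighted_collisionMeasure`, `isFlow_marg` and
`IsFlow.fisher_flowAvg_le`.

Entropy: the Ornstein–Uhlenbeck averages `ou β θ h` lead from `h` at `θ = 0` to its mean at `θ = π /
2` and dissipate entropy in proportion to the information (`hasDerivAt_entropy_ou`). They commute
with `h₀ ↦ h_t`, because the latter averages over linear maps that preserve Gaussians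
(`ou_flowAvg_marg`). The information estimate therefore holds at every `θ`, and integration over `θ`
transfers the same factor to the entropy (`IsFlow.entropy_flowAvg_le`). This is first done for
smooth functions bounded above and below, then extended by mollification, truncation and lower
semicontinuity.

Finiteness at time zero: `√h₀ = γ^{-1/2} √f₀` has weak gradient `γ^{-1/2} (∇√f₀ + (β / 2) v √f₀)`,
which is square integrable against `γ` by the `H¹` and energy assumptions. The information is four
times the squared norm of this gradient, and a logarithmic Sobolev inequality gives finite entropy.
-/

open Filter Topology Set

namespace KacModel

/-! ### Coordinates -/

/-- The Euclidean inner product of `ℝ^{dn}`. -/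
noncomputable def dot {d n : ℕ} (x y : Vel d n) : ℝ := ∑ k, inner ℝ (x k) (y k)

/-- The square of the Euclidean norm of `ℝ^{dn}`. -/
noncomputable def normSq {d n : ℕ} (x : Vel d n) : ℝ := ∑ k, ‖x k‖ ^ 2

/-- The standard basis of `ℝ^{dn}`. -/
noncomputable def basisVec {d n : ℕ} (p : Fin n × Fin d) : Vel d n :=
  Pi.single p.1 (EuclideanSpace.single p.2 1)

section coordinates

variable {d n m : ℕ}

theorem dot_eq_sum (x y : Vel d n) : dot x y = ∑ p : Fin n × Fin d, x p.1 p.2 * y p.1 p.2 := by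
  rw [Fintype.sum_prod_type]
  refine Finset.sum_congr rfl fun k _ => ?_
  rw [PiLp.inner_apply]
  exact Finset.sum_congr rfl fun a _ => by simp [mul_comm]

theorem normSq_eq_dot (x : Vel d n) : normSq x = dot x x := by
  simp [normSq, dot]

theorem normSq_eq_sum (x : Vel d n) : normSq x = ∑ p : Fin n × Fin d, x p.1 p.2 ^ 2 := by
  rw [normSq_eq_dot, dot_eq_sum]; simp [sq]

theorem normSq_nonneg (x : Vel d n) : 0 ≤ normSq x := Finset.sum_nonneg fun _ _ => by positivity

theorem sum_coord_smul_basisVec (x : Vel d n) :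
    x = ∑ p : Fin n × Fin d, x p.1 p.2 • basisVec p := by
  rw [Fintype.sum_prod_type]
  ext k a
  simp only [basisVec, Finset.sum_apply, Pi.smul_apply]
  rw [Finset.sum_eq_single k]
  · simp [Finset.sum_apply, Pi.single_apply]
  · intro b _ hb
    simp [Pi.single_eq_of_ne hb.symm]
  · simp

theorem basisVec_apply (p : Fin n × Fin d) (k : Fin n) (a : Fin d) :
    (basisVec p : Vel d n) k a = if p = (k, a) then 1 else 0 := by
  obtain ⟨l, b⟩ := p
  by_cases h : l = k
  · subst h
    simp [basisVec, eq_comm]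
  · simp [basisVec, h]

theorem dot_basisVec (x : Vel d n) (p : Fin n × Fin d) : dot x (basisVec p) = x p.1 p.2 := by
  rw [dot_eq_sum]
  simp [basisVec_apply]

theorem dot_comm (x y : Vel d n) : dot x y = dot y x := by
  simp [dot, real_inner_comm]

theorem map_eq_sum_basisVec {F : Type*} [AddCommGroup F] [Module ℝ F] (l : Vel d n →ₗ[ℝ] F)
    (x : Vel d n) : l x = ∑ p : Fin n × Fin d, x p.1 p.2 • l (basisVec p) := by
  conv_lhs => rw [sum_coord_smul_basisVec x]
  simp

theorem dot_add_right (x y z : Vel d n) : dot x (y + z) = dot x y + dot x z := by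
  simp [dot, inner_add_right, Finset.sum_add_distrib]

theorem dot_smul_right (x y : Vel d n) (c : ℝ) : dot x (c • y) = c * dot x y := by
  simp [dot, inner_smul_right, Finset.mul_sum]

theorem dot_smul_left (x y : Vel d n) (c : ℝ) : dot (c • x) y = c * dot x y := by
  simp [dot, inner_smul_left, Finset.mul_sum]

theorem dot_add_left (x y z : Vel d n) : dot (x + y) z = dot x z + dot y z := by
  simp [dot, inner_add_left, Finset.sum_add_distrib]

@[fun_prop]
theorem continuous_normSq : Continuous (normSq : Vel d n → ℝ) := by
  unfold normSq; fun_prop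

theorem contDiff_normSq : ContDiff ℝ ∞ (normSq : Vel d n → ℝ) := by
  unfold normSq
  exact ContDiff.sum fun k _ => (contDiff_apply ℝ _ k).norm_sq ℝ

/-- The norm of `Vel d n` is a supremum over the particles, so it is only equivalent to the
Euclidean one. This bound and the next allow passing between them; the dimensional constants never
enter the final estimates. -/
theorem sq_norm_le_normSq (x : Vel d n) : ‖x‖ ^ 2 ≤ normSq x := by
  have : ‖x‖ ≤ Real.sqrt (normSq x) := by
    refine (pi_norm_le_iff_of_nonneg (Real.sqrt_nonneg _)).2 fun k => ?_
    refine Real.le_sqrt_of_sq_le ?_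
    exact Finset.single_le_sum (f := fun k => ‖x k‖ ^ 2) (fun _ _ => by positivity)
      (Finset.mem_univ k)
  calc ‖x‖ ^ 2 ≤ Real.sqrt (normSq x) ^ 2 := by gcongr
    _ = _ := Real.sq_sqrt (normSq_nonneg x)

theorem normSq_le_sq_norm (x : Vel d n) : normSq x ≤ n * ‖x‖ ^ 2 := by
  calc normSq x ≤ ∑ _k : Fin n, ‖x‖ ^ 2 :=
        Finset.sum_le_sum fun k _ => by gcongr; exact norm_le_pi_norm x k
    _ = _ := by simp

theorem norm_basisVec_le (p : Fin n × Fin d) : ‖(basisVec p : Vel d n)‖ ≤ 1 := by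
  refine (pi_norm_le_iff_of_nonneg zero_le_one).2 fun k => ?_
  by_cases h : p.1 = k
  · subst h; simp [basisVec]
  · simp [basisVec, Pi.single_eq_of_ne (Ne.symm h)]

theorem abs_dot_le (x y : Vel d n) : |dot x y| ≤ n * (‖x‖ * ‖y‖) := by
  calc |dot x y| ≤ ∑ k, |inner ℝ (x k) (y k)| := Finset.abs_sum_le_sum_abs _ _
    _ ≤ ∑ _k : Fin n, ‖x‖ * ‖y‖ := Finset.sum_le_sum fun k _ =>
        (abs_real_inner_le_norm _ _).trans (mul_le_mul (norm_le_pi_norm x k) (norm_le_pi_norm y k)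
          (norm_nonneg _) (norm_nonneg _))
    _ = _ := by simp

/-- The vector of `ℝ^{dn}` which represents a linear functional. -/
noncomputable def riesz (l : Vel d n →L[ℝ] ℝ) : Vel d n :=
  fun k => WithLp.toLp 2 fun a => l (basisVec (k, a))

theorem riesz_apply (l : Vel d n →L[ℝ] ℝ) (k : Fin n) (a : Fin d) :
    riesz l k a = l (basisVec (k, a)) := rfl

theorem dot_riesz (l : Vel d n →L[ℝ] ℝ) (x : Vel d n) : dot (riesz l) x = l x := by
  have := map_eq_sum_basisVec l.toLinearMap x
  simp only [ContinuousLinearMap.coe_coe, smul_eq_mul] at this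
  rw [this, dot_eq_sum]
  exact Finset.sum_congr rfl fun p _ => by rw [riesz_apply, mul_comm]

theorem continuous_vel_iff {X : Type*} [TopologicalSpace X] {f : X → Vel d n} :
    Continuous f ↔ ∀ k a, Continuous fun x => f x k a := by
  refine ⟨fun h k a => by fun_prop, fun h => continuous_pi fun k => ?_⟩
  exact (PiLp.continuous_toLp 2 _).comp (continuous_pi fun a => h k a)

theorem measurable_vel_iff {X : Type*} [MeasurableSpace X] {f : X → Vel d n} :
    Measurable f ↔ ∀ k a, Measurable fun x => f x k a := by
  refine ⟨fun h k a => by fun_prop, fun h => measurable_pi_lambda _ fun k => ?_⟩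
  exact (PiLp.continuous_toLp 2 _).measurable.comp (measurable_pi_lambda _ fun a => h k a)

theorem norm_vel_le_sum (x : Vel d n) : ‖x‖ ≤ ∑ p : Fin n × Fin d, |x p.1 p.2| := by
  conv_lhs => rw [sum_coord_smul_basisVec x]
  refine (norm_sum_le _ _).trans (Finset.sum_le_sum fun p _ => ?_)
  rw [norm_smul, Real.norm_eq_abs]
  exact mul_le_of_le_one_right (abs_nonneg _) (norm_basisVec_le p)

theorem integrable_vel_iff {X : Type*} [MeasurableSpace X] {μ : Measure X} {f : X → Vel d n} :
    Integrable f μ ↔ ∀ k a, Integrable (fun x => f x k a) μ := by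
  constructor
  · intro h k a
    exact ((PiLp.proj 2 (fun _ : Fin d => ℝ) a : EuclideanSpace ℝ (Fin d) →L[ℝ] ℝ).comp
      (ContinuousLinearMap.proj (R := ℝ) (φ := fun _ : Fin n => EuclideanSpace ℝ (Fin d)) k)
      ).integrable_comp h
  · intro h
    have : f = fun x => ∑ p : Fin n × Fin d, f x p.1 p.2 • (basisVec p : Vel d n) := by
      funext x; exact sum_coord_smul_basisVec (f x)
    rw [this]
    exact integrable_finsetSum _ fun p _ => (h p.1 p.2).smul_const _

theorem norm_riesz_le (l : Vel d n →L[ℝ] ℝ) : ‖riesz l‖ ≤ (n * d : ℕ) * ‖l‖ := by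
  refine (norm_vel_le_sum _).trans ?_
  calc ∑ p : Fin n × Fin d, |riesz l p.1 p.2| ≤ ∑ _p : Fin n × Fin d, ‖l‖ := by
        refine Finset.sum_le_sum fun p _ => ?_
        rw [riesz_apply, ← Real.norm_eq_abs]
        exact (l.le_opNorm _).trans (mul_le_of_le_one_right (norm_nonneg _) (norm_basisVec_le _))
    _ = _ := by simp

theorem continuous_riesz : Continuous (riesz : (Vel d n →L[ℝ] ℝ) → Vel d n) :=
  continuous_vel_iff.2 fun k a => by simp only [riesz_apply]; fun_prop

theorem continuous_dot_comp {X : Type*} [TopologicalSpace X] {f g : X → Vel d n}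
    (hf : Continuous f) (hg : Continuous g) : Continuous fun x => dot (f x) (g x) := by
  unfold dot; fun_prop

attribute [irreducible] riesz basisVec dot

end coordinates

/-! ### The Gaussian measure -/

section gaussian

variable {d n : ℕ} {β : ℝ}

theorem maxwell_eq (v : Vel d n) : maxwell β v =
    (β / (2 * Real.pi)) ^ (((d * n : ℕ) : ℝ) / 2) * Real.exp (-(β / 2) * normSq v) := rfl

theorem maxwell_pos (hβ : 0 < β) (v : Vel d n) : 0 < maxwell β v := by
  unfold maxwell; positivity

theorem contDiff_maxwell : ContDiff ℝ ∞ (maxwell β : Vel d n → ℝ) := by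
  have : (maxwell β : Vel d n → ℝ) = fun v => (β / (2 * Real.pi)) ^ (((d * n : ℕ) : ℝ) / 2) *
    Real.exp (-(β / 2) * normSq v) := rfl
  rw [this]
  exact contDiff_const.mul (contDiff_const.mul contDiff_normSq).exp

@[fun_prop]
theorem continuous_maxwell : Continuous (maxwell β : Vel d n → ℝ) := contDiff_maxwell.continuous

theorem maxwell_le (hβ : 0 < β) (v : Vel d n) :
    maxwell β v ≤ (β / (2 * Real.pi)) ^ (((d * n : ℕ) : ℝ) / 2) := by
  rw [maxwell_eq]
  refine mul_le_of_le_one_right (by positivity) (Real.exp_le_one_iff.2 ?_)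
  have := normSq_nonneg v
  nlinarith

theorem integral_maxwell (hβ : 0 < β) : ∫ v : Vel d n, maxwell β v = 1 := by
  have h1 : ∫ v : EuclideanSpace ℝ (Fin d), Real.exp (-(β / 2) * ‖v‖ ^ 2)
      = (2 * Real.pi / β) ^ ((d : ℝ) / 2) := by
    have := GaussianFourier.integral_rexp_neg_mul_sq_norm (V := EuclideanSpace ℝ (Fin d))
      (half_pos hβ)
    rw [this, finrank_euclideanSpace_fin]
    congr 1; field_simp
  have h2 : ∀ v : Vel d n, maxwell β v = (β / (2 * Real.pi)) ^ (((d * n : ℕ) : ℝ) / 2) *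
      ∏ k, Real.exp (-(β / 2) * ‖v k‖ ^ 2) := fun v => by
    simp only [maxwell, Finset.mul_sum, Real.exp_sum]
  simp_rw [h2]
  rw [integral_const_mul, integral_fintype_prod_volume_eq_pow
    (fun v : EuclideanSpace ℝ (Fin d) => Real.exp (-(β / 2) * ‖v‖ ^ 2)), h1, Fintype.card_fin,
    ← Real.rpow_mul_natCast (by positivity),
    show (d : ℝ) / 2 * n = ((d * n : ℕ) : ℝ) / 2 by push_cast; ring,
    ← Real.mul_rpow (by positivity) (by positivity)]
  rw [show β / (2 * Real.pi) * (2 * Real.pi / β) = 1 by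
    have := Real.pi_pos; field_simp, Real.one_rpow]

theorem lintegral_maxwell (hβ : 0 < β) : ∫⁻ v : Vel d n, ENNReal.ofReal (maxwell β v) = 1 := by
  rw [← ofReal_integral_eq_lintegral_ofReal (integrable_maxwell hβ d n)
    (Eventually.of_forall fun v => (maxwell_pos hβ v).le), integral_maxwell hβ, ENNReal.ofReal_one]

theorem isProbabilityMeasure_gaussMeasure (hβ : 0 < β) (d n : ℕ) :
    IsProbabilityMeasure (gaussMeasure β d n) :=
  ⟨by rw [gaussMeasure, withDensity_apply _ MeasurableSet.univ, Measure.restrict_univ,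
    lintegral_maxwell hβ]⟩

theorem measurable_ofReal_maxwell :
    Measurable fun v : Vel d n => ENNReal.ofReal (maxwell β v) :=
  continuous_maxwell.measurable.ennreal_ofReal

theorem lintegral_gaussMeasure (f : Vel d n → ℝ≥0∞) :
    ∫⁻ v, f v ∂gaussMeasure β d n = ∫⁻ v, ENNReal.ofReal (maxwell β v) * f v :=
  lintegral_withDensity_eq_lintegral_mul_non_measurable _ measurable_ofReal_maxwell
    (Eventually.of_forall fun _ => ENNReal.ofReal_lt_top) f

theorem integrable_gaussMeasure_iff {E : Type*} [NormedAddCommGroup E] [NormedSpace ℝ E]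
    (hβ : 0 < β) {f : Vel d n → E} :
    Integrable f (gaussMeasure β d n) ↔ Integrable fun v => maxwell β v • f v := by
  have h := integrable_withDensity_iff_integrable_smul' (g := f) (μ := (volume : Measure (Vel d n)))
    (measurable_ofReal_maxwell (β := β)) (Eventually.of_forall fun _ => ENNReal.ofReal_lt_top)
  rw [gaussMeasure, h]
  simp only [ENNReal.toReal_ofReal (maxwell_pos hβ _).le]

theorem integral_gaussMeasure {E : Type*} [NormedAddCommGroup E] [NormedSpace ℝ E]
    (hβ : 0 < β) (f : Vel d n → E) :
    ∫ v, f v ∂gaussMeasure β d n = ∫ v, maxwell β v • f v := by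
  rw [gaussMeasure, integral_withDensity_eq_integral_toReal_smul measurable_ofReal_maxwell
    (Eventually.of_forall fun _ => ENNReal.ofReal_lt_top)]
  simp only [ENNReal.toReal_ofReal (maxwell_pos hβ _).le]

theorem ae_gaussMeasure_iff (hβ : 0 < β) {p : Vel d n → Prop} :
    (∀ᵐ v ∂gaussMeasure β d n, p v) ↔ ∀ᵐ v, p v := by
  rw [gaussMeasure, ae_withDensity_iff measurable_ofReal_maxwell]
  simp [ENNReal.ofReal_eq_zero, not_le.2 (maxwell_pos hβ _)]

theorem aestronglyMeasurable_gaussMeasure_iff {E : Type*} [NormedAddCommGroup E] (hβ : 0 < β)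
    {f : Vel d n → E} :
    AEStronglyMeasurable f (gaussMeasure β d n) ↔ AEStronglyMeasurable f volume := by
  constructor
  · rintro ⟨g, hg, h⟩
    exact ⟨g, hg, (ae_gaussMeasure_iff hβ).1 h⟩
  · rintro ⟨g, hg, h⟩
    exact ⟨g, hg, (ae_gaussMeasure_iff hβ).2 h⟩

theorem integrable_gaussMeasure_of_volume {E : Type*} [NormedAddCommGroup E] [NormedSpace ℝ E]
    (hβ : 0 < β) {f : Vel d n → E} (hf : Integrable f) : Integrable f (gaussMeasure β d n) := by
  rw [integrable_gaussMeasure_iff hβ]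
  refine hf.bdd_smul ((β / (2 * Real.pi)) ^ (((d * n : ℕ) : ℝ) / 2))
    continuous_maxwell.aestronglyMeasurable ?_
  refine Eventually.of_forall fun v => ?_
  rw [Real.norm_of_nonneg (maxwell_pos hβ v).le]
  exact maxwell_le hβ v

/-- The Gaussian density is continuous and has no zeros, so multiplication by its inverse preserves
local integrability. -/
theorem locallyIntegrable_of_gaussMeasure {E : Type*} [NormedAddCommGroup E] [NormedSpace ℝ E]
    (hβ : 0 < β) {f : Vel d n → E} (hf : Integrable f (gaussMeasure β d n)) :
    LocallyIntegrable f := by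
  have h := ((integrable_gaussMeasure_iff hβ).1 hf).locallyIntegrable
  have hc : Continuous fun v : Vel d n => (maxwell β v)⁻¹ :=
    continuous_maxwell.inv₀ fun v => (maxwell_pos hβ v).ne'
  have := locallyIntegrableOn_univ.1
    ((h.locallyIntegrableOn univ).continuousOn_smul isOpen_univ.isLocallyClosed hc.continuousOn)
  refine this.congr (Eventually.of_forall fun v => ?_)
  simp [smul_smul, inv_mul_cancel₀ (maxwell_pos hβ v).ne']

end gaussian

/-! ### Invariance of Gaussian measures -/

/-- Reduces invariance of a Gaussian measure to invariance of Lebesgue measure together with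
invariance of the exponent. -/
theorem MeasurePreserving.withDensity_comp {X Y : Type*} [MeasurableSpace X] [MeasurableSpace Y]
    {μ : Measure X} {ν : Measure Y} {T : X → Y} (hT : MeasurePreserving T μ ν) {g : Y → ℝ≥0∞}
    (hg : Measurable g) : MeasurePreserving T (μ.withDensity (g ∘ T)) (ν.withDensity g) := by
  refine ⟨hT.measurable, Measure.ext fun s hs => ?_⟩
  rw [Measure.map_apply hT.measurable hs, withDensity_apply _ (hT.measurable hs),
    withDensity_apply _ hs, ← hT.map_eq, setLIntegral_map hs hg hT.measurable]
  rfl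

/-- The determinant of an involution squares to one, so its absolute value is one. -/
theorem measurePreserving_of_involutive {E : Type*} [NormedAddCommGroup E] [NormedSpace ℝ E]
    [FiniteDimensional ℝ E] [MeasurableSpace E] [BorelSpace E] (μ : Measure E)
    [μ.IsAddHaarMeasure] (L : E →ₗ[ℝ] E) (hL : ∀ x, L (L x) = x) : MeasurePreserving L μ μ := by
  have hLL : L * L = 1 := LinearMap.ext hL
  have hdet : LinearMap.det L * LinearMap.det L = 1 := by rw [← map_mul, hLL, map_one]
  have hne : LinearMap.det L ≠ 0 := fun h => by simp [h] at hdet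
  have habs : |(LinearMap.det L)⁻¹| = 1 := by
    rcases mul_self_eq_one_iff.1 hdet with h | h <;> simp [h]
  refine ⟨L.continuous_of_finiteDimensional.measurable, ?_⟩
  rw [Measure.map_linearMap_addHaar_eq_smul_addHaar μ hne, habs, ENNReal.ofReal_one, one_smul]

section gaussian

variable {d n : ℕ} {β : ℝ}

theorem gaussMeasure_prod (hβ : 0 < β) (d n m : ℕ) :
    (gaussMeasure β d n).prod (gaussMeasure β d m) =
      ((volume : Measure (Vel d n)).prod (volume : Measure (Vel d m))).withDensity
        fun p => ENNReal.ofReal (maxwell β p.1 * maxwell β p.2) := by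
  have := isProbabilityMeasure_gaussMeasure hβ d m
  have : SFinite ((volume : Measure (Vel d m)).withDensity
    fun v => ENNReal.ofReal (maxwell β v)) := by
    change SFinite (gaussMeasure β d m); infer_instance
  rw [gaussMeasure, gaussMeasure, prod_withDensity measurable_ofReal_maxwell
    measurable_ofReal_maxwell]
  congr 1
  funext p
  rw [ENNReal.ofReal_mul (maxwell_pos hβ _).le]

/-- The orthogonal reflection `(v, w) ↦ (c v + s w, s v - c w)`. -/
def reflection {E : Type*} [AddCommGroup E] [Module ℝ E] (c s : ℝ) : E × E →ₗ[ℝ] E × E :=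
  (c • LinearMap.fst ℝ E E + s • LinearMap.snd ℝ E E).prod
    (s • LinearMap.fst ℝ E E - c • LinearMap.snd ℝ E E)

theorem reflection_apply {E : Type*} [AddCommGroup E] [Module ℝ E] (c s : ℝ) (p : E × E) :
    reflection c s p = (c • p.1 + s • p.2, s • p.1 - c • p.2) := rfl

theorem reflection_reflection {E : Type*} [AddCommGroup E] [Module ℝ E] {c s : ℝ}
    (h : c ^ 2 + s ^ 2 = 1) (p : E × E) : reflection c s (reflection c s p) = p := by
  simp only [reflection_apply]
  ext
  · calc c • (c • p.1 + s • p.2) + s • (s • p.1 - c • p.2) = (c ^ 2 + s ^ 2) • p.1 := by module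
      _ = p.1 := by rw [h, one_smul]
  · calc s • (c • p.1 + s • p.2) - c • (s • p.1 - c • p.2) = (c ^ 2 + s ^ 2) • p.2 := by module
      _ = p.2 := by rw [h, one_smul]

theorem normSq_add_smul (v w : Vel d n) (c s : ℝ) :
    normSq (c • v + s • w) = c ^ 2 * normSq v + 2 * c * s * dot v w + s ^ 2 * normSq w := by
  simp only [normSq_eq_dot, dot_add_left, dot_add_right, dot_smul_left, dot_smul_right,
    dot_comm w v]
  ring

theorem maxwell_mul_maxwell {m : ℕ} (v : Vel d n) (w : Vel d m) :
    maxwell β v * maxwell β w = (β / (2 * Real.pi)) ^ (((d * n : ℕ) : ℝ) / 2) *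
      (β / (2 * Real.pi)) ^ (((d * m : ℕ) : ℝ) / 2) *
      Real.exp (-(β / 2) * (normSq v + normSq w)) := by
  rw [maxwell_eq, maxwell_eq, mul_add, Real.exp_add]; ring

/-- The cross terms of the two squared norms cancel, so `c² + s² = 1` makes the map an isometry. A
reflection serves better than a rotation because it is its own inverse, which yields both the
invariance of volume and an explicit inverse substitution in the dissipation formula. -/
theorem measurePreserving_reflection (hβ : 0 < β) (d n : ℕ) {c s : ℝ} (h : c ^ 2 + s ^ 2 = 1) :
    MeasurePreserving (reflection (E := Vel d n) c s)
      ((gaussMeasure β d n).prod (gaussMeasure β d n))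
      ((gaussMeasure β d n).prod (gaussMeasure β d n)) := by
  have : ((volume : Measure (Vel d n)).prod (volume : Measure (Vel d n))).IsAddHaarMeasure :=
    Measure.prod.instIsAddHaarMeasure _ _
  have h1 := measurePreserving_of_involutive
    ((volume : Measure (Vel d n)).prod (volume : Measure (Vel d n))) (reflection c s)
    (reflection_reflection h)
  have h2 := MeasurePreserving.withDensity_comp h1
    (g := fun p => ENNReal.ofReal (maxwell β p.1 * maxwell β p.2)) (by fun_prop)
  rw [gaussMeasure_prod hβ]
  convert h2 using 2
  funext p
  simp only [Function.comp, reflection_apply, maxwell_mul_maxwell]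
  congr 4
  rw [sub_eq_add_neg, ← neg_smul, normSq_add_smul, normSq_add_smul]
  linear_combination (-(normSq p.1 + normSq p.2)) * h

theorem measurePreserving_rotate (hβ : 0 < β) (d n : ℕ) {c s : ℝ} (h : c ^ 2 + s ^ 2 = 1) :
    MeasurePreserving (fun p : Vel d n × Vel d n => c • p.1 + s • p.2)
      ((gaussMeasure β d n).prod (gaussMeasure β d n)) (gaussMeasure β d n) := by
  have := isProbabilityMeasure_gaussMeasure hβ d n
  exact measurePreserving_fst.comp (measurePreserving_reflection hβ d n h)

theorem measurePreserving_split_gauss (hβ : 0 < β) (d n m : ℕ) :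
    MeasurePreserving (fun u : Vel d (n + m) =>
      ((fun k => u (Fin.castAdd m k), fun k => u (Fin.natAdd n k)) : Vel d n × Vel d m))
      (gaussMeasure β d (n + m)) ((gaussMeasure β d n).prod (gaussMeasure β d m)) := by
  rw [gaussMeasure_prod hβ]
  have h2 := MeasurePreserving.withDensity_comp (measurePreserving_split d n m)
    (g := fun p => ENNReal.ofReal (maxwell β p.1 * maxwell β p.2)) (by fun_prop)
  have h3 : gaussMeasure β d (n + m) = (volume : Measure (Vel d (n + m))).withDensity
      ((fun p => ENNReal.ofReal (maxwell β p.1 * maxwell β p.2)) ∘ fun u : Vel d (n + m) =>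
        ((fun k => u (Fin.castAdd m k), fun k => u (Fin.natAdd n k)) : Vel d n × Vel d m)) := by
    rw [gaussMeasure]
    congr 1
    funext u
    simp only [Function.comp, maxwell_mul_maxwell]
    rw [maxwell_eq]
    congr 2
    · rw [← Real.rpow_add (by positivity)]; congr 1; push_cast; ring
    · simp [normSq, Fin.sum_univ_add]
  rw [h3]
  exact h2

end gaussian

end KacModel

namespace KacModel

/-! ### Convergence in `L¹` -/

theorem tendsto_eLpNorm_one_of_dominated {X E : Type*} [MeasurableSpace X] {μ : Measure X}
    [NormedAddCommGroup E] {F : ℕ → X → E} {f : X → E} (b : X → ℝ)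
    (hF : ∀ k, AEStronglyMeasurable (F k) μ) (hb : Integrable b μ)
    (hle : ∀ k, ∀ᵐ x ∂μ, ‖F k x‖ ≤ b x)
    (hlim : ∀ᵐ x ∂μ, Tendsto (fun k => F k x) atTop (𝓝 (f x))) :
    Tendsto (fun k => eLpNorm (F k - f) 1 μ) atTop (𝓝 0) := by
  have h := tendsto_lintegral_norm_of_dominated_convergence hF hb.2 hle hlim
  refine h.congr fun k => ?_
  rw [eLpNorm_one_eq_lintegral_enorm]
  simp

theorem tendsto_eLpNorm_one_of_le {X E E' ι : Type*} [MeasurableSpace X] {μ : Measure X}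
    [NormedAddCommGroup E] [NormedAddCommGroup E'] {l : Filter ι} {F : ι → X → E} {f : X → E}
    {G : ι → X → E'} {g : X → E'} (C : ℝ) (h : Tendsto (fun k => eLpNorm (F k - f) 1 μ) l (𝓝 0))
    (hle : ∀ k, ∀ᵐ x ∂μ, ‖G k x - g x‖ ≤ C * ‖F k x - f x‖) :
    Tendsto (fun k => eLpNorm (G k - g) 1 μ) l (𝓝 0) := by
  have h1 : Tendsto (fun k => ENNReal.ofReal C * eLpNorm (F k - f) 1 μ) l (𝓝 0) := by
    have := ENNReal.Tendsto.const_mul (a := ENNReal.ofReal C) h (Or.inr ENNReal.ofReal_ne_top)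
    rwa [mul_zero] at this
  exact tendsto_of_tendsto_of_tendsto_of_le_of_le tendsto_const_nhds h1 (fun _ => zero_le)
    fun k => eLpNorm_le_mul_eLpNorm_of_ae_le_mul (hle k) 1

theorem tendsto_integral_of_eLpNorm_one_le {X E ι : Type*} [MeasurableSpace X] {μ : Measure X}
    [NormedAddCommGroup E] {l : Filter ι} {F : ι → X → E} {f : X → E}
    {G : ι → X → ℝ} {g : X → ℝ} (C : ℝ) (h : Tendsto (fun k => eLpNorm (F k - f) 1 μ) l (𝓝 0))
    (hG : ∀ k, Integrable (G k) μ) (hg : Integrable g μ)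
    (hle : ∀ k, ∀ᵐ x ∂μ, ‖G k x - g x‖ ≤ C * ‖F k x - f x‖) :
    Tendsto (fun k => ∫ x, G k x ∂μ) l (𝓝 (∫ x, g x ∂μ)) :=
  tendsto_integral_of_L1' g hg.1 (Eventually.of_forall hG) (tendsto_eLpNorm_one_of_le C h hle)

/-! ### Weak gradients -/

/-- The gradient of a differentiable function. -/
noncomputable def grad {d n : ℕ} (g : Vel d n → ℝ) (v : Vel d n) : Vel d n := riesz (fderiv ℝ g v)

section weak

variable {d n : ℕ} {β : ℝ}

theorem dot_grad (g : Vel d n → ℝ) (v w : Vel d n) : dot (grad g v) w = fderiv ℝ g v w :=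
  dot_riesz _ _

theorem continuous_grad {g : Vel d n → ℝ} (hg : ContDiff ℝ 1 g) : Continuous (grad g) :=
  continuous_riesz.comp (hg.continuous_fderiv one_ne_zero)

theorem HasWeakGradient.integral_eq' {g : Vel d n → ℝ} {G : Vel d n → Vel d n}
    (h : HasWeakGradient g G) {φ : Vel d n → ℝ} (h1 : ContDiff ℝ ∞ φ) (h2 : HasCompactSupport φ)
    (w : Vel d n) : ∫ v, g v * fderiv ℝ φ v w = -∫ v, dot (G v) w * φ v := by
  simpa only [dot] using h.integral_eq φ h1 h2 w

theorem hasCompactSupport_fderiv_apply {φ : Vel d n → ℝ} (h2 : HasCompactSupport φ) (w : Vel d n) :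
    HasCompactSupport fun v => fderiv ℝ φ v w :=
  (h2.fderiv ℝ).comp_left (g := fun l : Vel d n →L[ℝ] ℝ => l w) rfl

theorem continuous_fderiv_apply' {φ : Vel d n → ℝ} (h1 : ContDiff ℝ 1 φ) (w : Vel d n) :
    Continuous fun v => fderiv ℝ φ v w :=
  (h1.continuous_fderiv one_ne_zero).clm_apply continuous_const

theorem integrable_mul_of_locallyIntegrable {g ψ : Vel d n → ℝ} (hg : LocallyIntegrable g)
    (h1 : Continuous ψ) (h2 : HasCompactSupport ψ) : Integrable fun v => g v * ψ v :=
  hg.integrable_smul_right_of_hasCompactSupport h1 h2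

theorem integrable_dot_mul_of_locallyIntegrable {G : Vel d n → Vel d n} {ψ : Vel d n → ℝ}
    (hG : LocallyIntegrable G) (h1 : Continuous ψ) (h2 : HasCompactSupport ψ) (w : Vel d n) :
    Integrable fun v => dot (G v) w * ψ v := by
  have h := integrable_vel_iff.1 (hG.integrable_smul_left_of_hasCompactSupport h1 h2)
  have h3 := integrable_finsetSum Finset.univ
    fun (p : Fin n × Fin d) _ => (h p.1 p.2).mul_const (w p.1 p.2)
  refine h3.congr (Eventually.of_forall fun v => ?_)
  simp only [dot_eq_sum, Finset.sum_mul, Pi.smul_apply, PiLp.smul_apply, smul_eq_mul]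
  exact Finset.sum_congr rfl fun p _ => by ring

theorem HasWeakGradient.congr {g g' : Vel d n → ℝ} {G G' : Vel d n → Vel d n}
    (h : HasWeakGradient g G) (hg : g =ᵐ[volume] g') (hG : G =ᵐ[volume] G') :
    HasWeakGradient g' G' where
  locallyIntegrable := h.locallyIntegrable.congr hg
  locallyIntegrable_gradient := h.locallyIntegrable_gradient.congr hG
  integral_eq φ h1 h2 w := by
    rw [← integral_congr_ae (f := fun v => g v * fderiv ℝ φ v w), h.integral_eq φ h1 h2 w]
    · congr 1
      refine integral_congr_ae ?_
      filter_upwards [hG] with v hv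
      rw [hv]
    · filter_upwards [hg] with v hv
      rw [hv]

theorem hasWeakGradient_grad {g : Vel d n → ℝ} (hg : ContDiff ℝ 1 g) :
    HasWeakGradient g (grad g) where
  locallyIntegrable := hg.continuous.locallyIntegrable
  locallyIntegrable_gradient := (continuous_grad hg).locallyIntegrable
  integral_eq φ h1 h2 w := by
    have h1' : ContDiff ℝ 1 φ := h1.of_le (by norm_cast)
    have := integral_mul_fderiv_eq_neg_fderiv_mul_of_integrable (μ := (volume : Measure (Vel d n)))
      (f := g) (g := φ) (v := w)
      (((continuous_fderiv_apply' hg w).mul h1.continuous).integrable_of_hasCompactSupport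
        h2.mul_left)
      ((hg.continuous.mul (continuous_fderiv_apply' h1' w)).integrable_of_hasCompactSupport
        (hasCompactSupport_fderiv_apply h2 w).mul_left)
      ((hg.continuous.mul h1.continuous).integrable_of_hasCompactSupport h2.mul_left)
      (fun x _ => (hg.differentiable one_ne_zero) x) (fun x _ => (h1'.differentiable one_ne_zero) x)
    rw [this]
    congr 2
    funext v
    rw [← dot_grad, dot]

/-- The defining identity of `G` is tested with `χ φ`; the term in which the derivative falls on `χ`
moves to the other side. -/
theorem HasWeakGradient.smooth_mul {g : Vel d n → ℝ} {G : Vel d n → Vel d n}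
    (h : HasWeakGradient g G) {χ : Vel d n → ℝ} (hχ : ContDiff ℝ ∞ χ) :
    HasWeakGradient (fun v => χ v * g v) (fun v => χ v • G v + g v • grad χ v) := by
  have hχ1 : ContDiff ℝ 1 χ := hχ.of_le (by norm_cast)
  have hl : ∀ {E : Type} [NormedAddCommGroup E] [NormedSpace ℝ E] {f : Vel d n → E},
      LocallyIntegrable f → LocallyIntegrable fun v => χ v • f v := fun {E} _ _ {f} hf =>
    locallyIntegrableOn_univ.1 ((hf.locallyIntegrableOn univ).continuousOn_smul
      isOpen_univ.isLocallyClosed hχ.continuous.continuousOn)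
  have hl2 : LocallyIntegrable fun v => g v • grad χ v :=
    locallyIntegrableOn_univ.1 ((h.locallyIntegrable.locallyIntegrableOn univ).smul_continuousOn
      isOpen_univ.isLocallyClosed (continuous_grad hχ1).continuousOn)
  refine ⟨hl h.locallyIntegrable, (hl h.locallyIntegrable_gradient).add hl2, ?_⟩
  intro φ h1 h2 w
  have h1' : ContDiff ℝ 1 φ := h1.of_le (by norm_cast)
  have hχφ : ContDiff ℝ ∞ fun v => χ v * φ v := hχ.mul h1
  have hχφc : HasCompactSupport fun v => χ v * φ v := h2.mul_left
  have key := h.integral_eq' hχφ hχφc w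
  have hfd : ∀ v, fderiv ℝ (fun v => χ v * φ v) v w =
      χ v * fderiv ℝ φ v w + φ v * fderiv ℝ χ v w := fun v => by
    rw [fderiv_fun_mul (hχ1.differentiable one_ne_zero v) (h1'.differentiable one_ne_zero v)]
    simp
  have i1 : Integrable fun v => g v * (χ v * fderiv ℝ φ v w) :=
    integrable_mul_of_locallyIntegrable h.locallyIntegrable
      (hχ.continuous.mul (continuous_fderiv_apply' h1' w))
      (hasCompactSupport_fderiv_apply h2 w).mul_left
  have i2 : Integrable fun v => g v * (φ v * fderiv ℝ χ v w) :=
    integrable_mul_of_locallyIntegrable h.locallyIntegrable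
      (h1.continuous.mul (continuous_fderiv_apply' hχ1 w)) h2.mul_right
  have i3 : Integrable fun v => dot (G v) w * (χ v * φ v) :=
    integrable_dot_mul_of_locallyIntegrable h.locallyIntegrable_gradient hχφ.continuous hχφc w
  have e1 : ∫ v, g v * fderiv ℝ (fun v => χ v * φ v) v w =
      (∫ v, g v * (χ v * fderiv ℝ φ v w)) + ∫ v, g v * (φ v * fderiv ℝ χ v w) := by
    rw [← integral_add i1 i2]
    congr 1; funext v; rw [hfd]; ring
  have e2 : ∫ v, (∑ k, inner ℝ ((χ v • G v + g v • grad χ v) k) (w k)) * φ v =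
      (∫ v, dot (G v) w * (χ v * φ v)) + ∫ v, g v * (φ v * fderiv ℝ χ v w) := by
    rw [← integral_add i3 i2]
    congr 1; funext v
    have := dot_add_left (χ v • G v) (g v • grad χ v) w
    rw [dot] at this
    rw [this, dot_smul_left, dot_smul_left, dot_grad]; ring
  rw [e2]
  have e3 : ∫ v, χ v * g v * fderiv ℝ φ v w = ∫ v, g v * (χ v * fderiv ℝ φ v w) := by
    congr 1; funext v; ring
  rw [e3]
  linarith

/-- A test function or its derivative, divided by the Gaussian density, is still bounded.
Convergence in `L¹(γ)` thus suffices to pass to the limit in the defining identity. -/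
theorem HasWeakGradient.of_tendsto (hβ : 0 < β) {gk : ℕ → Vel d n → ℝ}
    {Gk : ℕ → Vel d n → Vel d n} {g : Vel d n → ℝ} {G : Vel d n → Vel d n}
    (h : ∀ k, HasWeakGradient (gk k) (Gk k))
    (hg : Integrable g (gaussMeasure β d n)) (hG : Integrable G (gaussMeasure β d n))
    (hgk : ∀ k, Integrable (gk k) (gaussMeasure β d n))
    (hGk : ∀ k, Integrable (Gk k) (gaussMeasure β d n))
    (lim : Tendsto (fun k => eLpNorm (gk k - g) 1 (gaussMeasure β d n)) atTop (𝓝 0))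
    (limG : Tendsto (fun k => eLpNorm (Gk k - G) 1 (gaussMeasure β d n)) atTop (𝓝 0)) :
    HasWeakGradient g G := by
  refine ⟨locallyIntegrable_of_gaussMeasure hβ hg, locallyIntegrable_of_gaussMeasure hβ hG, ?_⟩
  intro φ h1 h2 w
  have h1' : ContDiff ℝ 1 φ := h1.of_le (by norm_cast)
  have hinv : Continuous fun v : Vel d n => (maxwell β v)⁻¹ :=
    continuous_maxwell.inv₀ fun v => (maxwell_pos hβ v).ne'
  set ψ : Vel d n → ℝ := fun v => (maxwell β v)⁻¹ * fderiv ℝ φ v w with hψ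
  set η : Vel d n → ℝ := fun v => (maxwell β v)⁻¹ * φ v with hη
  have cψ : Continuous ψ := hinv.mul (continuous_fderiv_apply' h1' w)
  have cη : Continuous η := hinv.mul h1.continuous
  have sψ : HasCompactSupport ψ := (hasCompactSupport_fderiv_apply h2 w).mul_left
  have sη : HasCompactSupport η := h2.mul_left
  obtain ⟨K, hK⟩ := cψ.bounded_above_of_compact_support sψ
  obtain ⟨K', hK'⟩ := cη.bounded_above_of_compact_support sη
  have e1 : ∀ f : Vel d n → ℝ, ∫ v, f v * fderiv ℝ φ v w =
      ∫ v, f v * ψ v ∂gaussMeasure β d n := fun f => by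
    rw [integral_gaussMeasure hβ]
    congr 1; funext v
    have := (maxwell_pos hβ v).ne'
    simp only [hψ, smul_eq_mul]; field_simp
  have e2 : ∀ F : Vel d n → Vel d n, ∫ v, (∑ k, inner ℝ (F v k) (w k)) * φ v =
      ∫ v, dot (F v) w * η v ∂gaussMeasure β d n := fun F => by
    rw [integral_gaussMeasure hβ]
    congr 1; funext v
    have := (maxwell_pos hβ v).ne'
    simp only [hη, smul_eq_mul, dot]; field_simp
  have i1 : ∀ f : Vel d n → ℝ, Integrable f (gaussMeasure β d n) →
      Integrable (fun v => f v * ψ v) (gaussMeasure β d n) := fun f hf =>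
    hf.mul_bdd (c := K) cψ.aestronglyMeasurable (Eventually.of_forall hK)
  have i2 : ∀ F : Vel d n → Vel d n, Integrable F (gaussMeasure β d n) →
      Integrable (fun v => dot (F v) w * η v) (gaussMeasure β d n) := fun F hF => by
    refine Integrable.mul_bdd (c := K') ?_ cη.aestronglyMeasurable (Eventually.of_forall hK')
    simp only [dot_eq_sum]
    exact integrable_finsetSum _ fun p _ => (integrable_vel_iff.1 hF p.1 p.2).mul_const _
  have t1 := tendsto_integral_of_eLpNorm_one_le K lim (fun k => i1 _ (hgk k)) (i1 _ hg)
    (fun k => Eventually.of_forall fun v => by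
      rw [← sub_mul, norm_mul, mul_comm]
      exact mul_le_mul_of_nonneg_right (hK v) (norm_nonneg _))
  have t2 := tendsto_integral_of_eLpNorm_one_le (n * ‖w‖ * K') limG (fun k => i2 _ (hGk k))
    (i2 _ hG) (fun k => Eventually.of_forall fun v => by
      have : dot (Gk k v) w * η v - dot (G v) w * η v = dot (Gk k v - G v) w * η v := by
        rw [sub_eq_add_neg (Gk k v), ← neg_one_smul ℝ (G v), dot_add_left, dot_smul_left]; ring
      rw [this, norm_mul, Real.norm_eq_abs]
      calc _ ≤ n * (‖Gk k v - G v‖ * ‖w‖) * K' :=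
            mul_le_mul (abs_dot_le _ _) (hK' v) (norm_nonneg _) (by positivity)
        _ = _ := by ring)
  rw [e1, e2]
  refine tendsto_nhds_unique t1 (t2.neg.congr fun k => ?_)
  rw [← e1, ← e2, (h k).integral_eq φ h1 h2 w]

end weak

/-! ### Mollification -/

/-- A sequence of bump functions with shrinking supports. -/
noncomputable def bump (d n k : ℕ) : ContDiffBump (0 : Vel d n) where
  rIn := 1 / (2 * ((k : ℝ) + 1))
  rOut := 1 / ((k : ℝ) + 1)
  rIn_pos := by positivity
  rIn_lt_rOut := by
    apply one_div_lt_one_div_of_lt <;> linarith [(Nat.cast_nonneg k : (0 : ℝ) ≤ k)]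

/-- The mollification of a locally integrable function. -/
noncomputable def moll {d n : ℕ} {E : Type*} [NormedAddCommGroup E] [NormedSpace ℝ E] (k : ℕ)
    (g : Vel d n → E) : Vel d n → E :=
  convolution ((bump d n k).normed volume) g (ContinuousLinearMap.lsmul ℝ ℝ) volume

section moll

variable {d n : ℕ} {β : ℝ} {E : Type*} [NormedAddCommGroup E] [NormedSpace ℝ E]

instance : (volume : Measure (Vel d n)).IsNegInvariant :=
  Measure.pi.isNegInvariant _

theorem moll_apply (k : ℕ) (g : Vel d n → E) (x : Vel d n) :
    moll k g x = ∫ t, (bump d n k).normed volume t • g (x - t) := rfl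

theorem moll_apply' (k : ℕ) (g : Vel d n → E) (x : Vel d n) :
    moll k g x = ∫ t, (bump d n k).normed volume (x - t) • g t := by
  rw [moll, convolution_eq_swap]; rfl

theorem tendsto_rOut_bump : Tendsto (fun k => (bump d n k).rOut) atTop (𝓝 0) :=
  tendsto_one_div_add_atTop_nhds_zero_nat

theorem integrable_moll_integrand (k : ℕ) {g : Vel d n → E} (hg : LocallyIntegrable g)
    (x : Vel d n) : Integrable fun t => (bump d n k).normed volume t • g (x - t) :=
  (bump d n k).hasCompactSupport_normed.convolutionExists_left
    (ContinuousLinearMap.lsmul ℝ ℝ) (bump d n k).continuous_normed hg x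

theorem contDiff_moll (k : ℕ) {g : Vel d n → E} (hg : LocallyIntegrable g) :
    ContDiff ℝ ∞ (moll k g) :=
  (bump d n k).hasCompactSupport_normed.contDiff_convolution_left _
    (bump d n k).contDiff_normed hg

theorem hasCompactSupport_moll (k : ℕ) {g : Vel d n → E} (hg : HasCompactSupport g) :
    HasCompactSupport (moll k g) :=
  (bump d n k).hasCompactSupport_normed.convolution _ hg

theorem ae_tendsto_moll [CompleteSpace E] {g : Vel d n → E} (hg : LocallyIntegrable g) :
    ∀ᵐ x, Tendsto (fun k => moll k g x) atTop (𝓝 (g x)) := by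
  refine ContDiffBump.ae_convolution_tendsto_right_of_locallyIntegrable (K := 2) tendsto_rOut_bump
    (Eventually.of_forall fun k => ?_) hg
  change 1 / ((k : ℝ) + 1) ≤ 2 * (1 / (2 * ((k : ℝ) + 1)))
  apply le_of_eq; field_simp

theorem norm_moll_le (k : ℕ) {g : Vel d n → E} (x : Vel d n) :
    ‖moll k g x‖ ≤ moll k (fun v => ‖g v‖) x := by
  rw [moll_apply, moll_apply]
  refine (norm_integral_le_integral_norm _).trans (le_of_eq ?_)
  congr 1; funext t
  rw [norm_smul, Real.norm_of_nonneg ((bump d n k).nonneg_normed t), smul_eq_mul]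

theorem integrable_moll (k : ℕ) {g : Vel d n → E} (hg : Integrable g) : Integrable (moll k g) :=
  Integrable.integrable_convolution (ContinuousLinearMap.lsmul ℝ ℝ)
    (bump d n k).integrable_normed hg

theorem integral_moll [CompleteSpace E] (k : ℕ) {g : Vel d n → E} (hg : Integrable g) :
    ∫ x, moll k g x = ∫ x, g x := by
  rw [moll, integral_convolution (ContinuousLinearMap.lsmul ℝ ℝ)
    (bump d n k).integrable_normed hg, (bump d n k).integral_normed]
  simp

theorem fderiv_moll_apply (k : ℕ) {g : Vel d n → ℝ} (hg : LocallyIntegrable g) (x w : Vel d n) :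
    fderiv ℝ (moll k g) x w = ∫ t, fderiv ℝ ((bump d n k).normed volume) (x - t) w * g t := by
  have hc := (bump d n k).hasCompactSupport_normed (μ := volume)
  have hs : ContDiff ℝ 1 ((bump d n k).normed volume) := (bump d n k).contDiff_normed
  have h := hc.hasFDerivAt_convolution_left (ContinuousLinearMap.lsmul ℝ ℝ) hs hg x
  change HasFDerivAt (moll k g) _ x at h
  rw [h.fderiv, convolution_eq_swap]
  have := (hc.fderiv ℝ).convolutionExists_left
      ((ContinuousLinearMap.lsmul ℝ ℝ : ℝ →L[ℝ] ℝ →L[ℝ] ℝ).precompL (Vel d n))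
      (hs.continuous_fderiv one_ne_zero) hg x
  exact ContinuousLinearMap.integral_apply this.integrable_swap w

/-- The derivative of the convolution falls on the kernel, and `t ↦ φ(x - t)` is an admissible test
function. The sign from differentiating `x - t` cancels the sign of the integration by parts. -/
theorem HasWeakGradient.grad_moll {g : Vel d n → ℝ} {G : Vel d n → Vel d n}
    (h : HasWeakGradient g G) (k : ℕ) : grad (moll k g) = moll k G := by
  funext x
  have hs : ContDiff ℝ ∞ ((bump d n k).normed volume) := (bump d n k).contDiff_normed
  have hc := (bump d n k).hasCompactSupport_normed (μ := volume)
  have hi : Integrable fun t => (bump d n k).normed volume (x - t) • G t :=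
    ((bump d n k).hasCompactSupport_normed.convolutionExists_left
      (ContinuousLinearMap.lsmul ℝ ℝ) (bump d n k).continuous_normed
      h.locallyIntegrable_gradient x).integrable_swap
  funext l
  ext a
  rw [grad, riesz_apply, fderiv_moll_apply k h.locallyIntegrable]
  set p : Vel d n := basisVec (l, a) with hp
  have hψ : ContDiff ℝ ∞ fun t => (bump d n k).normed volume (x - t) :=
    hs.comp (contDiff_const.sub contDiff_id)
  have hψc : HasCompactSupport fun t => (bump d n k).normed volume (x - t) :=
    hc.comp_homeomorph (Homeomorph.subLeft x)
  have h3 := h.integral_eq' hψ hψc p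
  have h4 : ∀ t, fderiv ℝ (fun t => (bump d n k).normed volume (x - t)) t p =
      -fderiv ℝ ((bump d n k).normed volume) (x - t) p := fun t => by
    have := (hs.differentiable (by simp) (x - t)).hasFDerivAt.comp t
      ((hasFDerivAt_const x t).sub (hasFDerivAt_id t))
    rw [HasFDerivAt.fderiv (f := fun t => (bump d n k).normed volume (x - t)) this]
    simp
  simp only [h4, mul_neg, integral_neg, neg_inj] at h3
  have h5 : (fun t => fderiv ℝ ((bump d n k).normed volume) (x - t) p * g t) =
    fun t => g t * fderiv ℝ ((bump d n k).normed volume) (x - t) p := by funext t; ring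
  rw [h5, h3, moll_apply']
  have h6 := ((PiLp.proj 2 (fun _ : Fin d => ℝ) a : EuclideanSpace ℝ (Fin d) →L[ℝ] ℝ).comp
      (ContinuousLinearMap.proj (R := ℝ) (φ := fun _ : Fin n => EuclideanSpace ℝ (Fin d)) l)
      ).integral_comp_comm hi
  refine Eq.trans ?_ h6
  congr 1; funext t
  rw [hp, dot_basisVec]
  simp [mul_comm]

/-- Fatou's lemma applied to `A k = |g| + moll k |g| - |moll k g - g|`, which is nonnegative and
tends to `2 |g|` almost everywhere. Mollification preserves the integral, so `∫ A k` is `2 ∫ |g|`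
minus the distance sought, and this distance must vanish in the limit. -/
theorem tendsto_eLpNorm_moll [CompleteSpace E] {g : Vel d n → E} (hg : Integrable g) :
    Tendsto (fun k => eLpNorm (moll k g - g) 1 volume) atTop (𝓝 0) := by
  set A : ℕ → Vel d n → ℝ := fun k x => ‖g x‖ + moll k (fun v => ‖g v‖) x - ‖moll k g x - g x‖
  have hA0 : ∀ k x, 0 ≤ A k x := fun k x => by
    have h1 := norm_moll_le k (g := g) x
    have h2 := norm_sub_le (moll k g x) (g x)
    simp only [A]; linarith
  have hi1 : ∀ k, Integrable (moll k fun v => ‖g v‖) := fun k => integrable_moll k hg.norm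
  have hi2 : ∀ k, Integrable fun x => moll k g x - g x := fun k => (integrable_moll k hg).sub hg
  have hiA : ∀ k, Integrable (A k) := fun k => (hg.norm.add (hi1 k)).sub (hi2 k).norm
  set I := ∫ x, ‖g x‖ with hI
  have hIA : ∀ k, ∫ x, A k x = 2 * I - ∫ x, ‖moll k g x - g x‖ := fun k => by
    simp only [A]
    have h0 := hg.norm.add (hi1 k)
    simp only [Pi.add_def] at h0
    rw [integral_sub h0 (hi2 k).norm, integral_add hg.norm (hi1 k),
      integral_moll k hg.norm]
    ring
  have hae : ∀ᵐ x, Tendsto (fun k => ENNReal.ofReal (A k x)) atTop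
      (𝓝 (ENNReal.ofReal (2 * ‖g x‖))) := by
    filter_upwards [ae_tendsto_moll hg.locallyIntegrable,
      ae_tendsto_moll hg.norm.locallyIntegrable] with x h1 h2
    refine (ENNReal.continuous_ofReal.tendsto _).comp ?_
    have h3 : Tendsto (fun k => ‖moll k g x - g x‖) atTop (𝓝 0) := by
      have := (h1.sub_const (g x)).norm; simpa using this
    have := (h2.const_add ‖g x‖).sub h3
    convert this using 2; ring
  have hF := lintegral_liminf_le' (μ := volume) (u := atTop)
    (f := fun k x => ENNReal.ofReal (A k x)) fun k => (hiA k).1.aemeasurable.ennreal_ofReal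
  have e1 : ∫⁻ x, liminf (fun k => ENNReal.ofReal (A k x)) atTop = ENNReal.ofReal (2 * I) := by
    rw [lintegral_congr_ae (g := fun x => ENNReal.ofReal (2 * ‖g x‖))
      (by filter_upwards [hae] with x hx using hx.liminf_eq),
      ← ofReal_integral_eq_lintegral_ofReal (hg.norm.const_mul 2)
        (Eventually.of_forall fun x => by positivity), integral_const_mul]
  have e2 : ∀ k, ∫⁻ x, ENNReal.ofReal (A k x) =
      ENNReal.ofReal (2 * I - ∫ x, ‖moll k g x - g x‖) := fun k => by
    rw [← ofReal_integral_eq_lintegral_ofReal (hiA k) (Eventually.of_forall (hA0 k)), hIA]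
  rw [e1] at hF
  simp only [e2] at hF
  have hI0 : 0 ≤ I := integral_nonneg fun _ => norm_nonneg _
  have t1 : Tendsto (fun k => ENNReal.ofReal (2 * I - ∫ x, ‖moll k g x - g x‖)) atTop
      (𝓝 (ENNReal.ofReal (2 * I))) := by
    refine tendsto_of_le_liminf_of_limsup_le hF ?_
    refine limsup_le_of_le (h := Eventually.of_forall fun k => ENNReal.ofReal_le_ofReal ?_)
    have : 0 ≤ ∫ x, ‖moll k g x - g x‖ := integral_nonneg fun _ => norm_nonneg _
    linarith
  have t2 := ENNReal.Tendsto.sub (tendsto_const_nhds (x := ENNReal.ofReal (2 * I))) t1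
    (Or.inl ENNReal.ofReal_ne_top)
  rw [tsub_self] at t2
  refine t2.congr fun k => ?_
  have hn : 0 ≤ 2 * I - ∫ x, ‖moll k g x - g x‖ := by
    rw [← hIA]; exact integral_nonneg (hA0 k)
  rw [← ENNReal.ofReal_sub _ hn, sub_sub_cancel, eLpNorm_one_eq_lintegral_enorm,
    ofReal_integral_norm_eq_lintegral_enorm (hi2 k)]
  rfl

end moll

end KacModel

namespace KacModel

theorem integrable_bdd_smul {X E : Type*} [MeasurableSpace X] {μ : Measure X}
    [NormedAddCommGroup E] [NormedSpace ℝ E] {f : X → E} {φ : X → ℝ} (hf : Integrable f μ) (C : ℝ)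
    (hφ : AEStronglyMeasurable φ μ) (hC : ∀ x, ‖φ x‖ ≤ C) : Integrable (fun x => φ x • f x) μ :=
  hf.bdd_smul C hφ (Eventually.of_forall hC)

theorem hasCompactSupport_smul_left {X E : Type*} [TopologicalSpace X]
    [NormedAddCommGroup E] [NormedSpace ℝ E] {f : X → E} (hf : HasCompactSupport f) (φ : X → ℝ) :
    HasCompactSupport fun x => φ x • f x :=
  hf.smul_left

/-! ### Cutoff functions -/

/-- A fixed bump function, equal to one on the unit ball. -/
noncomputable def unitBump (d n : ℕ) : ContDiffBump (0 : Vel d n) where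
  rIn := 1
  rOut := 2
  rIn_pos := one_pos
  rIn_lt_rOut := one_lt_two

/-- A sequence of cutoff functions which increases to one. -/
noncomputable def cutoff {d n : ℕ} (k : ℕ) (v : Vel d n) : ℝ :=
  unitBump d n (((k : ℝ) + 1)⁻¹ • v)

section cutoff

variable {d n : ℕ} {β : ℝ}

theorem contDiff_cutoff (k : ℕ) : ContDiff ℝ ∞ (cutoff k : Vel d n → ℝ) :=
  (unitBump d n).contDiff.comp (contDiff_const_smul _)

theorem hasCompactSupport_cutoff (k : ℕ) : HasCompactSupport (cutoff k : Vel d n → ℝ) :=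
  (unitBump d n).hasCompactSupport.comp_smul (by positivity)

theorem cutoff_nonneg (k : ℕ) (v : Vel d n) : 0 ≤ cutoff k v := (unitBump d n).nonneg

theorem cutoff_le_one (k : ℕ) (v : Vel d n) : cutoff k v ≤ 1 := (unitBump d n).le_one

theorem norm_cutoff_le (k : ℕ) (v : Vel d n) : ‖cutoff k v‖ ≤ 1 := by
  rw [Real.norm_of_nonneg (cutoff_nonneg k v)]; exact cutoff_le_one k v

theorem tendsto_cutoff (v : Vel d n) : Tendsto (fun k => cutoff k v) atTop (𝓝 1) := by
  obtain ⟨K, hK⟩ := exists_nat_ge ‖v‖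
  refine tendsto_const_nhds.congr' ?_
  filter_upwards [eventually_ge_atTop K] with k hk
  refine ((unitBump d n).one_of_mem_closedBall ?_).symm
  rw [mem_closedBall_zero_iff, norm_smul, Real.norm_of_nonneg (by positivity)]
  change ((k : ℝ) + 1)⁻¹ * ‖v‖ ≤ 1
  rw [inv_mul_le_iff₀ (by positivity)]
  have : (K : ℝ) ≤ k := by exact_mod_cast hk
  linarith

/-- Dilating a fixed bump divides its gradient by the dilation factor; this kills the term `g ∇χ`
when a cutoff is removed. -/
theorem exists_norm_grad_cutoff_le (d n : ℕ) :
    ∃ C : ℝ, 0 ≤ C ∧ ∀ (k : ℕ) (v : Vel d n), ‖grad (cutoff k) v‖ ≤ C * ((k : ℝ) + 1)⁻¹ := by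
  have hs : ContDiff ℝ 1 (unitBump d n) := (unitBump d n).contDiff
  obtain ⟨C, hC⟩ := ((hs.continuous_fderiv one_ne_zero).bounded_above_of_compact_support
    ((unitBump d n).hasCompactSupport.fderiv ℝ))
  have hC0 : 0 ≤ C := (norm_nonneg _).trans (hC 0)
  refine ⟨(n * d : ℕ) * C, by positivity, fun k v => ?_⟩
  have h : HasFDerivAt (cutoff k : Vel d n → ℝ)
      ((fderiv ℝ (unitBump d n) (((k : ℝ) + 1)⁻¹ • v)).comp
        (((k : ℝ) + 1)⁻¹ • ContinuousLinearMap.id ℝ (Vel d n))) v :=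
    (hs.differentiable one_ne_zero _).hasFDerivAt.comp v
      ((hasFDerivAt_id v).const_smul ((k : ℝ) + 1)⁻¹)
  have h2 : ‖fderiv ℝ (cutoff k : Vel d n → ℝ) v‖ ≤ C * ((k : ℝ) + 1)⁻¹ := by
    rw [h.fderiv, ContinuousLinearMap.comp_smul, ContinuousLinearMap.comp_id, norm_smul,
      Real.norm_of_nonneg (by positivity), mul_comm]
    exact mul_le_mul_of_nonneg_right (hC _) (by positivity)
  calc ‖grad (cutoff k) v‖ ≤ (n * d : ℕ) * ‖fderiv ℝ (cutoff k : Vel d n → ℝ) v‖ :=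
        norm_riesz_le _
    _ ≤ (n * d : ℕ) * (C * ((k : ℝ) + 1)⁻¹) := by gcongr
    _ = _ := by ring

theorem integrable_of_hasCompactSupport {E : Type*} [NormedAddCommGroup E] {g : Vel d n → E}
    (hg : LocallyIntegrable g) (hc : HasCompactSupport g) : Integrable g :=
  (integrableOn_iff_integrable_of_support_subset (subset_tsupport g)).1
    (hg.integrableOn_isCompact hc)

theorem eLpNorm_gaussMeasure_le {E : Type*} [NormedAddCommGroup E] (hβ : 0 < β)
    (g : Vel d n → E) : eLpNorm g 1 (gaussMeasure β d n) ≤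
      ENNReal.ofReal ((β / (2 * Real.pi)) ^ (((d * n : ℕ) : ℝ) / 2)) * eLpNorm g 1 volume := by
  rw [eLpNorm_one_eq_lintegral_enorm, eLpNorm_one_eq_lintegral_enorm, lintegral_gaussMeasure,
    ← lintegral_const_mul' _ _ ENNReal.ofReal_ne_top]
  refine lintegral_mono fun v => ?_
  gcongr
  exact maxwell_le hβ v

theorem tendsto_eLpNorm_gaussMeasure {E : Type*} [NormedAddCommGroup E] (hβ : 0 < β)
    {F : ℕ → Vel d n → E} {f : Vel d n → E}
    (h : Tendsto (fun k => eLpNorm (F k - f) 1 volume) atTop (𝓝 0)) :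
    Tendsto (fun k => eLpNorm (F k - f) 1 (gaussMeasure β d n)) atTop (𝓝 0) := by
  have h1 := ENNReal.Tendsto.const_mul
    (a := ENNReal.ofReal ((β / (2 * Real.pi)) ^ (((d * n : ℕ) : ℝ) / 2))) h
    (Or.inr ENNReal.ofReal_ne_top)
  rw [mul_zero] at h1
  exact tendsto_of_tendsto_of_tendsto_of_le_of_le tendsto_const_nhds h1 (fun _ => zero_le)
    fun k => eLpNorm_gaussMeasure_le hβ _

theorem integrable_gaussMeasure_of_continuous {E : Type*} [NormedAddCommGroup E] [NormedSpace ℝ E]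
    (hβ : 0 < β) {g : Vel d n → E}
    (hg : Continuous g) (hc : HasCompactSupport g) : Integrable g (gaussMeasure β d n) :=
  integrable_gaussMeasure_of_volume hβ (hg.integrable_of_hasCompactSupport hc)

theorem hasCompactSupport_grad {g : Vel d n → ℝ} (hc : HasCompactSupport g) :
    HasCompactSupport (grad g) :=
  (hc.fderiv ℝ).comp_left (g := (riesz : (Vel d n →L[ℝ] ℝ) → Vel d n))
    (by funext k; ext a; simp [riesz_apply])

/-- The functions with integrable weak gradients are limits of test functions. -/
theorem HasWeakGradient.exists_seq (hβ : 0 < β) {g : Vel d n → ℝ} {G : Vel d n → Vel d n}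
    (h : HasWeakGradient g G) (hg : Integrable g (gaussMeasure β d n))
    (hG : Integrable G (gaussMeasure β d n)) :
    ∃ gk : ℕ → Vel d n → ℝ, (∀ k, ContDiff ℝ ∞ (gk k)) ∧ (∀ k, HasCompactSupport (gk k)) ∧
      Tendsto (fun k => eLpNorm (gk k - g) 1 (gaussMeasure β d n)) atTop (𝓝 0) ∧
      Tendsto (fun k => eLpNorm (grad (gk k) - G) 1 (gaussMeasure β d n)) atTop (𝓝 0) := by
  set γ := gaussMeasure β d n with hγ
  obtain ⟨C, hC0, hC⟩ := exists_norm_grad_cutoff_le d n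
  have hχc : ∀ k, Continuous (cutoff k : Vel d n → ℝ) := fun k => (contDiff_cutoff k).continuous
  have hgc : ∀ k, Continuous (grad (cutoff k : Vel d n → ℝ)) := fun k =>
    continuous_grad ((contDiff_cutoff k).of_le (by norm_cast))
  set g1 : ℕ → Vel d n → ℝ := fun k v => cutoff k v * g v with hg1
  set G1 : ℕ → Vel d n → Vel d n := fun k v => cutoff k v • G v + g v • grad (cutoff k) v with hG1
  have hw : ∀ k, HasWeakGradient (g1 k) (G1 k) := fun k => h.smooth_mul (contDiff_cutoff k)
  have t1 : Tendsto (fun k => eLpNorm (g1 k - g) 1 γ) atTop (𝓝 0) := by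
    refine tendsto_eLpNorm_one_of_dominated (fun v => ‖g v‖)
      (fun k => (hχc k).aestronglyMeasurable.mul hg.1) hg.norm
      (fun k => Eventually.of_forall fun v => ?_) (Eventually.of_forall fun v => ?_)
    · rw [norm_mul]
      exact mul_le_of_le_one_left (norm_nonneg _) (norm_cutoff_le k v)
    · have := (tendsto_cutoff v).mul_const (g v)
      rwa [one_mul] at this
  have hk1 : ∀ k : ℕ, ((k : ℝ) + 1)⁻¹ ≤ 1 := fun k => by
    apply inv_le_one_of_one_le₀; linarith [(Nat.cast_nonneg k : (0 : ℝ) ≤ k)]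
  have T1 : Tendsto (fun k => eLpNorm (G1 k - G) 1 γ) atTop (𝓝 0) := by
    refine tendsto_eLpNorm_one_of_dominated (fun v => ‖G v‖ + ‖g v‖ * C)
      (fun k => ((hχc k).aestronglyMeasurable.smul hG.1).add
        (hg.1.smul (hgc k).aestronglyMeasurable)) (hG.norm.add (hg.norm.mul_const _))
      (fun k => Eventually.of_forall fun v => ?_) (Eventually.of_forall fun v => ?_)
    · refine (norm_add_le _ _).trans (add_le_add ?_ ?_)
      · rw [norm_smul]
        exact mul_le_of_le_one_left (norm_nonneg _) (norm_cutoff_le k v)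
      · rw [norm_smul]
        refine mul_le_mul_of_nonneg_left ((hC k v).trans ?_) (norm_nonneg _)
        exact mul_le_of_le_one_right hC0 (hk1 k)
    · have h1 := (tendsto_cutoff v).smul_const (G v)
      have h2 : Tendsto (fun k => grad (cutoff k) v) atTop (𝓝 0) := by
        refine squeeze_zero_norm (hC · v) ?_
        have := (tendsto_inv_atTop_zero.comp
          (tendsto_atTop_add_const_right atTop (1 : ℝ) tendsto_natCast_atTop_atTop)).const_mul C
        simpa using this
      have := h1.add (h2.const_smul (g v))
      simpa using this
  have hc1 : ∀ k, HasCompactSupport (g1 k) := fun k => (hasCompactSupport_cutoff k).mul_right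
  have hC1 : ∀ k, HasCompactSupport (G1 k) := fun k =>
    (hasCompactSupport_cutoff k).smul_right.add
      (hasCompactSupport_smul_left (hasCompactSupport_grad (hasCompactSupport_cutoff k)) g)
  have hi1 : ∀ k, Integrable (g1 k) := fun k =>
    integrable_of_hasCompactSupport (hw k).locallyIntegrable (hc1 k)
  have hI1 : ∀ k, Integrable (G1 k) := fun k =>
    integrable_of_hasCompactSupport (hw k).locallyIntegrable_gradient (hC1 k)
  -- After the cutoff, function and gradient are integrable for Lebesgue measure, where
  -- mollification converges. The mollification index may depend on `k`, and one index serves for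
  -- both errors.
  have key : ∀ k : ℕ, ∃ m : ℕ,
      eLpNorm (moll m (g1 k) - g1 k) 1 γ ≤ ((k : ℝ≥0∞) + 1)⁻¹ ∧
      eLpNorm (moll m (G1 k) - G1 k) 1 γ ≤ ((k : ℝ≥0∞) + 1)⁻¹ := fun k => by
    have hpos : (0 : ℝ≥0∞) < ((k : ℝ≥0∞) + 1)⁻¹ := by
      simp [ENNReal.inv_pos]
    have a1 := (tendsto_eLpNorm_gaussMeasure hβ (tendsto_eLpNorm_moll (hi1 k))).eventually_le_const
      hpos
    have a2 := (tendsto_eLpNorm_gaussMeasure hβ (tendsto_eLpNorm_moll (hI1 k))).eventually_le_const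
      hpos
    exact (a1.and a2).exists
  choose m hm1 hm2 using key
  have hlim : Tendsto (fun k : ℕ => ((k : ℝ≥0∞) + 1)⁻¹) atTop (𝓝 0) := by
    have := (tendsto_add_atTop_iff_nat 1).2 ENNReal.tendsto_inv_nat_nhds_zero
    simpa using this
  have hmoll : ∀ k, ContDiff ℝ ∞ (moll (m k) (g1 k)) := fun k =>
    contDiff_moll _ (hw k).locallyIntegrable
  refine ⟨fun k => moll (m k) (g1 k), hmoll, fun k => hasCompactSupport_moll _ (hc1 k), ?_, ?_⟩
  · refine tendsto_of_tendsto_of_tendsto_of_le_of_le tendsto_const_nhds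
      (by simpa using hlim.add t1) (fun _ => zero_le) fun k => ?_
    have e : moll (m k) (g1 k) - g = (moll (m k) (g1 k) - g1 k) + (g1 k - g) := by abel
    simp only
    rw [e]
    have i1 : Integrable (g1 k) γ := integrable_gaussMeasure_of_volume hβ (hi1 k)
    refine (eLpNorm_add_le ?_ (i1.1.sub hg.1) le_rfl).trans (add_le_add (hm1 k) le_rfl)
    exact (hmoll k).continuous.aestronglyMeasurable.sub i1.1
  · refine tendsto_of_tendsto_of_tendsto_of_le_of_le tendsto_const_nhds
      (by simpa using hlim.add T1) (fun _ => zero_le) fun k => ?_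
    have e : grad (moll (m k) (g1 k)) - G = (moll (m k) (G1 k) - G1 k) + (G1 k - G) := by
      rw [(hw k).grad_moll]; abel
    simp only
    rw [e]
    have i1 : Integrable (G1 k) γ := integrable_gaussMeasure_of_volume hβ (hI1 k)
    refine (eLpNorm_add_le ?_ (i1.1.sub hG.1) le_rfl).trans (add_le_add (hm2 k) le_rfl)
    exact (contDiff_moll _ (hw k).locallyIntegrable_gradient).continuous.aestronglyMeasurable.sub
      i1.1

theorem exists_subseq_tendsto_ae {X E : Type*} [MeasurableSpace X] {μ : Measure X}
    [NormedAddCommGroup E] {F : ℕ → X → E} {f : X → E} (hF : ∀ k, AEStronglyMeasurable (F k) μ)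
    (hf : AEStronglyMeasurable f μ) (h : Tendsto (fun k => eLpNorm (F k - f) 1 μ) atTop (𝓝 0)) :
    ∃ ns : ℕ → ℕ, StrictMono ns ∧ ∀ᵐ x ∂μ, Tendsto (fun k => F (ns k) x) atTop (𝓝 (f x)) :=
  (tendstoInMeasure_of_tendsto_eLpNorm one_ne_zero hF hf h).exists_seq_tendsto_ae

/-- The chain rule for weak gradients. -/
theorem HasWeakGradient.comp (hβ : 0 < β) {g : Vel d n → ℝ} {G : Vel d n → Vel d n}
    (h : HasWeakGradient g G) (hg : Integrable g (gaussMeasure β d n))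
    (hG : Integrable G (gaussMeasure β d n)) {Φ : ℝ → ℝ} (hΦ : ContDiff ℝ 1 Φ) (K : ℝ)
    (hK : ∀ x, ‖deriv Φ x‖ ≤ K) :
    Integrable (fun v => Φ (g v)) (gaussMeasure β d n) ∧
    Integrable (fun v => deriv Φ (g v) • G v) (gaussMeasure β d n) ∧
    HasWeakGradient (fun v => Φ (g v)) (fun v => deriv Φ (g v) • G v) := by
  set γ := gaussMeasure β d n with hγ
  have : IsProbabilityMeasure γ := isProbabilityMeasure_gaussMeasure hβ d n
  have hK0 : 0 ≤ K := (norm_nonneg _).trans (hK 0)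
  have hdc : Continuous (deriv Φ) := hΦ.continuous_deriv le_rfl
  have hLip : ∀ x y, ‖Φ x - Φ y‖ ≤ K * ‖x - y‖ := fun x y =>
    convex_univ.norm_image_sub_le_of_norm_deriv_le
      (fun z _ => (hΦ.differentiable one_ne_zero) z) (fun z _ => hK z) (mem_univ y) (mem_univ x)
  have hcomp : ∀ f : Vel d n → ℝ, Integrable f γ → Integrable (fun v => Φ (f v)) γ := fun f hf => by
    have h1 : Integrable (fun v => Φ (f v) - Φ 0) γ := by
      refine (hf.norm.const_mul K).mono'
        ((hΦ.continuous.comp_aestronglyMeasurable hf.1).sub aestronglyMeasurable_const)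
        (Eventually.of_forall fun v => ?_)
      simpa using hLip (f v) 0
    exact (h1.add (integrable_const (Φ 0))).congr (Eventually.of_forall fun v => by simp)
  have hsm : ∀ (f : Vel d n → ℝ) (F : Vel d n → Vel d n), AEStronglyMeasurable f γ →
      Integrable F γ → Integrable (fun v => deriv Φ (f v) • F v) γ := fun f F hf hF =>
    integrable_bdd_smul hF K (hdc.comp_aestronglyMeasurable hf) fun v => hK _
  refine ⟨hcomp g hg, hsm g G hg.1 hG, ?_⟩
  obtain ⟨gk, hs, hc, t, T⟩ := h.exists_seq hβ hg hG
  have hik : ∀ k, Integrable (gk k) γ := fun k =>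
    integrable_gaussMeasure_of_continuous hβ (hs k).continuous (hc k)
  have hs1 : ∀ k, ContDiff ℝ 1 (gk k) := fun k => (hs k).of_le (by norm_cast)
  have hIk : ∀ k, Integrable (grad (gk k)) γ := fun k =>
    integrable_gaussMeasure_of_continuous hβ (continuous_grad (hs1 k))
      (hasCompactSupport_grad (hc k))
  obtain ⟨ns, hns, hae⟩ := exists_subseq_tendsto_ae (fun k => (hik k).1) hg.1 t
  have t' := t.comp hns.tendsto_atTop
  have T' := T.comp hns.tendsto_atTop
  refine HasWeakGradient.of_tendsto hβ (gk := fun k v => Φ (gk (ns k) v))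
    (Gk := fun k v => deriv Φ (gk (ns k) v) • grad (gk (ns k)) v) (fun k => ?_) (hcomp g hg)
    (hsm g G hg.1 hG) (fun k => hcomp _ (hik _)) (fun k => hsm _ _ (hik _).1 (hIk _)) ?_ ?_
  · have h1 := hasWeakGradient_grad (hΦ.comp (hs1 (ns k)))
    refine h1.congr (Eventually.of_forall fun v => rfl) (Eventually.of_forall fun v => ?_)
    funext l
    ext a
    simp only [grad, riesz_apply, Pi.smul_apply, PiLp.smul_apply, smul_eq_mul]
    rw [fderiv_comp v (hΦ.differentiable one_ne_zero _) ((hs1 (ns k)).differentiable one_ne_zero v)]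
    rw [ContinuousLinearMap.comp_apply, ← fderiv_apply_one_eq_deriv]
    conv_rhs => rw [mul_comm, ← smul_eq_mul, ← map_smul, smul_eq_mul, mul_one]
  · exact tendsto_eLpNorm_one_of_le K t' fun k => Eventually.of_forall fun v => hLip _ _
  -- The error of the gradients is split in two. With `G` fixed, only `deriv Φ` varies, and
  -- dominated convergence applies along the almost everywhere convergent subsequence. The remaining
  -- part is at most `K` times the `L¹` error of the gradients.
  · have s1 : Tendsto (fun k => eLpNorm ((fun v => deriv Φ (gk (ns k) v) • G v) -
        fun v => deriv Φ (g v) • G v) 1 γ) atTop (𝓝 0) := by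
      refine tendsto_eLpNorm_one_of_dominated (fun v => K * ‖G v‖)
        (fun k => (hsm _ _ (hik _).1 hG).1) (hG.norm.const_mul K)
        (fun k => Eventually.of_forall fun v => ?_) ?_
      · rw [norm_smul]; exact mul_le_mul_of_nonneg_right (hK _) (norm_nonneg _)
      · filter_upwards [hae] with v hv
        exact ((hdc.tendsto _).comp hv).smul_const _
    have s2 : Tendsto (fun k => eLpNorm ((fun v => deriv Φ (gk (ns k) v) • grad (gk (ns k)) v) -
        fun v => deriv Φ (gk (ns k) v) • G v) 1 γ) atTop (𝓝 0) := by
      have h1 : Tendsto (fun k => ENNReal.ofReal K * eLpNorm (grad (gk (ns k)) - G) 1 γ) atTop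
          (𝓝 0) := by
        have := ENNReal.Tendsto.const_mul (a := ENNReal.ofReal K) T' (Or.inr ENNReal.ofReal_ne_top)
        rwa [mul_zero] at this
      refine tendsto_of_tendsto_of_tendsto_of_le_of_le tendsto_const_nhds h1 (fun _ => zero_le)
        fun k => eLpNorm_le_mul_eLpNorm_of_ae_le_mul (Eventually.of_forall fun v => ?_) 1
      simp only [Pi.sub_apply]
      rw [← smul_sub, norm_smul]
      exact mul_le_mul_of_nonneg_right (hK _) (norm_nonneg _)
    refine tendsto_of_tendsto_of_tendsto_of_le_of_le tendsto_const_nhds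
      (by simpa using s2.add s1) (fun _ => zero_le) fun k => ?_
    refine le_trans (le_of_eq ?_) (eLpNorm_add_le ((hsm _ _ (hik _).1 (hIk _)).1.sub
      (hsm _ _ (hik _).1 hG).1) ((hsm _ _ (hik _).1 hG).1.sub (hsm g G hg.1 hG).1) le_rfl)
    congr 1
    abel

end cutoff

end KacModel

namespace KacModel

/-! ### Averages over random affine maps -/

/-- The adjoint of a linear map with respect to the Euclidean inner products. -/
noncomputable def adj {d n m : ℕ} (L : Vel d n →L[ℝ] Vel d m) (y : Vel d m) : Vel d n :=
  fun k => WithLp.toLp 2 fun a => dot y (L (basisVec (k, a)))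

section adj

variable {d n m : ℕ}

theorem adj_apply (L : Vel d n →L[ℝ] Vel d m) (y : Vel d m) (k : Fin n) (a : Fin d) :
    adj L y k a = dot y (L (basisVec (k, a))) := rfl

attribute [irreducible] adj

theorem dot_sum_smul_right {ι : Type*} (s : Finset ι) (x : Vel d n) (c : ι → ℝ) (y : ι → Vel d n) :
    dot x (∑ i ∈ s, c i • y i) = ∑ i ∈ s, c i * dot x (y i) := by
  classical
  induction s using Finset.induction_on with
  | empty => simp [dot]
  | insert i s hi ih => rw [Finset.sum_insert hi, Finset.sum_insert hi, dot_add_right, ih,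
      dot_smul_right]

theorem dot_adj (L : Vel d n →L[ℝ] Vel d m) (y : Vel d m) (x : Vel d n) :
    dot (adj L y) x = dot y (L x) := by
  have := map_eq_sum_basisVec L.toLinearMap x
  simp only [ContinuousLinearMap.coe_coe] at this
  rw [this, dot_sum_smul_right, dot_eq_sum]
  exact Finset.sum_congr rfl fun p _ => by rw [adj_apply, mul_comm]

theorem adj_sub (L : Vel d n →L[ℝ] Vel d m) (y z : Vel d m) :
    adj L (y - z) = adj L y - adj L z := by
  funext k
  ext a
  simp only [adj_apply, Pi.sub_apply, PiLp.sub_apply]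
  rw [sub_eq_add_neg, ← neg_one_smul ℝ z, dot_add_left, dot_smul_left]; ring

theorem norm_adj_le (L : Vel d n →L[ℝ] Vel d m) (y : Vel d m) :
    ‖adj L y‖ ≤ (n * d * m : ℕ) * ‖L‖ * ‖y‖ := by
  refine (norm_vel_le_sum _).trans ?_
  calc ∑ p : Fin n × Fin d, |adj L y p.1 p.2| ≤ ∑ _p : Fin n × Fin d, m * (‖y‖ * ‖L‖) := by
        refine Finset.sum_le_sum fun p _ => ?_
        rw [adj_apply]
        refine (abs_dot_le _ _).trans ?_
        gcongr
        exact (L.le_opNorm _).trans (mul_le_of_le_one_right (norm_nonneg _) (norm_basisVec_le _))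
    _ = _ := by simp; ring

theorem continuous_adj : Continuous fun p : (Vel d n →L[ℝ] Vel d m) × Vel d m => adj p.1 p.2 := by
  refine continuous_vel_iff.2 fun k a => ?_
  simp only [adj_apply]
  exact continuous_dot_comp continuous_snd (continuous_fst.clm_apply continuous_const)

theorem measurable_adj : Measurable fun p : (Vel d n →L[ℝ] Vel d m) × Vel d m => adj p.1 p.2 :=
  continuous_adj.measurable

theorem measurable_adj_comp {X : Type*} [MeasurableSpace X] {L : X → Vel d n →L[ℝ] Vel d m}
    {y : X → Vel d m} (hL : Measurable L) (hy : Measurable y) :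
    Measurable fun x => adj (L x) (y x) :=
  measurable_adj.comp (hL.prodMk hy)

theorem aestronglyMeasurable_adj {X : Type*} [MeasurableSpace X] {μ : Measure X}
    {L : X → Vel d n →L[ℝ] Vel d m} {y : X → Vel d m} (hL : Measurable L)
    (hy : AEStronglyMeasurable y μ) : AEStronglyMeasurable (fun x => adj (L x) (y x)) μ := by
  obtain ⟨z, hz, h⟩ := hy
  exact ⟨fun x => adj (L x) (z x), (measurable_adj_comp hL hz.measurable).stronglyMeasurable,
    h.mono fun x hx => by simp only [hx]⟩

theorem grad_comp_affine (g : Vel d m → ℝ) (L : Vel d n →L[ℝ] Vel d m)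
    (z : Vel d m) : riesz ((fderiv ℝ g z).comp L) = adj L (grad g z) := by
  funext k
  ext a
  rw [riesz_apply, adj_apply, dot_grad]; rfl

end adj

/-- A random affine map `v ↦ A v + b` which leaves the Gaussian measure invariant, and whose linear
part satisfies `E |Aᵀ y(A v + b)|² r(A v + b) ≤ c E |y(v)|² r(v)`. -/
structure IsFlow {d n : ℕ} {E : Type*} [MeasurableSpace E] (P : Measure E) (β : ℝ)
    (A : E → Vel d n →L[ℝ] Vel d n) (b : E → Vel d n) (c : ℝ) : Prop where
  measurable_linear : Measurable A
  measurable_shift : Measurable b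
  norm_le : ∃ K, ∀ᵐ e ∂P, ‖A e‖ ≤ K
  map_eq : (P.prod (gaussMeasure β d n)).map (fun p => A p.1 p.2 + b p.1) = gaussMeasure β d n
  fisher_le : ∀ y : Vel d n → Vel d n, Measurable y → ∀ r : Vel d n → ℝ≥0∞, Measurable r →
    ∫⁻ p, ENNReal.ofReal (normSq (adj (A p.1) (y (A p.1 p.2 + b p.1)))) * r (A p.1 p.2 + b p.1)
      ∂(P.prod (gaussMeasure β d n)) ≤
    ENNReal.ofReal c * ∫⁻ z, ENNReal.ofReal (normSq (y z)) * r z ∂(gaussMeasure β d n)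

/-- The average of a function over a random affine map. -/
noncomputable def flowAvg {d n : ℕ} {E : Type*} [MeasurableSpace E] (P : Measure E)
    (A : E → Vel d n →L[ℝ] Vel d n) (b : E → Vel d n) (h : Vel d n → ℝ) (v : Vel d n) : ℝ :=
  ∫ e, h (A e v + b e) ∂P

/-- The gradient of `flowAvg` in terms of the gradient of the function. -/
noncomputable def flowGrad {d n : ℕ} {E : Type*} [MeasurableSpace E] (P : Measure E)
    (A : E → Vel d n →L[ℝ] Vel d n) (b : E → Vel d n) (G : Vel d n → Vel d n) (v : Vel d n) :
    Vel d n :=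
  ∫ e, adj (A e) (G (A e v + b e)) ∂P

/-- Bounded continuously differentiable functions with bounded derivative. -/
structure IsBddC1 {d n : ℕ} (h : Vel d n → ℝ) : Prop where
  contDiff : ContDiff ℝ 1 h
  bdd : ∃ K, ∀ v, ‖h v‖ ≤ K
  bdd_fderiv : ∃ K, ∀ v, ‖fderiv ℝ h v‖ ≤ K

theorem IsBddC1.of_hasCompactSupport {d n : ℕ} {h : Vel d n → ℝ} (h1 : ContDiff ℝ 1 h)
    (h2 : HasCompactSupport h) : IsBddC1 h :=
  ⟨h1, h1.continuous.bounded_above_of_compact_support h2,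
    (h1.continuous_fderiv one_ne_zero).bounded_above_of_compact_support (h2.fderiv ℝ)⟩

/-- The Cauchy–Schwarz inequality `(∫ g)² / ∫ h ≤ ∫ g² / h`. -/
theorem sq_integral_div_le {X : Type*} [MeasurableSpace X] {μ : Measure X} {g h : X → ℝ}
    (hg : AEMeasurable g μ) (hh : Integrable h μ) (h0 : ∀ x, 0 ≤ h x) :
    ENNReal.ofReal ((∫ x, g x ∂μ) ^ 2) / ENNReal.ofReal (∫ x, h x ∂μ) ≤
      ∫⁻ x, ENNReal.ofReal (g x ^ 2) / ENNReal.ofReal (h x) ∂μ := by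
  set B := ∫⁻ x, ENNReal.ofReal (g x ^ 2) / ENNReal.ofReal (h x) ∂μ with hB
  by_cases hBt : B = ⊤
  · rw [hBt]; exact le_top
  have hm1 : AEMeasurable (fun x => ENNReal.ofReal (g x ^ 2) / ENNReal.ofReal (h x)) μ :=
    (hg.pow_const 2).ennreal_ofReal.div hh.1.aemeasurable.ennreal_ofReal
  -- The factorisation to which Hölder is applied. Where `h` vanishes, finiteness of the quotient
  -- forces `g = 0`, since a positive number divided by zero is infinite here.
  have hae : ∀ᵐ x ∂μ, ‖g x‖ₑ = (ENNReal.ofReal (g x ^ 2) / ENNReal.ofReal (h x)) ^ (1 / 2 : ℝ) *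
      ENNReal.ofReal (h x) ^ (1 / 2 : ℝ) := by
    filter_upwards [ae_lt_top' hm1 hBt] with x hx
    rw [← ENNReal.mul_rpow_of_nonneg _ _ (by norm_num)]
    have h1 : ENNReal.ofReal (g x ^ 2) / ENNReal.ofReal (h x) * ENNReal.ofReal (h x) =
        ENNReal.ofReal (g x ^ 2) := by
      by_cases hx0 : ENNReal.ofReal (h x) = 0
      · rw [hx0] at hx ⊢
        by_cases hg0 : ENNReal.ofReal (g x ^ 2) = 0
        · simp [hg0]
        · rw [ENNReal.div_zero hg0] at hx; exact absurd hx (lt_irrefl _)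
      · exact ENNReal.div_mul_cancel hx0 ENNReal.ofReal_ne_top
    rw [h1, ← sq_abs, ENNReal.ofReal_rpow_of_nonneg (by positivity) (by norm_num),
      ← Real.sqrt_eq_rpow, Real.sqrt_sq (abs_nonneg _), ← Real.norm_eq_abs, ofReal_norm]
  have hHol := ENNReal.lintegral_mul_le_Lp_mul_Lq μ Real.HolderConjugate.two_two
    (hm1.pow_const (1 / 2 : ℝ)) (hh.1.aemeasurable.ennreal_ofReal.pow_const (1 / 2 : ℝ))
  simp only [Pi.mul_apply] at hHol
  rw [← lintegral_congr_ae hae] at hHol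
  have hp : ∀ a : ℝ≥0∞, (a ^ (1 / 2 : ℝ)) ^ (2 : ℝ) = a := fun a => by
    rw [← ENNReal.rpow_mul]; norm_num
  simp only [hp] at hHol
  refine ENNReal.div_le_of_le_mul ?_
  rw [ofReal_integral_eq_lintegral_ofReal hh (Eventually.of_forall h0)]
  calc ENNReal.ofReal ((∫ x, g x ∂μ) ^ 2) = ‖∫ x, g x ∂μ‖ₑ ^ (2 : ℝ) := by
        rw [← sq_abs, ENNReal.ofReal_pow (abs_nonneg _), ← Real.norm_eq_abs, ofReal_norm]
        norm_cast
    _ ≤ (∫⁻ x, ‖g x‖ₑ ∂μ) ^ (2 : ℝ) := by gcongr; exact enorm_integral_le_lintegral_enorm _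
    _ ≤ _ := by
        refine (ENNReal.rpow_le_rpow hHol (by norm_num)).trans (le_of_eq ?_)
        rw [ENNReal.mul_rpow_of_nonneg _ _ (by norm_num), hp, hp]

namespace IsFlow

variable {d n : ℕ} {E : Type*} [MeasurableSpace E] {P : Measure E} {β : ℝ}
  {A : E → Vel d n →L[ℝ] Vel d n} {b : E → Vel d n} {c : ℝ}

theorem measurable_eval (hA : IsFlow P β A b c) :
    Measurable fun p : E × Vel d n => A p.1 p.2 + b p.1 := by
  have h1 : Measurable fun p : (Vel d n →L[ℝ] Vel d n) × Vel d n => p.1 p.2 :=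
    (continuous_fst.clm_apply continuous_snd).measurable
  exact (h1.comp ((hA.measurable_linear.comp measurable_fst).prodMk measurable_snd)).add
    (hA.measurable_shift.comp measurable_fst)

theorem measurePreserving (hA : IsFlow P β A b c) :
    MeasurePreserving (fun p : E × Vel d n => A p.1 p.2 + b p.1)
      (P.prod (gaussMeasure β d n)) (gaussMeasure β d n) :=
  ⟨hA.measurable_eval, hA.map_eq⟩

theorem integrable_comp (hA : IsFlow P β A b c) {F : Type*} [NormedAddCommGroup F]
    {h : Vel d n → F} (hh : Integrable h (gaussMeasure β d n)) :
    Integrable (fun p : E × Vel d n => h (A p.1 p.2 + b p.1)) (P.prod (gaussMeasure β d n)) :=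
  hA.measurePreserving.integrable_comp_of_integrable hh

theorem integrable_adj_comp (hA : IsFlow P β A b c) {G : Vel d n → Vel d n}
    (hG : Integrable G (gaussMeasure β d n)) :
    Integrable (fun p : E × Vel d n => adj (A p.1) (G (A p.1 p.2 + b p.1)))
      (P.prod (gaussMeasure β d n)) := by
  obtain ⟨K, hK⟩ := hA.norm_le
  have h1 := hA.integrable_comp hG
  refine (h1.norm.const_mul ((n * d * n : ℕ) * K)).mono'
    (aestronglyMeasurable_adj (hA.measurable_linear.comp measurable_fst) h1.1) ?_
  have h2 : ∀ᵐ p ∂(P.prod (gaussMeasure β d n)), ‖A p.1‖ ≤ K :=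
    Measure.quasiMeasurePreserving_fst.ae hK
  filter_upwards [h2] with p hp
  refine (norm_adj_le _ _).trans ?_
  gcongr

variable [IsProbabilityMeasure P]

theorem integrable_flowAvg (hβ : 0 < β) (hA : IsFlow P β A b c) {h : Vel d n → ℝ}
    (hh : Integrable h (gaussMeasure β d n)) :
    Integrable (flowAvg P A b h) (gaussMeasure β d n) := by
  have := isProbabilityMeasure_gaussMeasure hβ d n
  exact (hA.integrable_comp hh).integral_prod_right

theorem integrable_flowGrad (hβ : 0 < β) (hA : IsFlow P β A b c) {G : Vel d n → Vel d n}
    (hG : Integrable G (gaussMeasure β d n)) :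
    Integrable (flowGrad P A b G) (gaussMeasure β d n) := by
  have := isProbabilityMeasure_gaussMeasure hβ d n
  exact (hA.integrable_adj_comp hG).integral_prod_right

theorem integral_flowAvg (hβ : 0 < β) (hA : IsFlow P β A b c) {h : Vel d n → ℝ}
    (hh : Integrable h (gaussMeasure β d n)) :
    ∫ v, flowAvg P A b h v ∂gaussMeasure β d n = ∫ v, h v ∂gaussMeasure β d n := by
  have := isProbabilityMeasure_gaussMeasure hβ d n
  have h1 := integral_prod_symm _ (hA.integrable_comp hh)
  unfold flowAvg
  rw [← h1]
  have h2 := integral_map (μ := P.prod (gaussMeasure β d n)) (f := h)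
    hA.measurable_eval.aemeasurable (by rw [hA.map_eq]; exact hh.1)
  rw [hA.map_eq] at h2
  exact h2.symm

theorem tendsto_integral_right {X Y F F' : Type*} [MeasurableSpace X] [MeasurableSpace Y]
    {μ : Measure X} {ν : Measure Y} [SFinite μ] [SFinite ν] [NormedAddCommGroup F]
    [NormedAddCommGroup F'] [NormedSpace ℝ F'] {f : ℕ → X × Y → F} {f₀ : X × Y → F}
    {g : ℕ → X × Y → F'} {g₀ : X × Y → F'}
    (hg : ∀ k, Integrable (g k) (μ.prod ν)) (hg₀ : Integrable g₀ (μ.prod ν)) (C : ℝ)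
    (hle : ∀ k, ∀ᵐ p ∂(μ.prod ν), ‖g k p - g₀ p‖ ≤ C * ‖f k p - f₀ p‖)
    (h : Tendsto (fun k => eLpNorm (f k - f₀) 1 (μ.prod ν)) atTop (𝓝 0)) :
    Tendsto (fun k => eLpNorm ((fun y => ∫ x, g k (x, y) ∂μ) - fun y => ∫ x, g₀ (x, y) ∂μ) 1 ν)
      atTop (𝓝 0) := by
  refine tendsto_of_tendsto_of_tendsto_of_le_of_le tendsto_const_nhds
    (tendsto_eLpNorm_one_of_le C h hle) (fun _ => zero_le) fun k => ?_
  simp only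
  rw [eLpNorm_one_eq_lintegral_enorm, eLpNorm_one_eq_lintegral_enorm,
    lintegral_prod_symm _ ((hg k).sub hg₀).1.enorm]
  refine lintegral_mono_ae ?_
  filter_upwards [(hg k).prod_left_ae, hg₀.prod_left_ae] with y h1 h2
  simp only [Pi.sub_apply]
  rw [← integral_sub h1 h2]
  exact enorm_integral_le_lintegral_enorm _

theorem tendsto_comp (hA : IsFlow P β A b c) {F : Type*} [NormedAddCommGroup F]
    {f : ℕ → Vel d n → F} {f₀ : Vel d n → F}
    (hf : ∀ k, AEStronglyMeasurable (f k) (gaussMeasure β d n))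
    (hf₀ : AEStronglyMeasurable f₀ (gaussMeasure β d n))
    (h : Tendsto (fun k => eLpNorm (f k - f₀) 1 (gaussMeasure β d n)) atTop (𝓝 0)) :
    Tendsto (fun k => eLpNorm ((fun p : E × Vel d n => f k (A p.1 p.2 + b p.1)) -
      fun p => f₀ (A p.1 p.2 + b p.1)) 1 (P.prod (gaussMeasure β d n))) atTop (𝓝 0) := by
  refine h.congr fun k => ?_
  rw [← eLpNorm_comp_measurePreserving ((hf k).sub hf₀) hA.measurePreserving]
  rfl

theorem tendsto_flowAvg (hβ : 0 < β) (hA : IsFlow P β A b c) {f : ℕ → Vel d n → ℝ}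
    {f₀ : Vel d n → ℝ} (hf : ∀ k, Integrable (f k) (gaussMeasure β d n))
    (hf₀ : Integrable f₀ (gaussMeasure β d n))
    (h : Tendsto (fun k => eLpNorm (f k - f₀) 1 (gaussMeasure β d n)) atTop (𝓝 0)) :
    Tendsto (fun k => eLpNorm (flowAvg P A b (f k) - flowAvg P A b f₀) 1 (gaussMeasure β d n))
      atTop (𝓝 0) := by
  have := isProbabilityMeasure_gaussMeasure hβ d n
  have h3 := hA.tendsto_comp (F := ℝ) (fun k => (hf k).1) hf₀.1 h
  exact tendsto_integral_right (F := ℝ) (F' := ℝ)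
    (f := fun k p => f k (A p.1 p.2 + b p.1)) (f₀ := fun p => f₀ (A p.1 p.2 + b p.1))
    (g := fun k p => f k (A p.1 p.2 + b p.1)) (g₀ := fun p => f₀ (A p.1 p.2 + b p.1))
    (fun k => hA.integrable_comp (hf k)) (hA.integrable_comp hf₀) 1
    (fun k => Eventually.of_forall fun p => by rw [one_mul]) h3

theorem tendsto_flowGrad (hβ : 0 < β) (hA : IsFlow P β A b c) {f : ℕ → Vel d n → Vel d n}
    {f₀ : Vel d n → Vel d n} (hf : ∀ k, Integrable (f k) (gaussMeasure β d n))
    (hf₀ : Integrable f₀ (gaussMeasure β d n))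
    (h : Tendsto (fun k => eLpNorm (f k - f₀) 1 (gaussMeasure β d n)) atTop (𝓝 0)) :
    Tendsto (fun k => eLpNorm (flowGrad P A b (f k) - flowGrad P A b f₀) 1 (gaussMeasure β d n))
      atTop (𝓝 0) := by
  have := isProbabilityMeasure_gaussMeasure hβ d n
  obtain ⟨K, hK⟩ := hA.norm_le
  have h2 : ∀ᵐ p ∂(P.prod (gaussMeasure β d n)), ‖A p.1‖ ≤ K :=
    Measure.quasiMeasurePreserving_fst.ae hK
  have h3 := hA.tendsto_comp (F := Vel d n) (fun k => (hf k).1) hf₀.1 h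
  refine tendsto_integral_right (F := Vel d n) (F' := Vel d n)
    (f := fun k p => f k (A p.1 p.2 + b p.1)) (f₀ := fun p => f₀ (A p.1 p.2 + b p.1))
    (g := fun k p => adj (A p.1) (f k (A p.1 p.2 + b p.1)))
    (g₀ := fun p => adj (A p.1) (f₀ (A p.1 p.2 + b p.1)))
    (fun k => hA.integrable_adj_comp (hf k))
    (hA.integrable_adj_comp hf₀) ((n * d * n : ℕ) * K) (fun k => ?_) h3
  filter_upwards [h2] with p hp
  rw [← adj_sub]
  refine (norm_adj_le _ _).trans ?_
  gcongr

theorem hasFDerivAt_flowAvg (hA : IsFlow P β A b c) {h : Vel d n → ℝ} (hh : IsBddC1 h)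
    (v : Vel d n) :
    Integrable (fun e => (fderiv ℝ h (A e v + b e)).comp (A e)) P ∧
    HasFDerivAt (flowAvg P A b h) (∫ e, (fderiv ℝ h (A e v + b e)).comp (A e) ∂P) v := by
  obtain ⟨K, hK⟩ := hA.norm_le
  obtain ⟨B, hB⟩ := hh.bdd
  obtain ⟨B', hB'⟩ := hh.bdd_fderiv
  have hB0 : 0 ≤ B' := (norm_nonneg _).trans (hB' 0)
  have hme : ∀ v, Measurable fun e => A e v + b e := fun v =>
    hA.measurable_eval.comp measurable_prodMk_right
  have hm : ∀ v, AEStronglyMeasurable (fun e => (fderiv ℝ h (A e v + b e)).comp (A e)) P := fun v =>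
    (isBoundedBilinearMap_comp.continuous.measurable.comp
      (((hh.contDiff.continuous_fderiv one_ne_zero).measurable.comp (hme v)).prodMk
        hA.measurable_linear)).aestronglyMeasurable
  have hb : ∀ᵐ e ∂P, ∀ x ∈ (univ : Set (Vel d n)),
      ‖(fderiv ℝ h (A e x + b e)).comp (A e)‖ ≤ B' * K := by
    filter_upwards [hK] with e he x _
    exact (ContinuousLinearMap.opNorm_comp_le _ _).trans
      (mul_le_mul (hB' _) he (norm_nonneg _) hB0)
  have hint : ∀ v, Integrable (fun e => h (A e v + b e)) P := fun v =>
    Integrable.of_bound (hh.contDiff.continuous.measurable.comp (hme v)).aestronglyMeasurable B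
      (Eventually.of_forall fun e => hB _)
  refine ⟨Integrable.of_bound (hm v) (B' * K) (hb.mono fun e he => he v (mem_univ v)), ?_⟩
  refine hasFDerivAt_integral_of_dominated_of_fderiv_le (bound := fun _ => B' * K) univ_mem
    (Eventually.of_forall fun v => (hint v).1) (hint v) (hm v) hb (integrable_const _)
    (Eventually.of_forall fun e x _ => ?_)
  exact ((hh.contDiff.differentiable one_ne_zero) _).hasFDerivAt.comp x
    ((A e).hasFDerivAt.add_const (b e))

/-- The class of smooth functions is stable under flows, so flows can be composed with each other
and the entropy identity holds after each of them. -/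
theorem isBddC1_flowAvg (hA : IsFlow P β A b c) {h : Vel d n → ℝ} (hh : IsBddC1 h) :
    IsBddC1 (flowAvg P A b h) := by
  obtain ⟨K, hK⟩ := hA.norm_le
  obtain ⟨B, hB⟩ := hh.bdd
  obtain ⟨B', hB'⟩ := hh.bdd_fderiv
  have hB0 : 0 ≤ B' := (norm_nonneg _).trans (hB' 0)
  have hme : ∀ v, Measurable fun e => A e v + b e := fun v =>
    hA.measurable_eval.comp measurable_prodMk_right
  have hd := fun v => (hA.hasFDerivAt_flowAvg hh v).2
  have hfd : fderiv ℝ (flowAvg P A b h) =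
      fun v => ∫ e, (fderiv ℝ h (A e v + b e)).comp (A e) ∂P := by
    funext v; exact (hd v).fderiv
  have hb : ∀ v, ∀ᵐ e ∂P, ‖(fderiv ℝ h (A e v + b e)).comp (A e)‖ ≤ B' * K := fun v => by
    filter_upwards [hK] with e he
    exact (ContinuousLinearMap.opNorm_comp_le _ _).trans
      (mul_le_mul (hB' _) he (norm_nonneg _) hB0)
  refine ⟨contDiff_one_iff_fderiv.2 ⟨fun v => (hd v).differentiableAt, ?_⟩, ⟨B, fun v => ?_⟩,
    ⟨B' * K, fun v => ?_⟩⟩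
  · rw [hfd]
    refine continuous_of_dominated (fun v => (hA.hasFDerivAt_flowAvg hh v).1.1) hb
      (integrable_const _) (Eventually.of_forall fun e => ?_)
    exact ((hh.contDiff.continuous_fderiv one_ne_zero).comp
      ((A e).continuous.add continuous_const)).clm_comp continuous_const
  · unfold flowAvg
    have := norm_integral_le_of_norm_le_const (μ := P) (f := fun e => h (A e v + b e)) (C := B)
      (Eventually.of_forall fun e => hB _)
    simpa using this
  · rw [hfd]
    simpa using norm_integral_le_of_norm_le_const (hb v)

theorem grad_flowAvg (hA : IsFlow P β A b c) {h : Vel d n → ℝ} (hh : IsBddC1 h) :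
    grad (flowAvg P A b h) = flowGrad P A b (grad h) := by
  funext v
  obtain ⟨h1, h2⟩ := hA.hasFDerivAt_flowAvg hh v
  have h3 : ∀ e, adj (A e) (grad h (A e v + b e)) =
      riesz ((fderiv ℝ h (A e v + b e)).comp (A e)) := fun e =>
    (grad_comp_affine h _ _).symm
  have h4 : Integrable (fun e => riesz ((fderiv ℝ h (A e v + b e)).comp (A e))) P := by
    refine integrable_vel_iff.2 fun k a => ?_
    simp only [riesz_apply]
    exact (ContinuousLinearMap.apply ℝ ℝ (basisVec (k, a))).integrable_comp h1
  rw [flowGrad]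
  simp only [h3]
  rw [grad, h2.fderiv]
  funext k
  ext a
  have h6 := ((PiLp.proj 2 (fun _ : Fin d => ℝ) a : EuclideanSpace ℝ (Fin d) →L[ℝ] ℝ).comp
      (ContinuousLinearMap.proj (R := ℝ) (φ := fun _ : Fin n => EuclideanSpace ℝ (Fin d)) k)
      ).integral_comp_comm h4
  rw [riesz_apply, ContinuousLinearMap.integral_apply h1]
  refine Eq.trans ?_ h6
  congr 1; funext e
  exact (riesz_apply _ k a).symm

/-- Weak gradients of averages. -/
theorem hasWeakGradient_flowAvg (hβ : 0 < β) (hA : IsFlow P β A b c) {h : Vel d n → ℝ}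
    {G : Vel d n → Vel d n} (hw : HasWeakGradient h G) (hh : Integrable h (gaussMeasure β d n))
    (hG : Integrable G (gaussMeasure β d n)) :
    HasWeakGradient (flowAvg P A b h) (flowGrad P A b G) := by
  -- For test functions the formula is differentiation under the integral. Both averages are
  -- continuous in `L¹(γ)` because the random map preserves `γ`, so the formula passes to the limit.
  obtain ⟨gk, hs, hc, t, T⟩ := hw.exists_seq hβ hh hG
  have hs1 : ∀ k, ContDiff ℝ 1 (gk k) := fun k => (hs k).of_le (by norm_cast)
  have hik : ∀ k, Integrable (gk k) (gaussMeasure β d n) := fun k =>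
    integrable_gaussMeasure_of_continuous hβ (hs k).continuous (hc k)
  have hIk : ∀ k, Integrable (grad (gk k)) (gaussMeasure β d n) := fun k =>
    integrable_gaussMeasure_of_continuous hβ (continuous_grad (hs1 k))
      (hasCompactSupport_grad (hc k))
  refine HasWeakGradient.of_tendsto hβ (fun k => ?_) (hA.integrable_flowAvg hβ hh)
    (hA.integrable_flowGrad hβ hG) (fun k => hA.integrable_flowAvg hβ (hik k))
    (fun k => hA.integrable_flowGrad hβ (hIk k)) (hA.tendsto_flowAvg hβ hik hh t)
    (hA.tendsto_flowGrad hβ hIk hG T)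
  have hb := IsBddC1.of_hasCompactSupport (hs1 k) (hc k)
  rw [← hA.grad_flowAvg hb]
  exact hasWeakGradient_grad (hA.isBddC1_flowAvg hb).contDiff

/-- The Fisher information of an average. -/
theorem fisher_flowAvg_le (hβ : 0 < β) (hA : IsFlow P β A b c) {h : Vel d n → ℝ}
    {G : Vel d n → Vel d n} (hm : Measurable h) (h0 : ∀ v, 0 ≤ h v) (hGm : Measurable G)
    (hh : Integrable h (gaussMeasure β d n)) (hG : Integrable G (gaussMeasure β d n)) :
    ∫⁻ v, ENNReal.ofReal (normSq (flowGrad P A b G v)) / ENNReal.ofReal (flowAvg P A b h v)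
      ∂gaussMeasure β d n ≤
    ENNReal.ofReal c * ∫⁻ v, ENNReal.ofReal (normSq (G v)) / ENNReal.ofReal (h v)
      ∂gaussMeasure β d n := by
  have := isProbabilityMeasure_gaussMeasure hβ d n
  have hma : Measurable fun p : E × Vel d n => adj (A p.1) (G (A p.1 p.2 + b p.1)) :=
    measurable_adj_comp (hA.measurable_linear.comp measurable_fst) (hGm.comp hA.measurable_eval)
  have hmn : Measurable fun p : E × Vel d n =>
      ENNReal.ofReal (normSq (adj (A p.1) (G (A p.1 p.2 + b p.1)))) /
        ENNReal.ofReal (h (A p.1 p.2 + b p.1)) :=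
    (continuous_normSq.measurable.comp hma).ennreal_ofReal.div
      (hm.comp hA.measurable_eval).ennreal_ofReal
  -- The weight `1 / h` in the flow inequality produces the information density. It remains to
  -- compare, at a fixed `v`, the square of an average over the average of `h` with the average of
  -- the quotient; this is Cauchy–Schwarz in each coordinate.
  have h1 := hA.fisher_le G hGm (fun z => (ENNReal.ofReal (h z))⁻¹) hm.ennreal_ofReal.inv
  simp only [← div_eq_mul_inv] at h1
  refine le_trans ?_ h1
  rw [lintegral_prod_symm _ hmn.aemeasurable]
  refine lintegral_mono_ae ?_
  filter_upwards [(hA.integrable_comp hh).prod_left_ae,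
    (hA.integrable_adj_comp hG).prod_left_ae] with v i1 i2
  have hcoord : ∀ p : Fin n × Fin d, flowGrad P A b G v p.1 p.2 =
      ∫ e, adj (A e) (G (A e v + b e)) p.1 p.2 ∂P := fun p =>
    (((PiLp.proj 2 (fun _ : Fin d => ℝ) p.2 : EuclideanSpace ℝ (Fin d) →L[ℝ] ℝ).comp
      (ContinuousLinearMap.proj (R := ℝ) (φ := fun _ : Fin n => EuclideanSpace ℝ (Fin d)) p.1)
      ).integral_comp_comm i2).symm
  have hdiv : ∀ (x : Vel d n) (r : ℝ≥0∞), ENNReal.ofReal (normSq x) / r =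
      ∑ p : Fin n × Fin d, ENNReal.ofReal (x p.1 p.2 ^ 2) / r := fun x r => by
    rw [normSq_eq_sum, ENNReal.ofReal_sum_of_nonneg fun p _ => sq_nonneg _]
    simp only [div_eq_mul_inv, Finset.sum_mul]
  simp only [hdiv]
  have hmc : ∀ p : Fin n × Fin d,
      Measurable fun e => adj (A e) (G (A e v + b e)) p.1 p.2 := fun p =>
    measurable_vel_iff.1 (hma.comp measurable_prodMk_right) p.1 p.2
  have hmq : ∀ p : Fin n × Fin d, Measurable fun e =>
      ENNReal.ofReal (adj (A e) (G (A e v + b e)) p.1 p.2 ^ 2) /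
        ENNReal.ofReal (h (A e v + b e)) := fun p =>
    ((hmc p).pow_const 2).ennreal_ofReal.div
      (hm.comp (hA.measurable_eval.comp measurable_prodMk_right)).ennreal_ofReal
  rw [lintegral_finsetSum _ fun p _ => hmq p]
  refine Finset.sum_le_sum fun p _ => ?_
  rw [hcoord]
  exact sq_integral_div_le (hmc p).aemeasurable i1 fun e => h0 _

end IsFlow

end KacModel

namespace KacModel

/-! ### The Ornstein–Uhlenbeck flow -/

section stein

variable {d n : ℕ} {β : ℝ}

theorem integrable_normSq_gauss (hβ : 0 < β) :
    Integrable (normSq : Vel d n → ℝ) (gaussMeasure β d n) := by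
  rw [integrable_gaussMeasure_iff hβ]
  set C := (β / (2 * Real.pi)) ^ (((d * n : ℕ) : ℝ) / 2) with hC
  set C' := (β / 2 / (2 * Real.pi)) ^ (((d * n : ℕ) : ℝ) / 2) with hC'
  have hC0 : 0 < C := by positivity
  have hC0' : 0 < C' := by positivity
  refine ((integrable_maxwell (half_pos hβ) d n).const_mul (4 / β * C / C')).mono'
    (continuous_maxwell.smul continuous_normSq).aestronglyMeasurable
    (Eventually.of_forall fun v => ?_)
  have h0 := normSq_nonneg v
  rw [smul_eq_mul, Real.norm_of_nonneg (mul_nonneg (maxwell_pos hβ v).le h0), maxwell_eq,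
    maxwell_eq, ← hC, ← hC']
  -- Half of the Gaussian exponent absorbs the polynomial factor; what is left is a multiple of the
  -- Maxwellian at `β / 2`.
  have h1 : normSq v ≤ 4 / β * Real.exp (β / 4 * normSq v) := by
    have := Real.add_one_le_exp (β / 4 * normSq v)
    calc normSq v = 4 / β * (β / 4 * normSq v) := by field_simp
      _ ≤ _ := by gcongr; linarith
  have h2 : Real.exp (-(β / 2 / 2) * normSq v) =
      Real.exp (-(β / 2) * normSq v) * Real.exp (β / 4 * normSq v) := by
    rw [← Real.exp_add]; congr 1; ring
  rw [h2]
  calc C * Real.exp (-(β / 2) * normSq v) * normSq v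
      ≤ C * Real.exp (-(β / 2) * normSq v) * (4 / β * Real.exp (β / 4 * normSq v)) := by gcongr
    _ = _ := by field_simp

theorem integrable_norm_gauss (hβ : 0 < β) :
    Integrable (fun v : Vel d n => ‖v‖) (gaussMeasure β d n) := by
  have := isProbabilityMeasure_gaussMeasure hβ d n
  refine ((integrable_const (1 : ℝ)).add (integrable_normSq_gauss hβ)).mono'
    continuous_norm.aestronglyMeasurable (Eventually.of_forall fun v => ?_)
  rw [norm_norm, Pi.add_apply]
  nlinarith [sq_norm_le_normSq v, sq_nonneg (‖v‖ - 1)]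

theorem fderiv_maxwell (v a : Vel d n) :
    fderiv ℝ (maxwell β) v a = -β * dot a v * maxwell β v := by
  have h1 : HasLineDerivAt ℝ (maxwell β) (fderiv ℝ (maxwell β) v a) v a :=
    ((contDiff_maxwell.differentiable (by simp) v).hasFDerivAt).hasLineDerivAt a
  have h2 : HasLineDerivAt ℝ (maxwell β) (-β * dot a v * maxwell β v) v a := by
    set C := (β / (2 * Real.pi)) ^ (((d * n : ℕ) : ℝ) / 2) with hC
    have e : (fun t : ℝ => maxwell β (v + t • a)) = fun t : ℝ =>
        C * Real.exp (-(β / 2) * (normSq v + 2 * t * dot v a + t ^ 2 * normSq a)) := by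
      funext t
      have := normSq_add_smul v a 1 t
      rw [one_smul] at this
      rw [maxwell_eq, this, ← hC]
      simp only [one_pow, one_mul, mul_one]
    unfold HasLineDerivAt
    rw [e]
    have h3 : HasDerivAt (fun t : ℝ => normSq v + 2 * t * dot v a + t ^ 2 * normSq a)
        (2 * dot v a) 0 := by
      have h4 := (((hasDerivAt_id (0 : ℝ)).const_mul 2).mul_const (dot v a)).const_add (normSq v)
      have h5 := ((hasDerivAt_id (0 : ℝ)).pow 2).mul_const (normSq a)
      exact (h4.add h5).congr_deriv (by simp)
    refine (((h3.const_mul (-(β / 2))).exp).const_mul C).congr_deriv ?_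
    rw [maxwell_eq, dot_comm a v, ← hC]
    simp only [mul_zero, zero_mul, add_zero, zero_pow two_ne_zero]
    ring
  exact h1.unique h2

/-- Gaussian integration by parts. -/
theorem integral_mul_dot_gauss (hβ : 0 < β) {ψ : Vel d n → ℝ} (hψ : IsBddC1 ψ) (a : Vel d n) :
    ∫ y, ψ y * dot a y ∂gaussMeasure β d n = 1 / β * ∫ y, fderiv ℝ ψ y a ∂gaussMeasure β d n := by
  have := isProbabilityMeasure_gaussMeasure hβ d n
  obtain ⟨K, hK⟩ := hψ.bdd
  obtain ⟨K', hK'⟩ := hψ.bdd_fderiv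
  have hcd : Continuous fun y : Vel d n => dot a y :=
    continuous_dot_comp continuous_const continuous_id
  have i1 : Integrable (fun y => ψ y * dot a y) (gaussMeasure β d n) := by
    refine Integrable.bdd_mul (c := K) ?_ hψ.contDiff.continuous.aestronglyMeasurable
      (Eventually.of_forall hK)
    refine ((integrable_norm_gauss hβ).const_mul (n * ‖a‖)).mono' hcd.aestronglyMeasurable
      (Eventually.of_forall fun y => ?_)
    rw [Real.norm_eq_abs]
    refine (abs_dot_le a y).trans (le_of_eq (by ring))
  have cfd := continuous_fderiv_apply' hψ.contDiff a
  have i2 : Integrable (fun y => fderiv ℝ ψ y a) (gaussMeasure β d n) :=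
    Integrable.of_bound cfd.aestronglyMeasurable (K' * ‖a‖) (Eventually.of_forall fun y =>
      ((fderiv ℝ ψ y).le_opNorm a).trans (by gcongr; exact hK' y))
  have i3 : Integrable ψ (gaussMeasure β d n) :=
    Integrable.of_bound hψ.contDiff.continuous.aestronglyMeasurable K (Eventually.of_forall hK)
  rw [integrable_gaussMeasure_iff hβ] at i1 i2 i3
  have key := integral_mul_fderiv_eq_neg_fderiv_mul_of_integrable
    (μ := (volume : Measure (Vel d n))) (f := ψ) (g := maxwell β) (v := a)
    (i2.congr (Eventually.of_forall fun y => by simp [mul_comm]))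
    ((i1.const_mul (-β)).congr (Eventually.of_forall fun y => by
      simp only [fderiv_maxwell, smul_eq_mul]; ring))
    (i3.congr (Eventually.of_forall fun y => by simp [mul_comm]))
    (fun y _ => hψ.contDiff.differentiable one_ne_zero y)
    (fun y _ => contDiff_maxwell.differentiable (by simp) y)
  rw [integral_gaussMeasure hβ, integral_gaussMeasure hβ]
  have e1 : ∫ y, ψ y * fderiv ℝ (maxwell β) y a =
      -β * ∫ y, maxwell β y • (ψ y * dot a y) := by
    rw [← integral_const_mul]
    congr 1; funext y; rw [fderiv_maxwell, smul_eq_mul]; ring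
  have e2 : ∫ y, fderiv ℝ ψ y a * maxwell β y = ∫ y, maxwell β y • fderiv ℝ ψ y a := by
    congr 1; funext y; rw [smul_eq_mul, mul_comm]
  rw [e1, e2] at key
  field_simp
  linarith

end stein

/-- The Ornstein–Uhlenbeck flow, `∫ h(cos θ v + sin θ w) γ(w) dw`. -/
noncomputable def ou {d n : ℕ} (β θ : ℝ) (h : Vel d n → ℝ) : Vel d n → ℝ :=
  flowAvg (gaussMeasure β d n) (fun _ => Real.cos θ • ContinuousLinearMap.id ℝ (Vel d n))
    (fun w => Real.sin θ • w) h

section ou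

variable {d n : ℕ} {β : ℝ}

theorem ou_apply (θ : ℝ) (h : Vel d n → ℝ) (v : Vel d n) :
    ou β θ h v = ∫ w, h (Real.cos θ • v + Real.sin θ • w) ∂gaussMeasure β d n := rfl

theorem normSq_smul (c : ℝ) (x : Vel d n) : normSq (c • x) = c ^ 2 * normSq x := by
  rw [normSq_eq_dot, normSq_eq_dot, dot_smul_left, dot_smul_right]; ring

theorem adj_smul_id (c : ℝ) (y : Vel d n) :
    adj (c • ContinuousLinearMap.id ℝ (Vel d n)) y = c • y := by
  funext k
  ext a
  rw [adj_apply]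
  simp [dot_smul_right, dot_basisVec]

/-- The linear part is multiplication by `cos θ`, so the flow inequality is an equality, and
invariance is the rotation invariance of a pair of independent Gaussians. All results on flows
thereby apply to `ou`. -/
theorem isFlow_ou (hβ : 0 < β) (d n : ℕ) (θ : ℝ) :
    IsFlow (gaussMeasure β d n) β
      (fun _ => Real.cos θ • ContinuousLinearMap.id ℝ (Vel d n))
      (fun w => Real.sin θ • w) (Real.cos θ ^ 2) := by
  have := isProbabilityMeasure_gaussMeasure hβ d n
  have hmp : MeasurePreserving (fun p : Vel d n × Vel d n =>
      (Real.cos θ • ContinuousLinearMap.id ℝ (Vel d n)) p.2 + Real.sin θ • p.1)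
      ((gaussMeasure β d n).prod (gaussMeasure β d n)) (gaussMeasure β d n) := by
    have := measurePreserving_rotate hβ d n (Real.sin_sq_add_cos_sq θ)
    convert this using 2
    simp [add_comm]
  refine ⟨measurable_const, (continuous_const_smul _).measurable, ⟨_, Eventually.of_forall fun _ => le_rfl⟩,
    hmp.map_eq, fun y hy r hr => le_of_eq ?_⟩
  simp only [adj_smul_id, normSq_smul]
  have hm : Measurable fun z => ENNReal.ofReal (Real.cos θ ^ 2 * normSq (y z)) * r z :=
    ((continuous_normSq.measurable.comp hy).const_mul _).ennreal_ofReal.mul hr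
  rw [hmp.lintegral_comp hm, ← lintegral_const_mul' _ _ ENNReal.ofReal_ne_top]
  refine lintegral_congr fun z => ?_
  rw [ENNReal.ofReal_mul (sq_nonneg _), mul_assoc]

theorem ou_zero (hβ : 0 < β) (h : Vel d n → ℝ) : ou β 0 h = h := by
  have := isProbabilityMeasure_gaussMeasure hβ d n
  funext v
  simp [ou_apply]

/-- With the angle as parameter the mean is reached at a finite endpoint, which replaces the limit
of infinite time. -/
theorem ou_pi_div_two (h : Vel d n → ℝ) (v : Vel d n) :
    ou β (Real.pi / 2) h v = ∫ w, h w ∂gaussMeasure β d n := by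
  simp [ou_apply]

theorem IsBddC1.integrable_gauss (hβ : 0 < β) {h : Vel d n → ℝ} (hh : IsBddC1 h) :
    Integrable h (gaussMeasure β d n) := by
  have := isProbabilityMeasure_gaussMeasure hβ d n
  obtain ⟨K, hK⟩ := hh.bdd
  exact Integrable.of_bound hh.contDiff.continuous.aestronglyMeasurable K (Eventually.of_forall hK)

theorem IsBddC1.exists_norm_grad_le {h : Vel d n → ℝ} (hh : IsBddC1 h) :
    ∃ K, 0 ≤ K ∧ ∀ v, ‖grad h v‖ ≤ K := by
  obtain ⟨K, hK⟩ := hh.bdd_fderiv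
  have hK0 : 0 ≤ K := (norm_nonneg _).trans (hK 0)
  refine ⟨(n * d : ℕ) * K, by positivity, fun v => (norm_riesz_le _).trans ?_⟩
  gcongr
  exact hK v

theorem IsBddC1.integrable_grad_gauss (hβ : 0 < β) {h : Vel d n → ℝ} (hh : IsBddC1 h) :
    Integrable (grad h) (gaussMeasure β d n) := by
  have := isProbabilityMeasure_gaussMeasure hβ d n
  obtain ⟨K, -, hK⟩ := hh.exists_norm_grad_le
  exact Integrable.of_bound (continuous_grad hh.contDiff).aestronglyMeasurable K
    (Eventually.of_forall hK)

theorem isBddC1_ou (hβ : 0 < β) {h : Vel d n → ℝ} (hh : IsBddC1 h) (θ : ℝ) :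
    IsBddC1 (ou β θ h) := by
  have := isProbabilityMeasure_gaussMeasure hβ d n
  exact (isFlow_ou hβ d n θ).isBddC1_flowAvg hh

theorem le_flowAvg {E : Type*} [MeasurableSpace E] {P : Measure E} [IsProbabilityMeasure P]
    {A : E → Vel d n →L[ℝ] Vel d n} {b : E → Vel d n} {c : ℝ} (hA : IsFlow P β A b c)
    {h : Vel d n → ℝ} (hh : IsBddC1 h) {m : ℝ} (hm : ∀ v, m ≤ h v) (v : Vel d n) :
    m ≤ flowAvg P A b h v := by
  obtain ⟨K, hK⟩ := hh.bdd
  have hi : Integrable (fun e => h (A e v + b e)) P :=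
    Integrable.of_bound (hh.contDiff.continuous.measurable.comp
      (hA.measurable_eval.comp measurable_prodMk_right)).aestronglyMeasurable K
      (Eventually.of_forall fun e => hK _)
  have := integral_mono (μ := P) (integrable_const m) hi fun e => hm _
  simpa [flowAvg] using this

/-- The average of the gradient along the Ornstein–Uhlenbeck flow. -/
noncomputable def ouGrad {d n : ℕ} (β θ : ℝ) (h : Vel d n → ℝ) (v : Vel d n) : Vel d n :=
  ∫ w, grad h (Real.cos θ • v + Real.sin θ • w) ∂gaussMeasure β d n

theorem grad_ou (hβ : 0 < β) {h : Vel d n → ℝ} (hh : IsBddC1 h) (θ : ℝ) (v : Vel d n) :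
    grad (ou β θ h) v = Real.cos θ • ouGrad β θ h v := by
  have := isProbabilityMeasure_gaussMeasure hβ d n
  unfold ou
  rw [(isFlow_ou hβ d n θ).grad_flowAvg hh]
  have := integral_smul (μ := gaussMeasure β d n) (Real.cos θ)
    (fun w => grad h (Real.cos θ • v + Real.sin θ • w))
  rw [ouGrad, ← this]
  simp only [flowGrad, adj_smul_id]
  rfl

theorem hasDerivAt_cos_smul_add_sin_smul {E : Type*} [NormedAddCommGroup E] [NormedSpace ℝ E]
    (v w : E) (θ : ℝ) : HasDerivAt (fun θ : ℝ => Real.cos θ • v + Real.sin θ • w)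
      (-Real.sin θ • v + Real.cos θ • w) θ :=
  ((Real.hasDerivAt_cos θ).smul_const v).add ((Real.hasDerivAt_sin θ).smul_const w)

theorem norm_sin_smul_add_cos_smul_le {E : Type*} [NormedAddCommGroup E] [NormedSpace ℝ E]
    (v w : E) (θ : ℝ) : ‖-Real.sin θ • v + Real.cos θ • w‖ ≤ ‖v‖ + ‖w‖ := by
  refine (norm_add_le _ _).trans (add_le_add ?_ ?_)
  · rw [norm_smul, norm_neg]
    exact mul_le_of_le_one_left (norm_nonneg _) (Real.abs_sin_le_one θ)
  · rw [norm_smul]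
    exact mul_le_of_le_one_left (norm_nonneg _) (Real.abs_cos_le_one θ)

theorem hasDerivAt_ou (hβ : 0 < β) {h : Vel d n → ℝ} (hh : IsBddC1 h) (θ : ℝ) (v : Vel d n) :
    HasDerivAt (fun θ => ou β θ h v) (∫ w, dot (grad h (Real.cos θ • v + Real.sin θ • w))
      (-Real.sin θ • v + Real.cos θ • w) ∂gaussMeasure β d n) θ := by
  have := isProbabilityMeasure_gaussMeasure hβ d n
  obtain ⟨K, hK⟩ := hh.bdd
  obtain ⟨K', hK0, hK'⟩ := hh.exists_norm_grad_le
  have hc : ∀ θ : ℝ, Continuous fun w : Vel d n => Real.cos θ • v + Real.sin θ • w := fun θ => by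
    fun_prop
  have hF' : ∀ θ : ℝ, Continuous fun w : Vel d n =>
      dot (grad h (Real.cos θ • v + Real.sin θ • w)) (-Real.sin θ • v + Real.cos θ • w) := fun θ =>
    continuous_dot_comp ((continuous_grad hh.contDiff).comp (hc θ)) (by fun_prop)
  refine (hasDerivAt_integral_of_dominated_loc_of_deriv_le (s := univ)
    (bound := fun w => n * (K' * (‖v‖ + ‖w‖))) (F := fun θ w => h (Real.cos θ • v + Real.sin θ • w))
    (F' := fun θ w => dot (grad h (Real.cos θ • v + Real.sin θ • w))
      (-Real.sin θ • v + Real.cos θ • w)) univ_mem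
    (Eventually.of_forall fun θ => (hh.contDiff.continuous.comp (hc θ)).aestronglyMeasurable)
    (Integrable.of_bound (hh.contDiff.continuous.comp (hc θ)).aestronglyMeasurable K
      (Eventually.of_forall fun w => hK _)) (hF' θ).aestronglyMeasurable
    (Eventually.of_forall fun w θ _ => ?_) ?_ (Eventually.of_forall fun w θ _ => ?_)).2
  · rw [Real.norm_eq_abs]
    refine (abs_dot_le _ _).trans ?_
    gcongr
    · exact hK' _
    · exact norm_sin_smul_add_cos_smul_le v w θ
  · exact (((integrable_const ‖v‖).add (integrable_norm_gauss hβ)).const_mul K').const_mul (n : ℝ)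
  · have h1 := hasDerivAt_cos_smul_add_sin_smul v w θ
    have h2 := ((hh.contDiff.differentiable one_ne_zero)
      (Real.cos θ • v + Real.sin θ • w)).hasFDerivAt.comp_hasDerivAt θ h1
    rw [dot_grad]
    exact h2

end ou

end KacModel

namespace KacModel

/-! ### Dissipation of the entropy along the Ornstein–Uhlenbeck flow. -/

section entropy

variable {d n : ℕ} {β : ℝ}

/-- A function with values in `[m, K]`, `m > 0`, has a bounded logarithm. -/
theorem abs_log_le {m K x : ℝ} (hm : 0 < m) (h1 : m ≤ x) (h2 : x ≤ K) :
    |Real.log x| ≤ |Real.log m| + |Real.log K| := by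
  have a := Real.log_le_log hm h1
  have b := Real.log_le_log (hm.trans_le h1) h2
  rw [abs_le]
  constructor
  · have := neg_abs_le (Real.log m); have := abs_nonneg (Real.log K); linarith
  · have := le_abs_self (Real.log K); have := abs_nonneg (Real.log m); linarith

theorem IsBddC1.log_add_one {h : Vel d n → ℝ} (hh : IsBddC1 h) {m : ℝ} (hm : 0 < m)
    (hm' : ∀ v, m ≤ h v) : IsBddC1 (fun v => Real.log (h v) + 1) ∧
      ∀ v, fderiv ℝ (fun v => Real.log (h v) + 1) v = (h v)⁻¹ • fderiv ℝ h v := by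
  obtain ⟨K, hK⟩ := hh.bdd
  obtain ⟨K', hK'⟩ := hh.bdd_fderiv
  have hne : ∀ v, h v ≠ 0 := fun v => (hm.trans_le (hm' v)).ne'
  have hfd : ∀ v, fderiv ℝ (fun v => Real.log (h v) + 1) v = (h v)⁻¹ • fderiv ℝ h v := fun v => by
    rw [fderiv_add_const]
    exact fderiv.log (hh.contDiff.differentiable one_ne_zero v) (hne v)
  refine ⟨⟨(hh.contDiff.log hne).add contDiff_const, ⟨|Real.log m| + |Real.log K| + 1, fun v => ?_⟩,
    ⟨m⁻¹ * K', fun v => ?_⟩⟩, hfd⟩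
  · refine (norm_add_le _ _).trans ?_
    rw [norm_one, Real.norm_eq_abs]
    gcongr
    exact abs_log_le hm (hm' v) ((le_abs_self _).trans (hK v))
  · rw [hfd, norm_smul, norm_inv, Real.norm_of_nonneg (hm.trans_le (hm' v)).le]
    gcongr
    · exact hm' v
    · exact hK' v

theorem IsBddC1.comp_affine {h : Vel d n → ℝ} (hh : IsBddC1 h) (z : Vel d n) (s : ℝ) :
    IsBddC1 (fun y => h (z + s • y)) ∧
      ∀ y a, fderiv ℝ (fun y => h (z + s • y)) y a = s * fderiv ℝ h (z + s • y) a := by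
  obtain ⟨K, hK⟩ := hh.bdd
  obtain ⟨K', hK'⟩ := hh.bdd_fderiv
  have h1 : ∀ y, HasFDerivAt (fun y => h (z + s • y))
      ((fderiv ℝ h (z + s • y)).comp (s • ContinuousLinearMap.id ℝ (Vel d n))) y := fun y =>
    (hh.contDiff.differentiable one_ne_zero _).hasFDerivAt.comp y
      (((hasFDerivAt_id y).const_smul s).const_add z)
  refine ⟨⟨hh.contDiff.comp (contDiff_const.add (contDiff_const_smul s)), ⟨K, fun y => hK _⟩,
    ⟨K' * |s|, fun y => ?_⟩⟩, fun y a => ?_⟩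
  · rw [(h1 y).fderiv, ContinuousLinearMap.comp_smul, ContinuousLinearMap.comp_id, norm_smul,
      mul_comm, Real.norm_eq_abs]
    gcongr
    exact hK' _
  · rw [(h1 y).fderiv]; simp

/-- The dissipation of the entropy along the Ornstein–Uhlenbeck flow. -/
noncomputable def ouDissipation {d n : ℕ} (β θ : ℝ) (h : Vel d n → ℝ) : ℝ :=
  ∫ v, normSq (ouGrad β θ h v) / ou β θ h v ∂gaussMeasure β d n

theorem integrable_norm_add_norm_prod (hβ : 0 < β) (d n : ℕ) :
    Integrable (fun p : Vel d n × Vel d n => ‖p.1‖ + ‖p.2‖)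
      ((gaussMeasure β d n).prod (gaussMeasure β d n)) := by
  have := isProbabilityMeasure_gaussMeasure hβ d n
  exact ((integrable_norm_gauss hβ).comp_fst _).add ((integrable_norm_gauss hβ).comp_snd _)

/-- Write `u` for the average `ou β θ h` and substitute `z = c v + s w`, `y = s v - c w`. Then `v =
c z + s y` and the direction `-s v + c w` becomes `-y`. Gaussian integration by parts in `y`, with
`z` fixed, replaces `-y · ∇h(z)` by `-1 / β` times a derivative of `log u(c z + s y)`, that is by
`-(s / β) ∇h(z) · ∇u / u`. Back in the old variables, integrating `∇h(c v + s w)` over `w` gives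
`ouGrad`, while `∇u` is `c` times `ouGrad`; this accounts for the other factor `c`. -/
theorem integral_log_mul_eq (hβ : 0 < β) {h : Vel d n → ℝ} (hh : IsBddC1 h) {m : ℝ} (hm : 0 < m)
    (hm' : ∀ v, m ≤ h v) (θ : ℝ) :
    ∫ v, (Real.log (ou β θ h v) + 1) * (∫ w, dot (grad h (Real.cos θ • v + Real.sin θ • w))
      (-Real.sin θ • v + Real.cos θ • w) ∂gaussMeasure β d n) ∂gaussMeasure β d n =
    -(Real.sin θ * Real.cos θ / β) * ouDissipation β θ h := by
  set γ := gaussMeasure β d n with hγ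
  have : IsProbabilityMeasure γ := isProbabilityMeasure_gaussMeasure hβ d n
  set c := Real.cos θ with hc
  set s := Real.sin θ with hs
  have hcs : c ^ 2 + s ^ 2 = 1 := Real.cos_sq_add_sin_sq θ
  have hu : IsBddC1 (ou β θ h) := isBddC1_ou hβ hh θ
  have hmu : ∀ v, m ≤ ou β θ h v := le_flowAvg (isFlow_ou hβ d n θ) hh hm'
  obtain ⟨hl, hlfd⟩ := hu.log_add_one hm hmu
  obtain ⟨L, hL⟩ := hl.bdd
  have hL0 : 0 ≤ L := (norm_nonneg _).trans (hL 0)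
  obtain ⟨K', hK0, hK'⟩ := hh.exists_norm_grad_le
  obtain ⟨B, hB0, hB⟩ := hu.exists_norm_grad_le
  have cg := continuous_grad hh.contDiff
  have cu := continuous_grad hu.contDiff
  set Ψ : Vel d n × Vel d n → ℝ := fun p => (Real.log (ou β θ h p.1) + 1) *
    dot (grad h (c • p.1 + s • p.2)) (-s • p.1 + c • p.2) with hΨ
  have cΨ : Continuous Ψ := (hl.contDiff.continuous.comp continuous_fst).mul
    (continuous_dot_comp (cg.comp (by fun_prop)) (by fun_prop))
  have iΨ : Integrable Ψ (γ.prod γ) := by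
    refine ((integrable_norm_add_norm_prod hβ d n).const_mul (L * (n * K'))).mono'
      cΨ.aestronglyMeasurable (Eventually.of_forall fun p => ?_)
    rw [norm_mul, mul_assoc]
    refine mul_le_mul (hL _) ?_ (norm_nonneg _) hL0
    rw [Real.norm_eq_abs, mul_assoc]
    refine (abs_dot_le _ _).trans ?_
    gcongr
    · exact hK' _
    · exact norm_sin_smul_add_cos_smul_le _ _ θ
  have hR := measurePreserving_reflection hβ d n hcs
  set Ψ₂ : Vel d n × Vel d n → ℝ := fun p =>
    dot (grad h (c • p.1 + s • p.2)) (grad (ou β θ h) p.1) / ou β θ h p.1 with hΨ₂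
  have cΨ₂ : Continuous Ψ₂ := (continuous_dot_comp (cg.comp (by fun_prop))
    (cu.comp continuous_fst)).div (hu.contDiff.continuous.comp continuous_fst)
      fun p => (hm.trans_le (hmu _)).ne'
  have iΨ₂ : Integrable Ψ₂ (γ.prod γ) := by
    refine Integrable.of_bound cΨ₂.aestronglyMeasurable (n * (K' * B) / m)
      (Eventually.of_forall fun p => ?_)
    rw [norm_div, Real.norm_of_nonneg (hm.trans_le (hmu _)).le, Real.norm_eq_abs]
    gcongr
    · refine (abs_dot_le _ _).trans ?_
      gcongr
      · exact hK' _
      · exact hB _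
    · exact hmu _
  -- Since the reflection is an involution, substituting it turns the argument of `grad h` into the
  -- first variable alone.
  have eR : ∀ p : Vel d n × Vel d n, c • (reflection c s p).1 + s • (reflection c s p).2 = p.1 :=
    fun p => congrArg Prod.fst (reflection_reflection hcs p)
  have eR2 : ∀ p : Vel d n × Vel d n,
      -s • (reflection c s p).1 + c • (reflection c s p).2 = -p.2 := fun p => by
    have := congrArg Prod.snd (reflection_reflection hcs p)
    rw [← this]
    simp only [reflection_apply]
    module
  -- Only the logarithm depends on `y` here; `grad h z` is a constant direction, so no second
  -- derivative of `h` is needed.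
  have hstein : ∀ z : Vel d n, ∫ y, Ψ (reflection c s (z, y)) ∂γ =
      -(s / β) * ∫ y, Ψ₂ (reflection c s (z, y)) ∂γ := fun z => by
    obtain ⟨hq, hqfd⟩ := hl.comp_affine (c • z) s
    have h1 := integral_mul_dot_gauss hβ hq (grad h z)
    have e1 : ∀ y, Ψ (reflection c s (z, y)) =
        -((Real.log (ou β θ h (c • z + s • y)) + 1) * dot (grad h z) y) := fun y => by
      simp only [hΨ, eR, eR2]
      rw [← neg_one_smul ℝ y, dot_smul_right]
      simp only [reflection_apply]
      ring
    have e2 : ∀ y, fderiv ℝ (fun y => Real.log (ou β θ h (c • z + s • y)) + 1) y (grad h z) =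
        s * Ψ₂ (reflection c s (z, y)) := fun y => by
      simp only [hΨ₂, eR]
      rw [hqfd, hlfd, smul_apply, ← dot_grad, dot_comm]
      simp only [reflection_apply, smul_eq_mul]
      ring
    simp only [e1, integral_neg]
    rw [h1]
    simp only [e2, integral_const_mul]
    ring
  have t1 : ∫ p, Ψ p ∂(γ.prod γ) = -(s / β) * ∫ p, Ψ₂ p ∂(γ.prod γ) := by
    have a1 : ∫ p, Ψ p ∂(γ.prod γ) = ∫ p, Ψ (reflection c s p) ∂(γ.prod γ) := by
      have := integral_map (μ := γ.prod γ) (f := Ψ) hR.measurable.aemeasurable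
        cΨ.aestronglyMeasurable
      rwa [hR.map_eq] at this
    have a2 : ∫ p, Ψ₂ p ∂(γ.prod γ) = ∫ p, Ψ₂ (reflection c s p) ∂(γ.prod γ) := by
      have := integral_map (μ := γ.prod γ) (f := Ψ₂) hR.measurable.aemeasurable
        cΨ₂.aestronglyMeasurable
      rwa [hR.map_eq] at this
    have b1 : Integrable (fun p => Ψ (reflection c s p)) (γ.prod γ) :=
      hR.integrable_comp_of_integrable iΨ
    have b2 : Integrable (fun p => Ψ₂ (reflection c s p)) (γ.prod γ) :=
      hR.integrable_comp_of_integrable iΨ₂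
    rw [a1, a2, integral_prod _ b1, integral_prod _ b2, ← integral_const_mul]
    simp only [hstein]
  have t2 : ∫ p, Ψ p ∂(γ.prod γ) = ∫ v, (Real.log (ou β θ h v) + 1) *
      (∫ w, dot (grad h (c • v + s • w)) (-s • v + c • w) ∂γ) ∂γ := by
    rw [integral_prod _ iΨ]
    simp only [hΨ, integral_const_mul]
  have t3 : ∫ p, Ψ₂ p ∂(γ.prod γ) = c * ouDissipation β θ h := by
    rw [integral_prod _ iΨ₂, ouDissipation, ← integral_const_mul]
    congr 1
    funext v
    simp only [hΨ₂, integral_div]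
    rw [mul_div_assoc']
    congr 1
    have hiv : Integrable (fun w => grad h (c • v + s • w)) γ :=
      Integrable.of_bound (cg.comp (by fun_prop)).aestronglyMeasurable K'
        (Eventually.of_forall fun w => hK' _)
    rw [grad_ou hβ hh]
    simp only [dot_smul_right, integral_const_mul]
    congr 1
    set x := ouGrad β θ h v with hx
    have e3 : ∀ w, dot (grad h (c • v + s • w)) x =
        ∑ p : Fin n × Fin d, grad h (c • v + s • w) p.1 p.2 * x p.1 p.2 := fun w =>
      dot_eq_sum _ _
    simp only [e3]
    rw [integral_finsetSum _ fun p _ => (integrable_vel_iff.1 hiv p.1 p.2).mul_const _,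
      normSq_eq_dot, dot_eq_sum]
    refine Finset.sum_congr rfl fun p _ => ?_
    rw [integral_mul_const]
    congr 1
    exact ((PiLp.proj 2 (fun _ : Fin d => ℝ) p.2 : EuclideanSpace ℝ (Fin d) →L[ℝ] ℝ).comp
      (ContinuousLinearMap.proj (R := ℝ) (φ := fun _ : Fin n => EuclideanSpace ℝ (Fin d)) p.1)
      ).integral_comp_comm hiv
  rw [← t2, t1, t3]
  ring

/-- De Bruijn's identity for the Ornstein–Uhlenbeck flow. -/
theorem hasDerivAt_entropy_ou (hβ : 0 < β) {h : Vel d n → ℝ} (hh : IsBddC1 h) {m : ℝ} (hm : 0 < m)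
    (hm' : ∀ v, m ≤ h v) (θ : ℝ) :
    HasDerivAt (fun θ => ∫ v, ou β θ h v * Real.log (ou β θ h v) ∂gaussMeasure β d n)
      (-(Real.sin θ * Real.cos θ / β) * ouDissipation β θ h) θ := by
  rw [← integral_log_mul_eq hβ hh hm hm' θ]
  have : IsProbabilityMeasure (gaussMeasure β d n) := isProbabilityMeasure_gaussMeasure hβ d n
  have hmu : ∀ θ v, m ≤ ou β θ h v := fun θ => le_flowAvg (isFlow_ou hβ d n θ) hh hm'
  have hcu : ∀ θ, Continuous (ou β θ h) := fun θ => (isBddC1_ou hβ hh θ).contDiff.continuous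
  obtain ⟨K, hK⟩ := hh.bdd
  obtain ⟨K', hK0, hK'⟩ := hh.exists_norm_grad_le
  have hKu : ∀ θ v, ‖ou β θ h v‖ ≤ K := fun θ v => by
    have := norm_integral_le_of_norm_le_const (μ := gaussMeasure β d n)
      (f := fun w => h (Real.cos θ • v + Real.sin θ • w)) (C := K)
      (Eventually.of_forall fun e => hK _)
    simpa [ou_apply] using this
  have hlog : ∀ θ v, ‖Real.log (ou β θ h v)‖ ≤ |Real.log m| + |Real.log K| := fun θ v =>
    abs_log_le hm (hmu θ v) ((le_abs_self _).trans (hKu θ v))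
  have hcl : ∀ θ, Continuous fun v => ou β θ h v * Real.log (ou β θ h v) := fun θ =>
    (hcu θ).mul ((hcu θ).log fun v => (hm.trans_le (hmu θ v)).ne')
  have hq : ∀ θ : ℝ, Continuous fun p : Vel d n × Vel d n =>
      dot (grad h (Real.cos θ • p.1 + Real.sin θ • p.2))
        (-Real.sin θ • p.1 + Real.cos θ • p.2) := fun θ =>
    continuous_dot_comp ((continuous_grad hh.contDiff).comp (by fun_prop)) (by fun_prop)
  set D : ℝ → Vel d n → ℝ := fun θ v => ∫ w, dot (grad h (Real.cos θ • v + Real.sin θ • w))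
    (-Real.sin θ • v + Real.cos θ • w) ∂gaussMeasure β d n with hD
  have hDm : ∀ θ, AEStronglyMeasurable (D θ) (gaussMeasure β d n) := fun θ =>
    (hq θ).stronglyMeasurable.integral_prod_right'.aestronglyMeasurable
  set I := ∫ w : Vel d n, ‖w‖ ∂gaussMeasure β d n with hI
  have hDb : ∀ θ v, ‖D θ v‖ ≤ n * K' * (‖v‖ + I) := fun θ v => by
    have hint := ((integrable_const ‖v‖).add (integrable_norm_gauss (d := d) (n := n) hβ)).const_mul
      (n * K')
    have := norm_integral_le_of_norm_le (μ := gaussMeasure β d n)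
      (f := fun w => dot (grad h (Real.cos θ • v + Real.sin θ • w))
        (-Real.sin θ • v + Real.cos θ • w)) hint (Eventually.of_forall fun w => by
        rw [Real.norm_eq_abs]
        refine (abs_dot_le _ _).trans ?_
        rw [mul_assoc, Pi.add_apply]
        gcongr
        · exact hK' _
        · exact norm_sin_smul_add_cos_smul_le v w θ)
    refine this.trans (le_of_eq ?_)
    simp only [Pi.add_apply]
    rw [integral_const_mul, integral_add (integrable_const _) (integrable_norm_gauss hβ)]
    simp [hI]
  refine (hasDerivAt_integral_of_dominated_loc_of_deriv_le (s := univ)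
    (bound := fun v => (|Real.log m| + |Real.log K| + 1) * (n * K' * (‖v‖ + I)))
    (F := fun θ v => ou β θ h v * Real.log (ou β θ h v))
    (F' := fun θ v => (Real.log (ou β θ h v) + 1) * D θ v) univ_mem
    (Eventually.of_forall fun θ => (hcl θ).aestronglyMeasurable)
    (Integrable.of_bound (hcl θ).aestronglyMeasurable (K * (|Real.log m| + |Real.log K|))
      (Eventually.of_forall fun v => ?_)) ?_
    (Eventually.of_forall fun v θ _ => ?_) ?_ (Eventually.of_forall fun v θ _ => ?_)).2
  · rw [norm_mul]
    exact mul_le_mul (hKu θ v) (hlog θ v) (norm_nonneg _) ((norm_nonneg _).trans (hK 0))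
  · exact (((hcu θ).log fun v => (hm.trans_le (hmu θ v)).ne').add
      continuous_const).aestronglyMeasurable.mul (hDm θ)
  · rw [norm_mul]
    refine mul_le_mul ((norm_add_le _ _).trans ?_) (hDb θ v) (norm_nonneg _) (by positivity)
    rw [norm_one]
    exact add_le_add (hlog θ v) le_rfl
  · exact (((integrable_norm_gauss hβ).add (integrable_const I)).const_mul (n * K')).const_mul _
  · have h1 := hasDerivAt_ou hβ hh θ v
    exact (Real.hasDerivAt_mul_log (hm.trans_le (hmu θ v)).ne').comp θ h1

end entropy

end KacModel

namespace KacModel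

/-! ### Logarithmic Sobolev inequality and contraction of the entropy for smooth functions. -/

section entropy

variable {d n : ℕ} {β : ℝ}

/-- The Fisher information of a smooth positive function. -/
noncomputable def smoothFisher {d n : ℕ} (β : ℝ) (h : Vel d n → ℝ) : ℝ :=
  ∫ v, normSq (grad h v) / h v ∂gaussMeasure β d n

theorem integrable_normSq_div (hβ : 0 < β) {u : Vel d n → ℝ} {x : Vel d n → Vel d n}
    (hu : Continuous u) (hx : Continuous x) {m : ℝ} (hm : 0 < m) (hmu : ∀ v, m ≤ u v) {K : ℝ}
    (hK : ∀ v, ‖x v‖ ≤ K) :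
    Integrable (fun v => normSq (x v) / u v) (gaussMeasure β d n) := by
  have := isProbabilityMeasure_gaussMeasure hβ d n
  refine Integrable.of_bound ((continuous_normSq.comp hx).div hu
    fun v => (hm.trans_le (hmu v)).ne').aestronglyMeasurable (n * K ^ 2 / m)
    (Eventually.of_forall fun v => ?_)
  rw [norm_div, Real.norm_of_nonneg (normSq_nonneg _), Real.norm_of_nonneg (hm.trans_le (hmu v)).le]
  gcongr
  · refine (normSq_le_sq_norm _).trans ?_
    gcongr
    exact hK v
  · exact hmu v

theorem ofReal_smoothFisher (hβ : 0 < β) {h : Vel d n → ℝ} (hh : IsBddC1 h) {m : ℝ} (hm : 0 < m)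
    (hm' : ∀ v, m ≤ h v) : ENNReal.ofReal (smoothFisher β h) =
      ∫⁻ v, ENNReal.ofReal (normSq (grad h v)) / ENNReal.ofReal (h v) ∂gaussMeasure β d n := by
  obtain ⟨K, -, hK⟩ := hh.exists_norm_grad_le
  rw [smoothFisher, ofReal_integral_eq_lintegral_ofReal (integrable_normSq_div hβ
    hh.contDiff.continuous (continuous_grad hh.contDiff) hm hm' hK)
    (Eventually.of_forall fun v => div_nonneg (normSq_nonneg _) (hm.trans_le (hm' v)).le)]
  refine lintegral_congr fun v => ?_
  rw [ENNReal.ofReal_div_of_pos (hm.trans_le (hm' v))]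

theorem smoothFisher_nonneg {h : Vel d n → ℝ} {m : ℝ} (hm : 0 < m)
    (hm' : ∀ v, m ≤ h v) : 0 ≤ smoothFisher β h :=
  integral_nonneg fun v => div_nonneg (normSq_nonneg _) (hm.trans_le (hm' v)).le

theorem smoothFisher_flowAvg_le (hβ : 0 < β) {E : Type*} [MeasurableSpace E] {P : Measure E}
    [IsProbabilityMeasure P] {A : E → Vel d n →L[ℝ] Vel d n} {b : E → Vel d n} {c : ℝ}
    (hA : IsFlow P β A b c) (hc : 0 ≤ c) {h : Vel d n → ℝ} (hh : IsBddC1 h) {m : ℝ} (hm : 0 < m)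
    (hm' : ∀ v, m ≤ h v) : smoothFisher β (flowAvg P A b h) ≤ c * smoothFisher β h := by
  have h0 := smoothFisher_nonneg (β := β) hm hm'
  have h1 := hA.fisher_flowAvg_le hβ hh.contDiff.continuous.measurable
    (fun v => (hm.trans_le (hm' v)).le) (continuous_grad hh.contDiff).measurable
    (hh.integrable_gauss hβ) (hh.integrable_grad_gauss hβ)
  rw [← hA.grad_flowAvg hh, ← ofReal_smoothFisher hβ (hA.isBddC1_flowAvg hh) hm
    (le_flowAvg hA hh hm'), ← ofReal_smoothFisher hβ hh hm hm', ← ENNReal.ofReal_mul hc] at h1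
  exact (ENNReal.ofReal_le_ofReal_iff (by positivity)).1 h1

/-- The entropy thus decreases at the rate `tan θ / β` times the information for `θ < π / 2`.
Writing the rate with `ouDissipation` instead removes the singularity at `π / 2`. -/
theorem smoothFisher_ou (hβ : 0 < β) {h : Vel d n → ℝ} (hh : IsBddC1 h) (θ : ℝ) :
    smoothFisher β (ou β θ h) = Real.cos θ ^ 2 * ouDissipation β θ h := by
  rw [smoothFisher, ouDissipation, ← integral_const_mul]
  congr 1
  funext v
  rw [grad_ou hβ hh, normSq_smul, mul_div_assoc]

/-- The logarithmic Sobolev inequality, with a constant which is not optimal. -/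
theorem entropy_le_smoothFisher (hβ : 0 < β) {h : Vel d n → ℝ} (hh : IsBddC1 h) {m : ℝ}
    (hm : 0 < m) (hm' : ∀ v, m ≤ h v) :
    ∫ v, h v * Real.log (h v) ∂gaussMeasure β d n ≤
      (∫ v, h v ∂gaussMeasure β d n) * Real.log (∫ v, h v ∂gaussMeasure β d n) +
      Real.pi / 2 / β * smoothFisher β h := by
  have hpr := isProbabilityMeasure_gaussMeasure hβ d n
  set F := smoothFisher β h with hF
  have hF0 : 0 ≤ F := smoothFisher_nonneg hm hm'
  -- The slope `F / β` dominates the dissipation rate, so `D` increases. The interval has length `π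
  -- / 2`, whence the constant.
  set D : ℝ → ℝ := fun θ =>
    (∫ v, ou β θ h v * Real.log (ou β θ h v) ∂gaussMeasure β d n) + F / β * θ with hD
  have hd : ∀ θ, HasDerivAt D
      (-(Real.sin θ * Real.cos θ / β) * ouDissipation β θ h + F / β * 1) θ := fun θ =>
    (hasDerivAt_entropy_ou hβ hh hm hm' θ).add ((hasDerivAt_id θ).const_mul _)
  have hmono : MonotoneOn D (Icc 0 (Real.pi / 2)) := by
    refine monotoneOn_of_deriv_nonneg (convex_Icc _ _)
      (fun θ _ => (hd θ).continuousAt.continuousWithinAt)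
      (fun θ _ => (hd θ).differentiableAt.differentiableWithinAt) fun θ hθ => ?_
    rw [interior_Icc] at hθ
    have hc : 0 < Real.cos θ := Real.cos_pos_of_mem_Ioo ⟨by linarith [hθ.1, Real.pi_pos], hθ.2⟩
    rw [(hd θ).deriv]
    -- The flow `ou` contracts the information by `cos² θ`, the very factor between information and
    -- dissipation. After cancellation the dissipation is at most `F`; the crude bound `sin θ cos θ
    -- ≤ 1` then suffices.
    have h1 := smoothFisher_flowAvg_le hβ (isFlow_ou hβ d n θ) (sq_nonneg _) hh hm hm'
    change smoothFisher β (ou β θ h) ≤ _ at h1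
    rw [smoothFisher_ou hβ hh] at h1
    have h2 : ouDissipation β θ h ≤ F := le_of_mul_le_mul_left h1 (by positivity)
    have h3 : Real.sin θ * Real.cos θ ≤ 1 := by
      nlinarith [Real.sin_sq_add_cos_sq θ, sq_nonneg (Real.sin θ - Real.cos θ)]
    have h4 : 0 ≤ Real.sin θ * Real.cos θ := mul_nonneg
      (Real.sin_nonneg_of_nonneg_of_le_pi hθ.1.le (by linarith [hθ.2, Real.pi_pos])) hc.le
    have h5 : Real.sin θ * Real.cos θ * ouDissipation β θ h ≤ F :=
      (mul_le_mul_of_nonneg_left h2 h4).trans (mul_le_of_le_one_left hF0 h3)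
    have : -(Real.sin θ * Real.cos θ / β) * ouDissipation β θ h + F / β * 1 =
      (F - Real.sin θ * Real.cos θ * ouDissipation β θ h) / β := by ring
    rw [this]
    exact div_nonneg (by linarith) hβ.le
  have hπ : 0 ≤ Real.pi / 2 := by positivity
  have := hmono (left_mem_Icc.2 hπ) (right_mem_Icc.2 hπ) hπ
  simp only [hD, ou_zero hβ, ou_pi_div_two, mul_zero, add_zero, integral_const,
    probReal_univ, one_smul] at this
  refine this.trans (le_of_eq ?_)
  ring

/-- The contraction of the entropy for smooth functions. -/
theorem IsFlow.entropy_flowAvg_le (hβ : 0 < β) {E : Type*} [MeasurableSpace E] {P : Measure E}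
    [IsProbabilityMeasure P] {A : E → Vel d n →L[ℝ] Vel d n} {b : E → Vel d n} {c : ℝ}
    (hA : IsFlow P β A b c) (hc : 0 ≤ c)
    (hcomm : ∀ h : Vel d n → ℝ, IsBddC1 h → ∀ θ,
      ou β θ (flowAvg P A b h) = flowAvg P A b (ou β θ h))
    {h : Vel d n → ℝ} (hh : IsBddC1 h) {m : ℝ} (hm : 0 < m) (hm' : ∀ v, m ≤ h v) :
    ∫ v, flowAvg P A b h v * Real.log (flowAvg P A b h v) ∂gaussMeasure β d n ≤
      c * ∫ v, h v * Real.log (h v) ∂gaussMeasure β d n + (1 - c) *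
      ((∫ v, h v ∂gaussMeasure β d n) * Real.log (∫ v, h v ∂gaussMeasure β d n)) := by
  have hpr := isProbabilityMeasure_gaussMeasure hβ d n
  have hT := hA.isBddC1_flowAvg hh
  have hTm := le_flowAvg hA hh hm'
  set T := flowAvg P A b h with hTdef
  -- At `θ = π / 2` both functions have become the same constant, the mean of `h`. Comparing this
  -- value of `D` with the one at `0` is the claim, including the term with `1 - c`.
  set D : ℝ → ℝ := fun θ =>
    c * (∫ v, ou β θ h v * Real.log (ou β θ h v) ∂gaussMeasure β d n) -
      ∫ v, ou β θ T v * Real.log (ou β θ T v) ∂gaussMeasure β d n with hD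
  have hd : ∀ θ, HasDerivAt D
      (c * (-(Real.sin θ * Real.cos θ / β) * ouDissipation β θ h) -
        -(Real.sin θ * Real.cos θ / β) * ouDissipation β θ T) θ := fun θ =>
    ((hasDerivAt_entropy_ou hβ hh hm hm' θ).const_mul c).sub
      (hasDerivAt_entropy_ou hβ hT hm hTm θ)
  have hanti : AntitoneOn D (Icc 0 (Real.pi / 2)) := by
    refine antitoneOn_of_deriv_nonpos (convex_Icc _ _)
      (fun θ _ => (hd θ).continuousAt.continuousWithinAt)
      (fun θ _ => (hd θ).differentiableAt.differentiableWithinAt) fun θ hθ => ?_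
    rw [interior_Icc] at hθ
    have hcos : 0 < Real.cos θ := Real.cos_pos_of_mem_Ioo ⟨by linarith [hθ.1, Real.pi_pos], hθ.2⟩
    rw [(hd θ).deriv]
    -- The flow is applied to `ou β θ h`. Commutation identifies the result with `ou β θ T`, and
    -- `cos² θ > 0` cancels on both sides inside the open interval.
    have h1 := smoothFisher_flowAvg_le hβ hA hc (isBddC1_ou hβ hh θ) hm
      (le_flowAvg (isFlow_ou hβ d n θ) hh hm')
    rw [← hcomm h hh, smoothFisher_ou hβ hT, smoothFisher_ou hβ hh, mul_left_comm] at h1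
    have h2 : ouDissipation β θ T ≤ c * ouDissipation β θ h :=
      le_of_mul_le_mul_left h1 (by positivity)
    have h4 : 0 ≤ Real.sin θ * Real.cos θ / β := div_nonneg (mul_nonneg
      (Real.sin_nonneg_of_nonneg_of_le_pi hθ.1.le (by linarith [hθ.2, Real.pi_pos])) hcos.le) hβ.le
    have := mul_le_mul_of_nonneg_left h2 h4
    linarith
  have hπ : 0 ≤ Real.pi / 2 := by positivity
  have := hanti (left_mem_Icc.2 hπ) (right_mem_Icc.2 hπ) hπ
  simp only [hD, ou_zero hβ, ou_pi_div_two, integral_const, probReal_univ, one_smul] at this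
  rw [hTdef, hA.integral_flowAvg hβ (hh.integrable_gauss hβ)] at this
  linarith

end entropy

end KacModel

/-! ### Contraction of the entropy for densities of finite entropy, by approximation. -/

namespace KacModel

theorem sub_one_le_mul_log {x : ℝ} (hx : 0 ≤ x) : x - 1 ≤ x * Real.log x := by
  rcases hx.eq_or_lt with rfl | h
  · simp
  · have := Real.one_sub_inv_le_log_of_pos h
    calc x - 1 = x * (1 - x⁻¹) := by field_simp
      _ ≤ _ := by gcongr

/-- Lower semicontinuity of the entropy. -/
theorem entropy_le_of_tendsto {X : Type*} [MeasurableSpace X] {μ : Measure X}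
    [IsProbabilityMeasure μ] {u : ℕ → X → ℝ} {u₀ : X → ℝ}
    (hi : ∀ k, Integrable (fun x => u k x * Real.log (u k x)) μ) (h0 : ∀ k, ∀ᵐ x ∂μ, 0 ≤ u k x)
    (hm : AEStronglyMeasurable u₀ μ)
    (hlim : ∀ᵐ x ∂μ, Tendsto (fun k => u k x) atTop (𝓝 (u₀ x))) {R : ℕ → ℝ} {R₀ : ℝ}
    (hR : ∀ k, ∫ x, u k x * Real.log (u k x) ∂μ ≤ R k) (hR₀ : Tendsto R atTop (𝓝 R₀)) :
    Integrable (fun x => u₀ x * Real.log (u₀ x)) μ ∧ ∫ x, u₀ x * Real.log (u₀ x) ∂μ ≤ R₀ := by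
  -- Since `x log x ≥ x - 1 ≥ -1` for `x ≥ 0`, adding one makes the integrands nonnegative and
  -- Fatou's lemma applicable. On a probability space the shift costs exactly one on each side.
  have hi1 : ∀ k, Integrable (fun x => u k x * Real.log (u k x) + 1) μ := fun k =>
    (hi k).add (integrable_const 1)
  have hnn : ∀ k, ∀ᵐ x ∂μ, 0 ≤ u k x * Real.log (u k x) + 1 := fun k => by
    filter_upwards [h0 k] with x hx
    have := sub_one_le_mul_log hx
    linarith
  have hint : ∀ k, ∫ x, (u k x * Real.log (u k x) + 1) ∂μ =
      ∫ x, u k x * Real.log (u k x) ∂μ + 1 := fun k => by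
    rw [integral_add (hi k) (integrable_const 1)]; simp
  have hmφ : AEStronglyMeasurable (fun x => u₀ x * Real.log (u₀ x)) μ :=
    Real.continuous_mul_log.comp_aestronglyMeasurable hm
  have hnn₀ : ∀ᵐ x ∂μ, 0 ≤ u₀ x * Real.log (u₀ x) + 1 := by
    filter_upwards [hlim, ae_all_iff.2 h0] with x hx h
    have := sub_one_le_mul_log (ge_of_tendsto' hx h)
    have := ge_of_tendsto' hx h
    linarith
  have hF := lintegral_liminf_le' (μ := μ) (u := atTop)
    (f := fun k x => ENNReal.ofReal (u k x * Real.log (u k x) + 1))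
    fun k => (hi1 k).1.aemeasurable.ennreal_ofReal
  have e1 : ∫⁻ x, liminf (fun k => ENNReal.ofReal (u k x * Real.log (u k x) + 1)) atTop ∂μ =
      ∫⁻ x, ENNReal.ofReal (u₀ x * Real.log (u₀ x) + 1) ∂μ := by
    refine lintegral_congr_ae ?_
    filter_upwards [hlim] with x hx
    refine Tendsto.liminf_eq ((ENNReal.continuous_ofReal.tendsto _).comp ?_)
    exact ((Real.continuous_mul_log.tendsto _).comp hx).add_const 1
  rw [e1] at hF
  have e2 : ∀ k, ∫⁻ x, ENNReal.ofReal (u k x * Real.log (u k x) + 1) ∂μ ≤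
      ENNReal.ofReal (R k + 1) := fun k => by
    rw [← ofReal_integral_eq_lintegral_ofReal (hi1 k) (hnn k), hint]
    exact ENNReal.ofReal_le_ofReal (by linarith [hR k])
  have e3 : Tendsto (fun k => ENNReal.ofReal (R k + 1)) atTop (𝓝 (ENNReal.ofReal (R₀ + 1))) :=
    (ENNReal.continuous_ofReal.tendsto _).comp (hR₀.add_const 1)
  have hle : ∫⁻ x, ENNReal.ofReal (u₀ x * Real.log (u₀ x) + 1) ∂μ ≤ ENNReal.ofReal (R₀ + 1) := by
    refine hF.trans ?_
    rw [← e3.liminf_eq]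
    exact liminf_le_liminf (Eventually.of_forall e2)
  have hi₀ : Integrable (fun x => u₀ x * Real.log (u₀ x) + 1) μ := by
    refine ⟨hmφ.add aestronglyMeasurable_const, ?_⟩
    rw [hasFiniteIntegral_iff_ofReal hnn₀]
    exact hle.trans_lt ENNReal.ofReal_lt_top
  have hi₀' : Integrable (fun x => u₀ x * Real.log (u₀ x)) μ :=
    (hi₀.sub (integrable_const 1)).congr (Eventually.of_forall fun x => by simp)
  refine ⟨hi₀', ?_⟩
  have hpos : 0 ≤ R₀ + 1 := by
    refine ge_of_tendsto' (hR₀.add_const 1) fun k => ?_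
    have := integral_nonneg_of_ae (hnn k)
    rw [hint] at this
    linarith [hR k]
  rw [← ofReal_integral_eq_lintegral_ofReal hi₀ hnn₀, ENNReal.ofReal_le_ofReal_iff hpos,
    integral_add hi₀' (integrable_const 1)] at hle
  simp only [integral_const, probReal_univ, one_smul] at hle
  linarith

section

variable {d n : ℕ} {β : ℝ}

theorem locallyIntegrable_of_bound {g : Vel d n → ℝ} (hg : Measurable g) {K : ℝ}
    (hK : ∀ v, ‖g v‖ ≤ K) : LocallyIntegrable g :=
  (memLp_top_of_bound hg.aestronglyMeasurable K (Eventually.of_forall hK)).locallyIntegrable le_top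

theorem le_moll (k : ℕ) {g : Vel d n → ℝ} (hg : LocallyIntegrable g) {m : ℝ} (hm : ∀ v, m ≤ g v)
    (v : Vel d n) : m ≤ moll k g v := by
  have h1 : Integrable fun t => (bump d n k).normed volume t • m :=
    (bump d n k).integrable_normed.smul_const m
  have := integral_mono h1 (integrable_moll_integrand k hg v) fun t =>
    mul_le_mul_of_nonneg_left (hm (v - t)) ((bump d n k).nonneg_normed t)
  rwa [integral_smul_const, (bump d n k).integral_normed, one_smul] at this

theorem moll_le (k : ℕ) {g : Vel d n → ℝ} (hg : LocallyIntegrable g) {K : ℝ} (hK : ∀ v, g v ≤ K)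
    (v : Vel d n) : moll k g v ≤ K := by
  have h1 : Integrable fun t => (bump d n k).normed volume t • K :=
    (bump d n k).integrable_normed.smul_const K
  have := integral_mono (integrable_moll_integrand k hg v) h1 fun t =>
    mul_le_mul_of_nonneg_left (hK (v - t)) ((bump d n k).nonneg_normed t)
  rwa [integral_smul_const, (bump d n k).integral_normed, one_smul] at this

/-- The derivative falls on the kernel, whose derivative is integrable, so boundedness of `g` is
enough. -/
theorem isBddC1_moll (k : ℕ) {g : Vel d n → ℝ} (hg : Measurable g) {K : ℝ}
    (hK : ∀ v, ‖g v‖ ≤ K) : IsBddC1 (moll k g) := by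
  have hl := locallyIntegrable_of_bound hg hK
  have hK0 : 0 ≤ K := (norm_nonneg _).trans (hK 0)
  have hc := (bump d n k).hasCompactSupport_normed (μ := volume)
  have hs : ContDiff ℝ 1 ((bump d n k).normed volume) := (bump d n k).contDiff_normed
  have hi : Integrable (fderiv ℝ ((bump d n k).normed volume)) :=
    (hs.continuous_fderiv one_ne_zero).integrable_of_hasCompactSupport (hc.fderiv ℝ)
  refine ⟨(contDiff_moll k hl).of_le (by norm_cast), ⟨K, fun v => ?_⟩,
    ⟨K * ∫ t, ‖fderiv ℝ ((bump d n k).normed volume) t‖, fun v => ?_⟩⟩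
  · refine (norm_moll_le k v).trans (moll_le k ?_ hK v)
    exact locallyIntegrable_of_bound hg.norm fun v => by rw [norm_norm]; exact hK v
  · refine ContinuousLinearMap.opNorm_le_bound _
      (mul_nonneg hK0 (integral_nonneg fun _ => norm_nonneg _)) fun w => ?_
    rw [fderiv_moll_apply k hl]
    have hi2 : Integrable fun t => K * ‖w‖ * ‖fderiv ℝ ((bump d n k).normed volume) (v - t)‖ :=
      ((hi.comp_sub_left v).norm).const_mul _
    refine (norm_integral_le_of_norm_le hi2 (Eventually.of_forall fun t => ?_)).trans (le_of_eq ?_)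
    · rw [norm_mul]
      calc _ ≤ ‖fderiv ℝ ((bump d n k).normed volume) (v - t)‖ * ‖w‖ * K :=
            mul_le_mul (ContinuousLinearMap.le_opNorm _ _) (hK t) (norm_nonneg _) (by positivity)
        _ = _ := by ring
    · rw [integral_const_mul, integral_sub_left_eq_self
        (fun t => ‖fderiv ℝ ((bump d n k).normed volume) t‖) volume v]
      ring

theorem abs_mul_log_le {m K x : ℝ} (hm : 0 < m) (h1 : m ≤ x) (h2 : x ≤ K) :
    ‖x * Real.log x‖ ≤ K * (|Real.log m| + |Real.log K|) := by
  rw [norm_mul, Real.norm_of_nonneg (hm.le.trans h1)]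
  exact mul_le_mul h2 (abs_log_le hm h1 h2) (norm_nonneg _) (hm.le.trans (h1.trans h2))

theorem flowAvg_bounds {E : Type*} [MeasurableSpace E] {P : Measure E} [IsProbabilityMeasure P]
    {A : E → Vel d n →L[ℝ] Vel d n} {b : E → Vel d n} {c : ℝ} (hA : IsFlow P β A b c)
    {h : Vel d n → ℝ} (hh : Measurable h) {m K : ℝ} (hm : ∀ v, m ≤ h v) (hK : ∀ v, h v ≤ K)
    (v : Vel d n) : m ≤ flowAvg P A b h v ∧ flowAvg P A b h v ≤ K := by
  have hi : Integrable (fun e => h (A e v + b e)) P :=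
    Integrable.of_bound (hh.comp
      (hA.measurable_eval.comp measurable_prodMk_right)).aestronglyMeasurable (max |m| |K|)
      (Eventually.of_forall fun e => abs_le_max_abs_abs (hm _) (hK _))
  have h1 := integral_mono (μ := P) (integrable_const m) hi fun e => hm _
  have h2 := integral_mono (μ := P) hi (integrable_const K) fun e => hK _
  simp only [integral_const, probReal_univ, one_smul] at h1 h2
  exact ⟨h1, h2⟩

variable {E : Type*} [MeasurableSpace E] {P : Measure E}
    [IsProbabilityMeasure P] {A : E → Vel d n →L[ℝ] Vel d n} {b : E → Vel d n} {c : ℝ}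

theorem tendsto_integral_gauss (hβ : 0 < β) {f : ℕ → Vel d n → ℝ} {f₀ : Vel d n → ℝ}
    (hf : ∀ k, Integrable (f k) (gaussMeasure β d n)) (hf₀ : Integrable f₀ (gaussMeasure β d n))
    (h : Tendsto (fun k => eLpNorm (f k - f₀) 1 (gaussMeasure β d n)) atTop (𝓝 0)) :
    Tendsto (fun k => ∫ v, f k v ∂gaussMeasure β d n) atTop (𝓝 (∫ v, f₀ v ∂gaussMeasure β d n)) :=
  tendsto_integral_of_L1' f₀ hf₀.1 (Eventually.of_forall hf) h

/-- Mollification and averaging keep values in `[m, K]`, so all integrands of the entropy are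
uniformly bounded and dominated convergence applies. A subsequence makes the averages converge
almost everywhere. -/
theorem IsFlow.entropy_flowAvg_le_of_bounded (hβ : 0 < β)
    (hA : IsFlow P β A b c) (hc : 0 ≤ c)
    (hcomm : ∀ h : Vel d n → ℝ, IsBddC1 h → ∀ θ,
      ou β θ (flowAvg P A b h) = flowAvg P A b (ou β θ h))
    {g : Vel d n → ℝ} (hg : Measurable g) {m K : ℝ} (hm : 0 < m) (hm' : ∀ v, m ≤ g v)
    (hK : ∀ v, g v ≤ K) :
    ∫ v, flowAvg P A b g v * Real.log (flowAvg P A b g v) ∂gaussMeasure β d n ≤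
      c * ∫ v, g v * Real.log (g v) ∂gaussMeasure β d n + (1 - c) *
      ((∫ v, g v ∂gaussMeasure β d n) * Real.log (∫ v, g v ∂gaussMeasure β d n)) := by
  have hpr := isProbabilityMeasure_gaussMeasure hβ d n
  have hnK : ∀ v, ‖g v‖ ≤ K := fun v => by
    rw [Real.norm_of_nonneg (hm.le.trans (hm' v))]; exact hK v
  have hl := locallyIntegrable_of_bound hg hnK
  have hb : ∀ k, IsBddC1 (moll k g) := fun k => isBddC1_moll k hg hnK
  have hbm : ∀ k v, m ≤ moll k g v := fun k => le_moll k hl hm'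
  have hbK : ∀ k v, moll k g v ≤ K := fun k => moll_le k hl hK
  have hig : Integrable g (gaussMeasure β d n) :=
    Integrable.of_bound hg.aestronglyMeasurable K (Eventually.of_forall hnK)
  have hlim : ∀ᵐ v ∂gaussMeasure β d n, Tendsto (fun k => moll k g v) atTop (𝓝 (g v)) :=
    (ae_gaussMeasure_iff hβ).2 (ae_tendsto_moll hl)
  have t0 : Tendsto (fun k => eLpNorm (moll k g - g) 1 (gaussMeasure β d n)) atTop (𝓝 0) :=
    tendsto_eLpNorm_one_of_dominated (fun _ => K)
      (fun k => (hb k).contDiff.continuous.aestronglyMeasurable) (integrable_const K)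
      (fun k => Eventually.of_forall fun v => by
        rw [Real.norm_of_nonneg (hm.le.trans (hbm k v))]; exact hbK k v) hlim
  have t1 := hA.tendsto_flowAvg hβ (fun k => (hb k).integrable_gauss hβ) hig t0
  obtain ⟨ns, hns, hae⟩ := exists_subseq_tendsto_ae
    (fun k => (hA.integrable_flowAvg hβ ((hb k).integrable_gauss hβ)).1)
    (hA.integrable_flowAvg hβ hig).1 t1
  have hdct : ∀ {u : ℕ → Vel d n → ℝ} {u₀ : Vel d n → ℝ},
      (∀ k, AEStronglyMeasurable (u k) (gaussMeasure β d n)) → (∀ k v, m ≤ u k v) →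
      (∀ k v, u k v ≤ K) →
      (∀ᵐ v ∂gaussMeasure β d n, Tendsto (fun k => u k v) atTop (𝓝 (u₀ v))) →
      Tendsto (fun k => ∫ v, u k v * Real.log (u k v) ∂gaussMeasure β d n) atTop
        (𝓝 (∫ v, u₀ v * Real.log (u₀ v) ∂gaussMeasure β d n)) := fun {u u₀} h1 h2 h3 h4 => by
    refine tendsto_integral_of_dominated_convergence (fun _ => K * (|Real.log m| + |Real.log K|))
      (fun k => Real.continuous_mul_log.comp_aestronglyMeasurable (h1 k)) (integrable_const _)
      (fun k => Eventually.of_forall fun v => abs_mul_log_le hm (h2 k v) (h3 k v)) ?_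
    filter_upwards [h4] with v hv
    exact (Real.continuous_mul_log.tendsto _).comp hv
  have c1 := hdct (fun k => (hA.isBddC1_flowAvg (hb (ns k))).contDiff.continuous.aestronglyMeasurable)
    (fun k v => (flowAvg_bounds hA (hb (ns k)).contDiff.continuous.measurable (hbm _) (hbK _) v).1)
    (fun k v => (flowAvg_bounds hA (hb (ns k)).contDiff.continuous.measurable (hbm _) (hbK _) v).2)
    hae
  have c2 := (hdct (fun k => (hb k).contDiff.continuous.aestronglyMeasurable) hbm hbK hlim).comp
    hns.tendsto_atTop
  have c3 := (tendsto_integral_gauss hβ (fun k => (hb k).integrable_gauss hβ) hig t0).comp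
    hns.tendsto_atTop
  have c4 := (Real.continuous_mul_log.tendsto _).comp c3
  refine le_of_tendsto_of_tendsto' c1 ((c2.const_mul c).add (c4.const_mul (1 - c))) fun k => ?_
  exact hA.entropy_flowAvg_le hβ hc hcomm (hb (ns k)) hm (hbm (ns k))

/-- The truncation of a nonnegative number to `[1/(k+1), k+1]`. -/
noncomputable def clampSeq (k : ℕ) (x : ℝ) : ℝ := min (max x (1 / ((k : ℝ) + 1))) ((k : ℝ) + 1)

theorem one_div_add_one_le (k : ℕ) : 1 / ((k : ℝ) + 1) ≤ 1 := by
  rw [div_le_one (by positivity)]; linarith [(Nat.cast_nonneg k : (0 : ℝ) ≤ k)]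

theorem le_clampSeq (k : ℕ) (x : ℝ) : 1 / ((k : ℝ) + 1) ≤ clampSeq k x :=
  le_min (le_max_right _ _) ((one_div_add_one_le k).trans
    (by linarith [(Nat.cast_nonneg k : (0 : ℝ) ≤ k)]))

theorem clampSeq_le (k : ℕ) (x : ℝ) : clampSeq k x ≤ (k : ℝ) + 1 := min_le_right _ _

theorem measurable_clampSeq (k : ℕ) : Measurable (clampSeq k) :=
  (measurable_id.max measurable_const).min measurable_const

theorem clampSeq_le_add_one (k : ℕ) {x : ℝ} (hx : 0 ≤ x) : clampSeq k x ≤ x + 1 := by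
  refine (min_le_left _ _).trans (max_le (by linarith) ?_)
  linarith [one_div_add_one_le k]

theorem tendsto_clampSeq {x : ℝ} (hx : 0 ≤ x) : Tendsto (fun k => clampSeq k x) atTop (𝓝 x) := by
  have h1 : Tendsto (fun k : ℕ => max x (1 / ((k : ℝ) + 1))) atTop (𝓝 x) := by
    have := (tendsto_const_nhds (x := x)).max (tendsto_one_div_add_atTop_nhds_zero_nat (𝕜 := ℝ))
    rwa [max_eq_left hx] at this
  refine h1.congr' ?_
  obtain ⟨K, hK⟩ := exists_nat_ge x
  filter_upwards [eventually_ge_atTop K] with k hk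
  have : (K : ℝ) ≤ k := by exact_mod_cast hk
  refine (min_eq_left (max_le (by linarith) ?_)).symm
  have := one_div_add_one_le k
  linarith [(Nat.cast_nonneg k : (0 : ℝ) ≤ k)]

/-- On `(0, 1]` the function `|x log x|` is at most one. A clamped value above one does not exceed
`x`, and `x log x` is increasing there. The bound does not depend on `k`, which gives domination. -/
theorem abs_clampSeq_mul_log_le (k : ℕ) {x : ℝ} :
    ‖clampSeq k x * Real.log (clampSeq k x)‖ ≤ ‖x * Real.log x‖ + 1 := by
  have hk : (0 : ℝ) < 1 / ((k : ℝ) + 1) := by positivity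
  have hk1 := one_div_add_one_le k
  have hpos : 0 < clampSeq k x := hk.trans_le (le_clampSeq k x)
  by_cases h1 : clampSeq k x ≤ 1
  · have := (Real.abs_log_mul_self_lt _ hpos h1).le
    rw [mul_comm, Real.norm_eq_abs]
    linarith [norm_nonneg (x * Real.log x)]
  · push Not at h1
    have h2 : clampSeq k x ≤ x := by
      refine (min_le_left _ _).trans (max_le le_rfl ?_)
      by_contra h3
      push Not at h3
      have : clampSeq k x ≤ 1 := (min_le_left _ _).trans (by rw [max_eq_right h3.le]; exact hk1)
      linarith
    have h3 : clampSeq k x * Real.log (clampSeq k x) ≤ x * Real.log x :=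
      mul_le_mul h2 (Real.log_le_log hpos h2) (Real.log_nonneg h1.le) (hpos.le.trans h2)
    rw [Real.norm_of_nonneg (mul_nonneg hpos.le (Real.log_nonneg h1.le))]
    linarith [le_abs_self (x * Real.log x), Real.norm_eq_abs (x * Real.log x)]

/-- The contraction of the entropy. -/
theorem IsFlow.entropy_flowAvg_le_of_integrable (hβ : 0 < β)
    (hA : IsFlow P β A b c) (hc : 0 ≤ c)
    (hcomm : ∀ h : Vel d n → ℝ, IsBddC1 h → ∀ θ,
      ou β θ (flowAvg P A b h) = flowAvg P A b (ou β θ h))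
    {h : Vel d n → ℝ} (hm : Measurable h) (h0 : ∀ v, 0 ≤ h v)
    (hh : Integrable h (gaussMeasure β d n)) (h1 : ∫ v, h v ∂gaussMeasure β d n = 1)
    (hS : Integrable (fun v => h v * Real.log (h v)) (gaussMeasure β d n)) :
    Integrable (fun v => flowAvg P A b h v * Real.log (flowAvg P A b h v)) (gaussMeasure β d n) ∧
    ∫ v, flowAvg P A b h v * Real.log (flowAvg P A b h v) ∂gaussMeasure β d n ≤
      c * ∫ v, h v * Real.log (h v) ∂gaussMeasure β d n := by
  have hpr := isProbabilityMeasure_gaussMeasure hβ d n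
  set g : ℕ → Vel d n → ℝ := fun k v => clampSeq k (h v) with hg
  have hgm : ∀ k, Measurable (g k) := fun k => (measurable_clampSeq k).comp hm
  have hk : ∀ k : ℕ, (0 : ℝ) < 1 / ((k : ℝ) + 1) := fun k => by positivity
  have hg1 : ∀ (k : ℕ) v, 1 / ((k : ℝ) + 1) ≤ g k v := fun k v => le_clampSeq k _
  have hg2 : ∀ (k : ℕ) v, g k v ≤ (k : ℝ) + 1 := fun k v => clampSeq_le k _
  have hgi : ∀ k, Integrable (g k) (gaussMeasure β d n) := fun k =>
    Integrable.of_bound (hgm k).aestronglyMeasurable ((k : ℝ) + 1) (Eventually.of_forall fun v => by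
      rw [Real.norm_of_nonneg ((hk k).le.trans (hg1 k v))]; exact hg2 k v)
  have t0 : Tendsto (fun k => eLpNorm (g k - h) 1 (gaussMeasure β d n)) atTop (𝓝 0) :=
    tendsto_eLpNorm_one_of_dominated (fun v => h v + 1) (fun k => (hgi k).1)
      (hh.add (integrable_const 1)) (fun k => Eventually.of_forall fun v => by
        rw [Real.norm_of_nonneg ((hk k).le.trans (hg1 k v))]
        exact clampSeq_le_add_one k (h0 v))
      (Eventually.of_forall fun v => tendsto_clampSeq (h0 v))
  have t1 := hA.tendsto_flowAvg hβ hgi hh t0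
  obtain ⟨ns, hns, hae⟩ := exists_subseq_tendsto_ae
    (fun k => (hA.integrable_flowAvg hβ (hgi k)).1) (hA.integrable_flowAvg hβ hh).1 t1
  have c2 : Tendsto (fun k => ∫ v, g k v * Real.log (g k v) ∂gaussMeasure β d n) atTop
      (𝓝 (∫ v, h v * Real.log (h v) ∂gaussMeasure β d n)) := by
    refine tendsto_integral_of_dominated_convergence (fun v => ‖h v * Real.log (h v)‖ + 1)
      (fun k => Real.continuous_mul_log.comp_aestronglyMeasurable (hgi k).1)
      (hS.norm.add (integrable_const 1))
      (fun k => Eventually.of_forall fun v => abs_clampSeq_mul_log_le k)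
      (Eventually.of_forall fun v => ?_)
    exact (Real.continuous_mul_log.tendsto _).comp (tendsto_clampSeq (h0 v))
  have c3 := tendsto_integral_gauss hβ hgi hh t0
  have c4 := (Real.continuous_mul_log.tendsto _).comp c3
  have c5 := ((c2.const_mul c).add (c4.const_mul (1 - c))).comp hns.tendsto_atTop
  -- The mean is one, so its contribution vanishes in the limit.
  rw [h1, Real.log_one, mul_zero, mul_zero, add_zero] at c5
  have hbd : ∀ (k : ℕ) v, 1 / ((k : ℝ) + 1) ≤ flowAvg P A b (g k) v ∧
      flowAvg P A b (g k) v ≤ (k : ℝ) + 1 := fun k =>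
    flowAvg_bounds hA (hgm k) (hg1 k) (hg2 k)
  -- The truncations are dominated, but this does not dominate the entropies of their averages; on
  -- the left side lower semicontinuity is used instead.
  refine entropy_le_of_tendsto (u := fun k => flowAvg P A b (g (ns k))) (fun k => ?_)
    (fun k => Eventually.of_forall fun v => (hk _).le.trans (hbd _ v).1)
    (hA.integrable_flowAvg hβ hh).1 hae (fun k => ?_) c5
  · exact Integrable.of_bound (Real.continuous_mul_log.comp_aestronglyMeasurable
      (hA.integrable_flowAvg hβ (hgi _)).1) _
      (Eventually.of_forall fun v => abs_mul_log_le (hk _) (hbd _ v).1 (hbd _ v).2)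
  · exact hA.entropy_flowAvg_le_of_bounded hβ hc hcomm (hgm _) (hk _) (hg1 _) (hg2 _)

end

end KacModel

namespace KacModel

/-! ### Squares and square roots in the Gaussian Sobolev space. -/

section sqrt

variable {d n : ℕ} {β : ℝ}

theorem integrable_norm_smul_of_memLp {X E : Type*} [MeasurableSpace X] {μ : Measure X}
    [NormedAddCommGroup E] {f : X → ℝ} {g : X → E} (hf : MemLp f 2 μ) (hg : MemLp g 2 μ) :
    Integrable (fun x => |f x| * ‖g x‖) μ :=
  MemLp.integrable_mul (p := 2) (q := 2) hf.norm hg.norm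

/-- The square of a function in `H¹(γ)`. -/
theorem HasWeakGradient.sq (hβ : 0 < β) {u : Vel d n → ℝ} {G : Vel d n → Vel d n}
    (h : HasWeakGradient u G) (hu : MemLp u 2 (gaussMeasure β d n))
    (hG : MemLp G 2 (gaussMeasure β d n)) :
    HasWeakGradient (fun v => u v ^ 2) (fun v => (2 * u v) • G v) := by
  have hpr := isProbabilityMeasure_gaussMeasure hβ d n
  set γ := gaussMeasure β d n with hγ
  set δ : ℕ → ℝ := fun j => 1 / ((j : ℝ) + 1) with hδ
  have hδ0 : ∀ j, 0 < δ j := fun j => by positivity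
  have hδt : Tendsto δ atTop (𝓝 0) := tendsto_one_div_add_atTop_nhds_zero_nat
  -- A regularised square: its derivative is bounded by `1 / δ`, as the chain rule requires, and by
  -- `2 |x|` for every `j`, which gives the integrable bound `2 |u| |G|`.
  set Φ : ℕ → ℝ → ℝ := fun j x => x ^ 2 / (1 + (δ j * x) ^ 2) with hΦ
  have hden : ∀ (j : ℕ) (x : ℝ), 0 < 1 + (δ j * x) ^ 2 := fun j x => by positivity
  have hΦc : ∀ j, ContDiff ℝ 1 (Φ j) := fun j =>
    (contDiff_id.pow 2).div (contDiff_const.add ((contDiff_const.mul contDiff_id).pow 2))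
      fun x => (hden j x).ne'
  have hder : ∀ j x, deriv (Φ j) x = 2 * x / (1 + (δ j * x) ^ 2) ^ 2 := fun j x => by
    have h1 : HasDerivAt (fun y : ℝ => y ^ 2) (2 * x) x := by simpa using hasDerivAt_pow 2 x
    have h2 : HasDerivAt (fun y : ℝ => 1 + (δ j * y) ^ 2) (2 * (δ j * x) * δ j) x := by
      have h3 : HasDerivAt (fun y : ℝ => δ j * y) (δ j) x := by
        simpa using (hasDerivAt_id x).const_mul (δ j)
      simpa using (h3.pow 2).const_add 1
    refine (h1.div h2 (hden j x).ne').deriv.trans ?_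
    congr 1
    ring
  have hsq1 : ∀ j x, 1 ≤ (1 + (δ j * x) ^ 2) ^ 2 := fun j x => by
    have : 0 ≤ (δ j * x) ^ 2 := sq_nonneg _
    nlinarith
  have hle1 : ∀ j x, ‖deriv (Φ j) x‖ ≤ 2 * |x| := fun j x => by
    rw [hder, norm_div, Real.norm_eq_abs, abs_mul, abs_two, Real.norm_of_nonneg (by positivity)]
    exact div_le_self (by positivity) (hsq1 j x)
  have hle2 : ∀ j x, ‖deriv (Φ j) x‖ ≤ (δ j)⁻¹ := fun j x => by
    rw [hder, norm_div, Real.norm_eq_abs, abs_mul, abs_two, Real.norm_of_nonneg (by positivity),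
      div_le_iff₀ (by positivity), inv_mul_eq_div, le_div_iff₀ (hδ0 j)]
    have h1 : 2 * (δ j * |x|) ≤ 1 + (δ j * x) ^ 2 := by
      have : (δ j * x) ^ 2 = (δ j * |x|) ^ 2 := by rw [mul_pow, mul_pow, sq_abs]
      nlinarith [sq_nonneg (δ j * |x| - 1)]
    have h2 : 0 ≤ (δ j * x) ^ 2 := sq_nonneg _
    nlinarith
  have hu1 : Integrable u γ := hu.integrable one_le_two
  have hG1 : Integrable G γ := hG.integrable one_le_two
  have hu2 : Integrable (fun v => u v ^ 2) γ := hu.integrable_sq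
  have hb : Integrable (fun v => 2 * (|u v| * ‖G v‖)) γ :=
    (integrable_norm_smul_of_memLp hu hG).const_mul 2
  have hl : ∀ x, Tendsto (fun j => 1 + (δ j * x) ^ 2) atTop (𝓝 1) := fun x => by
    simpa using ((hδt.mul_const x).pow 2).const_add 1
  have hc : ∀ j, _ := fun j => h.comp hβ hu1 hG1 (hΦc j) _ (hle2 j)
  have hGi : Integrable (fun v => (2 * u v) • G v) γ := by
    refine hb.mono' ((hu1.1.const_mul 2).smul hG1.1) (Eventually.of_forall fun v => le_of_eq ?_)
    rw [norm_smul, norm_mul, Real.norm_eq_abs, Real.norm_eq_abs, abs_two, mul_assoc]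
  refine HasWeakGradient.of_tendsto hβ (fun j => (hc j).2.2) hu2 hGi (fun j => (hc j).1)
    (fun j => (hc j).2.1) ?_ ?_
  · refine tendsto_eLpNorm_one_of_dominated (fun v => u v ^ 2) (fun j => (hc j).1.1) hu2
      (fun j => Eventually.of_forall fun v => ?_) (Eventually.of_forall fun v => ?_)
    · rw [Real.norm_of_nonneg (by positivity)]
      refine div_le_self (sq_nonneg _) ?_
      have : 0 ≤ (δ j * u v) ^ 2 := sq_nonneg _
      linarith
    · have h1 := (tendsto_const_nhds (x := u v ^ 2)).div (hl (u v)) one_ne_zero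
      rwa [div_one] at h1
  · refine tendsto_eLpNorm_one_of_dominated (fun v => 2 * (|u v| * ‖G v‖)) (fun j => (hc j).2.1.1)
      hb (fun j => Eventually.of_forall fun v => ?_) (Eventually.of_forall fun v => ?_)
    · rw [norm_smul, ← mul_assoc]
      exact mul_le_mul_of_nonneg_right (hle1 j _) (norm_nonneg _)
    · refine Tendsto.smul_const ?_ _
      simp only [hder]
      have h1 := (tendsto_const_nhds (x := 2 * u v)).div ((hl (u v)).pow 2) (by norm_num)
      rwa [one_pow, div_one] at h1

theorem integrable_normSq_of_memLp {μ : Measure (Vel d n)} {G : Vel d n → Vel d n}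
    (hG : MemLp G 2 μ) : Integrable (fun v => normSq (G v)) μ := by
  refine (hG.norm.integrable_sq.const_mul (n : ℝ)).mono'
    (continuous_normSq.comp_aestronglyMeasurable hG.1) (Eventually.of_forall fun v => ?_)
  rw [Real.norm_of_nonneg (normSq_nonneg _)]
  exact normSq_le_sq_norm _

theorem memLp_of_integrable_normSq {μ : Measure (Vel d n)} {G : Vel d n → Vel d n}
    (hm : AEStronglyMeasurable G μ) (hG : Integrable (fun v => normSq (G v)) μ) : MemLp G 2 μ := by
  rw [memLp_two_iff_integrable_sq_norm hm]
  refine hG.mono' (hm.norm.pow 2) (Eventually.of_forall fun v => ?_)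
  rw [Real.norm_of_nonneg (by positivity)]
  exact sq_norm_le_normSq _

theorem ofReal_div_le {a b : ℝ} (hb : 0 ≤ b) :
    ENNReal.ofReal (a / b) ≤ ENNReal.ofReal a / ENNReal.ofReal b := by
  rcases hb.eq_or_lt with rfl | hb
  · simp
  · rw [ENNReal.ofReal_div_of_pos hb]

/-- The information density of a function with finite Fisher information. -/
theorem integrable_normSq_div_of_lintegral {μ : Measure (Vel d n)} {h : Vel d n → ℝ}
    {G : Vel d n → Vel d n} (h0 : ∀ v, 0 ≤ h v) (hh : AEStronglyMeasurable h μ)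
    (hG : AEStronglyMeasurable G μ)
    (hI : ∫⁻ v, ENNReal.ofReal (normSq (G v)) / ENNReal.ofReal (h v) ∂μ < ⊤) :
    Integrable (fun v => normSq (G v) / h v) μ ∧ ∀ᵐ v ∂μ, h v = 0 → G v = 0 := by
  have hm := continuous_normSq.comp_aestronglyMeasurable hG
  constructor
  · refine ⟨(hm.aemeasurable.div hh.aemeasurable).aestronglyMeasurable, ?_⟩
    rw [hasFiniteIntegral_iff_ofReal
      (Eventually.of_forall fun v => div_nonneg (normSq_nonneg _) (h0 v))]
    exact (lintegral_mono fun v => ofReal_div_le (h0 v)).trans_lt hI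
  · have := ae_lt_top' ((hm.aemeasurable.ennreal_ofReal.div hh.aemeasurable.ennreal_ofReal)) hI.ne
    filter_upwards [this] with v hv h1
    by_contra h2
    rw [Pi.div_apply, h1, ENNReal.ofReal_zero, ENNReal.div_zero] at hv
    · exact lt_irrefl _ hv
    · rw [Ne, ENNReal.ofReal_eq_zero, not_le]
      refine lt_of_lt_of_le ?_ (sq_norm_le_normSq (G v))
      have := norm_pos_iff.2 h2
      positivity

/-- Where `h > 0`, completing a square gives `|G| ≤ |G|² / h + h`; where `h = 0`, finite information
forces `G = 0`. Integrability of the gradient is what approximation by test functions needs. -/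
theorem integrable_of_fisher {μ : Measure (Vel d n)} {h : Vel d n → ℝ}
    {G : Vel d n → Vel d n} (h0 : ∀ v, 0 ≤ h v) (hh : Integrable h μ)
    (hG : AEStronglyMeasurable G μ)
    (hI : ∫⁻ v, ENNReal.ofReal (normSq (G v)) / ENNReal.ofReal (h v) ∂μ < ⊤) :
    Integrable G μ := by
  obtain ⟨h1, h2⟩ := integrable_normSq_div_of_lintegral h0 hh.1 hG hI
  refine (h1.add hh).mono' hG ?_
  filter_upwards [h2] with v hv
  simp only [Pi.add_apply]
  rcases (h0 v).eq_or_lt with h3 | h3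
  · rw [hv h3.symm, norm_zero]
    exact add_nonneg (div_nonneg (normSq_nonneg _) (h0 v)) (h0 v)
  · have h4 := sq_norm_le_normSq (G v)
    have h5 : ‖G v‖ ^ 2 / h v ≤ normSq (G v) / h v := by gcongr
    have h6 : ‖G v‖ ≤ ‖G v‖ ^ 2 / h v + h v := by
      rw [← sub_nonneg]
      have : ‖G v‖ ^ 2 / h v + h v - ‖G v‖ =
          ((‖G v‖ - h v / 2) ^ 2 + 3 / 4 * h v ^ 2) / h v := by field_simp; ring
      rw [this]; positivity
    linarith

/-- The square root of a function with finite Fisher information. -/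
theorem memH1_sqrt (hβ : 0 < β) {h : Vel d n → ℝ} {G : Vel d n → Vel d n}
    (h0 : ∀ v, 0 ≤ h v) (hh : Integrable h (gaussMeasure β d n)) (hw : HasWeakGradient h G)
    (hI : ∫⁻ v, ENNReal.ofReal (normSq (G v)) / ENNReal.ofReal (h v) ∂gaussMeasure β d n < ⊤) :
    MemH1 (fun v => Real.sqrt (h v)) (gaussMeasure β d n) := by
  have hpr := isProbabilityMeasure_gaussMeasure hβ d n
  have hGm : AEStronglyMeasurable G (gaussMeasure β d n) :=
    (aestronglyMeasurable_gaussMeasure_iff hβ).2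
      hw.locallyIntegrable_gradient.aestronglyMeasurable
  have hG := integrable_of_fisher h0 hh hGm hI
  obtain ⟨hJ, -⟩ := integrable_normSq_div_of_lintegral h0 hh.1 hGm hI
  have hsm : AEStronglyMeasurable (fun v => Real.sqrt (h v)) (gaussMeasure β d n) :=
    Real.continuous_sqrt.comp_aestronglyMeasurable hh.1
  have hs2 : MemLp (fun v => Real.sqrt (h v)) 2 (gaussMeasure β d n) := by
    rw [memLp_two_iff_integrable_sq hsm]
    simpa only [Real.sq_sqrt (h0 _)] using hh
  -- The factor of the formal gradient of the square root. Where `h = 0` it is zero by the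
  -- convention for division, which does no harm because only `|c G|² = |G|² / (4 h)`, with the same
  -- convention, has to be integrable.
  set c : Vel d n → ℝ := fun v => 1 / (2 * Real.sqrt (h v)) with hc
  have hcm : AEStronglyMeasurable c (gaussMeasure β d n) :=
    (aemeasurable_const.div (hsm.aemeasurable.const_mul 2)).aestronglyMeasurable
  have hS : MemLp (fun v => c v • G v) 2 (gaussMeasure β d n) := by
    refine memLp_of_integrable_normSq (hcm.smul hGm) ((hJ.const_mul (1 / 4)).congr
      (Eventually.of_forall fun v => ?_))
    simp only [normSq_smul, hc, div_pow, mul_pow, Real.sq_sqrt (h0 v)]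
    ring
  refine ⟨hs2, _, ?_, hS⟩
  set δ : ℕ → ℝ := fun j => 1 / ((j : ℝ) + 1) with hδ
  have hδ0 : ∀ j, 0 < δ j := fun j => by positivity
  have hδ1 : ∀ j, δ j ≤ 1 := one_div_add_one_le
  have hδt : Tendsto δ atTop (𝓝 0) := tendsto_one_div_add_atTop_nhds_zero_nat
  -- A smooth substitute for `|x|`, at least `δ` and at least `|x|`. Its square root `Φ` is
  -- continuously differentiable on the whole line with bounded derivative and tends to `√|x|`.
  set s : ℕ → ℝ → ℝ := fun j x => Real.sqrt (x ^ 2 + δ j ^ 2) with hs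
  have hp : ∀ j x, 0 < x ^ 2 + δ j ^ 2 := fun j x => by have := hδ0 j; positivity
  have hs0 : ∀ j x, 0 < s j x := fun j x => Real.sqrt_pos.2 (hp j x)
  have hsx : ∀ j x, |x| ≤ s j x := fun j x =>
    Real.abs_le_sqrt (by have := sq_nonneg (δ j); linarith)
  have hsδ : ∀ j x, δ j ≤ s j x := fun j x =>
    Real.le_sqrt_of_sq_le (by have := sq_nonneg x; linarith)
  have hsu : ∀ j x, s j x ≤ |x| + 1 := fun j x => by
    rw [hs, Real.sqrt_le_left (by positivity), ← sq_abs x]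
    nlinarith [hδ0 j, hδ1 j, abs_nonneg x]
  have hst : ∀ x, Tendsto (fun j => s j x) atTop (𝓝 |x|) := fun x => by
    rw [← Real.sqrt_sq_eq_abs]
    refine (Real.continuous_sqrt.tendsto _).comp ?_
    simpa using (hδt.pow 2).const_add (x ^ 2)
  set Φ : ℕ → ℝ → ℝ := fun j x => Real.sqrt (s j x) with hΦ
  have hΦc : ∀ j, ContDiff ℝ 1 (Φ j) := fun j =>
    (((contDiff_id.pow 2).add contDiff_const).sqrt fun x => (hp j x).ne').sqrt
      fun x => (hs0 j x).ne'
  have hder : ∀ j x, deriv (Φ j) x = x / s j x * (1 / (2 * Real.sqrt (s j x))) := fun j x => by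
    have h1 : HasDerivAt (fun y : ℝ => y ^ 2 + δ j ^ 2) (2 * x) x := by
      simpa using (hasDerivAt_pow 2 x).add_const (δ j ^ 2)
    rw [((h1.sqrt (hp j x).ne').sqrt (hs0 j x).ne').deriv]
    change 2 * x / (2 * s j x) / (2 * Real.sqrt (s j x)) = _
    rw [mul_div_mul_left _ _ two_ne_zero]
    ring
  -- Used twice: with `r = δ j` it bounds the derivative for the chain rule, and with `r = h v` it
  -- dominates the approximating gradients uniformly in `j`. At `x = 0` the derivative vanishes,
  -- which matches the convention for `c`.
  have hle : ∀ j x r, 0 ≤ r → r ≤ s j x → x = 0 ∨ 0 < r →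
      ‖deriv (Φ j) x‖ ≤ 1 / (2 * Real.sqrt r) := fun j x r hr0 hr hx => by
    rcases hx with rfl | hr0
    · rw [hder]; simp
    · rw [hder, norm_mul, norm_div, Real.norm_eq_abs, Real.norm_of_nonneg (hs0 j x).le,
        Real.norm_of_nonneg (by positivity)]
      have h1 : |x| / s j x ≤ 1 := div_le_one_of_le₀ (hsx j x) (hs0 j x).le
      have h2 : 1 / (2 * Real.sqrt (s j x)) ≤ 1 / (2 * Real.sqrt r) := by
        have := Real.sqrt_pos.2 hr0
        gcongr
      calc _ ≤ 1 * (1 / (2 * Real.sqrt r)) := by gcongr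
        _ = _ := one_mul _
  have hC : ∀ j, _ := fun j => hw.comp hβ hh hG (hΦc j) _
    fun x => hle j x (δ j) (hδ0 j).le (hsδ j x) (Or.inr (hδ0 j))
  have hbi : Integrable (fun v => ‖c v • G v‖) (gaussMeasure β d n) :=
    (hS.integrable one_le_two).norm
  refine HasWeakGradient.of_tendsto hβ (fun j => (hC j).2.2) (hs2.integrable one_le_two)
    (hS.integrable one_le_two) (fun j => (hC j).1) (fun j => (hC j).2.1) ?_ ?_
  · refine tendsto_eLpNorm_one_of_dominated (fun v => h v + 2) (fun j => (hC j).1.1)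
      (hh.add (integrable_const 2)) (fun j => Eventually.of_forall fun v => ?_)
      (Eventually.of_forall fun v => ?_)
    · rw [Real.norm_of_nonneg (Real.sqrt_nonneg _), Real.sqrt_le_left (by linarith [h0 v])]
      have := hsu j (h v)
      rw [abs_of_nonneg (h0 v)] at this
      nlinarith [h0 v]
    · have := (Real.continuous_sqrt.tendsto _).comp (hst (h v))
      rwa [abs_of_nonneg (h0 v)] at this
  · refine tendsto_eLpNorm_one_of_dominated (fun v => ‖c v • G v‖) (fun j => (hC j).2.1.1)
      hbi (fun j => Eventually.of_forall fun v => ?_) (Eventually.of_forall fun v => ?_)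
    · rw [norm_smul, norm_smul]
      refine mul_le_mul_of_nonneg_right ?_ (norm_nonneg _)
      have h1 := hle j (h v) (h v) (h0 v) ((le_abs_self _).trans (hsx j _))
        ((h0 v).eq_or_lt.imp_left Eq.symm)
      exact h1.trans (le_abs_self _)
    · refine Tendsto.smul_const ?_ _
      simp only [hder, hc]
      rcases (h0 v).eq_or_lt with h3 | h3
      · rw [← h3]; simp
      · have h4 := hst (h v)
        rw [abs_of_pos h3] at h4
        have h5 := (Real.continuous_sqrt.tendsto _).comp h4
        have h6 := ((tendsto_const_nhds (x := h v)).div h4 h3.ne').mul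
          ((tendsto_const_nhds (x := (1 : ℝ))).div (h5.const_mul 2)
            (by have := Real.sqrt_pos.2 h3; positivity))
        rwa [div_self h3.ne', one_mul] at h6

end sqrt

end KacModel

namespace KacModel

/-! ### Logarithmic Sobolev inequality in `H¹(γ)` and finiteness of the entropy. -/

section initial

variable {d n : ℕ} {β : ℝ}

theorem two_mul_dot_le (x y : Vel d n) : 2 * dot x y ≤ normSq x + normSq y := by
  have h := normSq_nonneg ((1 : ℝ) • x + (-1 : ℝ) • y)
  rw [normSq_add_smul] at h
  linarith

theorem normSq_add_le (x y : Vel d n) : normSq (x + y) ≤ 2 * normSq x + 2 * normSq y := by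
  have h := normSq_add_smul x y 1 1
  rw [one_smul, one_smul] at h
  linarith [two_mul_dot_le x y]

/-- Jensen's inequality for mollifications. -/
theorem normSq_moll_le (k : ℕ) {G : Vel d n → Vel d n} (hG : LocallyIntegrable G)
    (hG2 : LocallyIntegrable fun v => normSq (G v)) (x : Vel d n) :
    normSq (moll k G x) ≤ moll k (fun v => normSq (G v)) x := by
  set φ := (bump d n k).normed (volume : Measure (Vel d n)) with hφ
  set z := moll k G x with hz
  have i1 : Integrable fun t => φ t • G (x - t) := integrable_moll_integrand k hG x
  have i2 : Integrable fun t => φ t • normSq (G (x - t)) := integrable_moll_integrand k hG2 x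
  have i3 : Integrable φ := (bump d n k).integrable_normed
  have i4 : ∀ p : Fin n × Fin d, Integrable fun t => (φ t • G (x - t)) p.1 p.2 * z p.1 p.2 :=
    fun p => ((integrable_vel_iff.1 i1 p.1 p.2)).mul_const _
  have e1 : ∀ t, φ t * dot (G (x - t)) z = dot (φ t • G (x - t)) z := fun t =>
    (dot_smul_left _ _ _).symm
  have hint : ∫ t, φ t * dot (G (x - t)) z = normSq z := by
    simp only [e1]
    simp only [dot_eq_sum]
    rw [integral_finsetSum _ fun p _ => i4 p, normSq_eq_sum]
    refine Finset.sum_congr rfl fun p _ => ?_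
    rw [integral_mul_const, sq]
    congr 1
    exact ((PiLp.proj 2 (fun _ : Fin d => ℝ) p.2 : EuclideanSpace ℝ (Fin d) →L[ℝ] ℝ).comp
      (ContinuousLinearMap.proj (R := ℝ) (φ := fun _ : Fin n => EuclideanSpace ℝ (Fin d)) p.1)
      ).integral_comp_comm i1
  have i5 : Integrable fun t => φ t * dot (G (x - t)) z := by
    simp only [e1]
    simp only [dot_eq_sum]
    exact integrable_finsetSum _ fun p _ => i4 p
  -- With `z` the mollified value, the inequality `2 G · z ≤ |G|² + |z|²` is integrated against the
  -- probability density `φ`. Its left side becomes `2 |z|²`, and one `|z|²` cancels.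
  have h1 : ∫ t, φ t * (2 * dot (G (x - t)) z) ≤
      ∫ t, (φ t • normSq (G (x - t)) + φ t * normSq z) := by
    refine integral_mono ((i5.const_mul 2).congr (Eventually.of_forall fun t => by ring))
      (i2.add (i3.mul_const _)) fun t => ?_
    rw [smul_eq_mul, ← mul_add]
    exact mul_le_mul_of_nonneg_left (two_mul_dot_le _ _) ((bump d n k).nonneg_normed t)
  rw [integral_add i2 (i3.mul_const _), integral_mul_const, (bump d n k).integral_normed,
    one_mul] at h1
  have h2 : ∫ t, φ t * (2 * dot (G (x - t)) z) = 2 * normSq z := by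
    rw [← hint, ← integral_const_mul]
    congr 1; funext t; ring
  rw [h2] at h1
  rw [moll_apply]
  linarith

theorem sq_moll_le (k : ℕ) {g : Vel d n → ℝ} (hg : LocallyIntegrable g)
    (hg2 : LocallyIntegrable fun v => g v ^ 2) (x : Vel d n) :
    moll k g x ^ 2 ≤ moll k (fun v => g v ^ 2) x := by
  set φ := (bump d n k).normed (volume : Measure (Vel d n)) with hφ
  set z := moll k g x with hz
  have i1 : Integrable fun t => φ t • g (x - t) := integrable_moll_integrand k hg x
  have i2 : Integrable fun t => φ t • g (x - t) ^ 2 := integrable_moll_integrand k hg2 x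
  have i3 : Integrable φ := (bump d n k).integrable_normed
  have h1 : ∫ t, φ t • g (x - t) * (2 * z) ≤ ∫ t, (φ t • g (x - t) ^ 2 + φ t * z ^ 2) := by
    refine integral_mono (i1.mul_const _) (i2.add (i3.mul_const _)) fun t => ?_
    simp only [smul_eq_mul]
    have := mul_nonneg ((bump d n k).nonneg_normed (μ := volume) t) (sq_nonneg (g (x - t) - z))
    simp only [hφ]
    nlinarith
  rw [integral_add i2 (i3.mul_const _), integral_mul_const, integral_mul_const,
    (bump d n k).integral_normed, one_mul] at h1
  have h2 : ∫ t, φ t • g (x - t) = z := rfl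
  rw [h2] at h1
  rw [moll_apply]
  nlinarith

theorem mul_log_mono {x y : ℝ} (hx : 1 ≤ x) (hxy : x ≤ y) : x * Real.log x ≤ y * Real.log y :=
  mul_le_mul hxy (Real.log_le_log (by linarith) hxy) (Real.log_nonneg hx) (by linarith)

theorem grad_sq_add_one {w : Vel d n → ℝ} (hw : ContDiff ℝ 1 w) (v : Vel d n) :
    grad (fun v => w v ^ 2 + 1) v = (2 * w v) • grad w v := by
  have h1 := ((hw.differentiable one_ne_zero v).hasFDerivAt.pow 2).add_const (1 : ℝ)
  funext l
  ext a
  simp only [grad, riesz_apply, Pi.smul_apply, PiLp.smul_apply, smul_eq_mul]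
  rw [h1.fderiv]
  simp

/-- The logarithmic Sobolev inequality for test functions. -/
theorem entropy_sq_add_one_le (hβ : 0 < β) {w : Vel d n → ℝ} (hw : ContDiff ℝ 1 w)
    (hc : HasCompactSupport w) :
    Integrable (fun v => (w v ^ 2 + 1) * Real.log (w v ^ 2 + 1)) (gaussMeasure β d n) ∧
    ∫ v, (w v ^ 2 + 1) * Real.log (w v ^ 2 + 1) ∂gaussMeasure β d n ≤
      (∫ v, w v ^ 2 ∂gaussMeasure β d n + 1) * Real.log (∫ v, w v ^ 2 ∂gaussMeasure β d n + 1) +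
      Real.pi / 2 / β * (4 * ∫ v, normSq (grad w v) ∂gaussMeasure β d n) := by
  have hpr := isProbabilityMeasure_gaussMeasure hβ d n
  have h1 : IsBddC1 fun v => w v ^ 2 :=
    IsBddC1.of_hasCompactSupport (hw.pow 2) (hc.comp_left (g := fun x : ℝ => x ^ 2) (by simp))
  have hb : IsBddC1 fun v => w v ^ 2 + 1 := by
    refine ⟨(hw.pow 2).add contDiff_const, ?_, ?_⟩
    · obtain ⟨K, hK⟩ := h1.bdd
      refine ⟨K + 1, fun v => (norm_add_le _ _).trans ?_⟩
      rw [norm_one]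
      linarith [hK v]
    · simpa using h1.bdd_fderiv
  -- Adding one gives the lower bound that the smooth inequality requires. It costs nothing in the
  -- information, since `|2 w ∇w|² / (w² + 1) ≤ 4 |∇w|²`, and it moves the mean to where `x log x`
  -- is increasing.
  have hone : ∀ v, 1 ≤ w v ^ 2 + 1 := fun v => by nlinarith [sq_nonneg (w v)]
  have h2 := entropy_le_smoothFisher hβ hb one_pos hone
  obtain ⟨K, hK⟩ := hb.bdd
  have hI : ∫ v, (w v ^ 2 + 1) ∂gaussMeasure β d n = ∫ v, w v ^ 2 ∂gaussMeasure β d n + 1 := by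
    rw [integral_add (h1.integrable_gauss hβ) (integrable_const 1)]
    simp
  constructor
  · exact Integrable.of_bound (Real.continuous_mul_log.comp
      hb.contDiff.continuous).aestronglyMeasurable _
      (Eventually.of_forall fun v => abs_mul_log_le one_pos (hone v) ((le_abs_self _).trans (hK v)))
  · rw [hI] at h2
    refine h2.trans ?_
    gcongr
    rw [smoothFisher, ← integral_const_mul]
    have hgi : Integrable (fun v => normSq (grad w v)) (gaussMeasure β d n) := by
      have hcg : HasCompactSupport fun v => normSq (grad w v) :=
        (hasCompactSupport_grad hc).comp_left (g := (normSq : Vel d n → ℝ)) (by simp [normSq])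
      exact integrable_gaussMeasure_of_continuous hβ (continuous_normSq.comp (continuous_grad hw)) hcg
    refine integral_mono_of_nonneg (Eventually.of_forall fun v =>
      div_nonneg (normSq_nonneg _) (zero_le_one.trans (hone v))) (hgi.const_mul 4)
      (Eventually.of_forall fun v => ?_)
    simp only
    rw [grad_sq_add_one hw, normSq_smul, div_le_iff₀ (zero_lt_one.trans_le (hone v))]
    have := normSq_nonneg (grad w v)
    nlinarith [sq_nonneg (w v)]

theorem tendsto_integral_moll_gauss (hβ : 0 < β) {g : Vel d n → ℝ} (hg : Integrable g) :
    Tendsto (fun k => ∫ v, moll k g v ∂gaussMeasure β d n) atTop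
      (𝓝 (∫ v, g v ∂gaussMeasure β d n)) :=
  tendsto_integral_of_eLpNorm_one_le 1 (tendsto_eLpNorm_gaussMeasure hβ (tendsto_eLpNorm_moll hg))
    (fun k => integrable_gaussMeasure_of_volume hβ (integrable_moll k hg))
    (integrable_gaussMeasure_of_volume hβ hg)
    (fun k => Eventually.of_forall fun v => by rw [one_mul])

/-- The logarithmic Sobolev inequality for functions in `H¹(γ)` with compact support. -/
theorem HasWeakGradient.entropy_sq_add_one_le (hβ : 0 < β) {u : Vel d n → ℝ} {G : Vel d n → Vel d n}
    (h : HasWeakGradient u G) (hu : MemLp u 2 (gaussMeasure β d n))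
    (hG : MemLp G 2 (gaussMeasure β d n)) (hc : HasCompactSupport u) (hcG : HasCompactSupport G) :
    Integrable (fun v => (u v ^ 2 + 1) * Real.log (u v ^ 2 + 1)) (gaussMeasure β d n) ∧
    ∫ v, (u v ^ 2 + 1) * Real.log (u v ^ 2 + 1) ∂gaussMeasure β d n ≤
      (∫ v, u v ^ 2 ∂gaussMeasure β d n + 1) * Real.log (∫ v, u v ^ 2 ∂gaussMeasure β d n + 1) +
      Real.pi / 2 / β * (4 * ∫ v, normSq (G v) ∂gaussMeasure β d n) := by
  have hpr := isProbabilityMeasure_gaussMeasure hβ d n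
  have l1 : LocallyIntegrable fun v => u v ^ 2 :=
    locallyIntegrable_of_gaussMeasure hβ hu.integrable_sq
  have l2 : LocallyIntegrable fun v => normSq (G v) :=
    locallyIntegrable_of_gaussMeasure hβ (integrable_normSq_of_memLp hG)
  have i1 : Integrable fun v => u v ^ 2 := integrable_of_hasCompactSupport l1
    (hc.comp_left (g := fun x : ℝ => x ^ 2) (by simp))
  have i2 : Integrable fun v => normSq (G v) := integrable_of_hasCompactSupport l2
    (hcG.comp_left (g := (normSq : Vel d n → ℝ)) (by simp [normSq]))
  set w : ℕ → Vel d n → ℝ := fun k => moll k u with hw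
  have hwc : ∀ k, ContDiff ℝ 1 (w k) := fun k =>
    (contDiff_moll k h.locallyIntegrable).of_le (by norm_cast)
  have hwk : ∀ k, HasCompactSupport (w k) := fun k => hasCompactSupport_moll k hc
  have e := fun k => KacModel.entropy_sq_add_one_le hβ (hwc k) (hwk k)
  have t1 := tendsto_integral_moll_gauss hβ i1
  have t2 := tendsto_integral_moll_gauss hβ i2
  have t3 := (((Real.continuous_mul_log.tendsto _).comp (t1.add_const 1))).add
    ((t2.const_mul 4).const_mul (Real.pi / 2 / β))
  have hm1 : ∀ k, Integrable (moll k fun v => u v ^ 2) (gaussMeasure β d n) := fun k =>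
    integrable_gaussMeasure_of_volume hβ (integrable_moll k i1)
  have hm2 : ∀ k, Integrable (moll k fun v => normSq (G v)) (gaussMeasure β d n) := fun k =>
    integrable_gaussMeasure_of_volume hβ (integrable_moll k i2)
  -- Jensen's inequality bounds the mass and the gradient term of each mollification by integrals of
  -- mollified squares, and these converge by compact support.
  refine entropy_le_of_tendsto (u := fun k v => w k v ^ 2 + 1) (fun k => (e k).1)
    (fun k => Eventually.of_forall fun v => by positivity) ?_ ?_ (fun k => (e k).2.trans ?_) t3
  · exact (hu.integrable_sq.add (integrable_const 1)).1
  · rw [ae_gaussMeasure_iff hβ]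
    filter_upwards [ae_tendsto_moll h.locallyIntegrable] with v hv
    exact (hv.pow 2).add_const 1
  · have a1 : ∫ v, w k v ^ 2 ∂gaussMeasure β d n ≤
        ∫ v, moll k (fun v => u v ^ 2) v ∂gaussMeasure β d n :=
      integral_mono_of_nonneg (Eventually.of_forall fun v => sq_nonneg _) (hm1 k)
        (Eventually.of_forall fun v => sq_moll_le k h.locallyIntegrable l1 v)
    have a2 : ∫ v, normSq (grad (w k) v) ∂gaussMeasure β d n ≤
        ∫ v, moll k (fun v => normSq (G v)) v ∂gaussMeasure β d n := by
      refine integral_mono_of_nonneg (Eventually.of_forall fun v => normSq_nonneg _) (hm2 k)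
        (Eventually.of_forall fun v => ?_)
      simp only [hw]
      rw [h.grad_moll]
      exact normSq_moll_le k h.locallyIntegrable_gradient l2 v
    have a3 : 0 ≤ ∫ v, w k v ^ 2 ∂gaussMeasure β d n := integral_nonneg fun v => sq_nonneg _
    simp only [Function.comp_apply]
    refine add_le_add (mul_log_mono (by linarith) (by linarith)) ?_
    gcongr

/-- Undoes the shift by one: `x log x` lies in `[-1, 0]` on `[0, 1]` and is at most `(x + 1) log (x
+ 1)` beyond. -/
theorem integrable_mul_log_of_add_one {X : Type*} [MeasurableSpace X] {μ : Measure X}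
    [IsFiniteMeasure μ] {f : X → ℝ} (h0 : ∀ x, 0 ≤ f x) (hf : AEStronglyMeasurable f μ)
    (h : Integrable (fun x => (f x + 1) * Real.log (f x + 1)) μ) :
    Integrable (fun x => f x * Real.log (f x)) μ := by
  refine (h.add (integrable_const 1)).mono'
    (Real.continuous_mul_log.comp_aestronglyMeasurable hf) (Eventually.of_forall fun v => ?_)
  simp only [Pi.add_apply]
  have h0 := h0 v
  generalize f v = x at h0
  have h1 : 0 ≤ (x + 1) * Real.log (x + 1) :=
    mul_nonneg (by linarith) (Real.log_nonneg (by linarith))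
  rw [Real.norm_eq_abs, abs_le]
  refine ⟨by linarith [sub_one_le_mul_log h0], ?_⟩
  rcases le_total 1 x with hx | hx
  · linarith [mul_log_mono hx (by linarith : x ≤ x + 1)]
  · linarith [mul_nonpos_of_nonneg_of_nonpos h0 (Real.log_nonpos h0 hx)]

theorem hasCompactSupport_smul_add_smul {X E : Type*} [TopologicalSpace X]
    [NormedAddCommGroup E] [NormedSpace ℝ E] {φ : X → ℝ} {H : X → E} (hφ : HasCompactSupport φ)
    (hH : HasCompactSupport H) (G : X → E) (u : X → ℝ) :
    HasCompactSupport fun x => φ x • G x + u x • H x :=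
  (hφ.smul_right (f' := G)).add (hH.smul_left (f := u))

theorem aestronglyMeasurable_smul_add_smul {X E : Type*} [MeasurableSpace X] {μ : Measure X}
    [NormedAddCommGroup E] [NormedSpace ℝ E] {φ u : X → ℝ} {G H : X → E}
    (hφ : AEStronglyMeasurable φ μ) (hu : AEStronglyMeasurable u μ)
    (hG : AEStronglyMeasurable G μ) (hH : AEStronglyMeasurable H μ) :
    AEStronglyMeasurable (fun x => φ x • G x + u x • H x) μ :=
  (hφ.smul hG).add (hu.smul hH)

/-- Functions in `H¹(γ)` have finite entropy. -/
theorem HasWeakGradient.integrable_sq_mul_log (hβ : 0 < β) {u : Vel d n → ℝ}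
    {G : Vel d n → Vel d n}
    (h : HasWeakGradient u G) (hu : MemLp u 2 (gaussMeasure β d n))
    (hG : MemLp G 2 (gaussMeasure β d n)) :
    Integrable (fun v => u v ^ 2 * Real.log (u v ^ 2)) (gaussMeasure β d n) := by
  have hpr := isProbabilityMeasure_gaussMeasure hβ d n
  obtain ⟨C, hC0, hC⟩ := exists_norm_grad_cutoff_le d n
  have hχc : ∀ k, Continuous (cutoff k : Vel d n → ℝ) := fun k => (contDiff_cutoff k).continuous
  have hgc : ∀ k, Continuous (grad (cutoff k : Vel d n → ℝ)) := fun k =>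
    continuous_grad ((contDiff_cutoff k).of_le (by norm_cast))
  have hC' : ∀ (k : ℕ) (v : Vel d n), normSq (grad (cutoff k) v) ≤ n * C ^ 2 := fun k v => by
    refine (normSq_le_sq_norm _).trans ?_
    gcongr
    refine (hC k v).trans (mul_le_of_le_one_right hC0 ?_)
    exact inv_le_one_of_one_le₀ (by linarith [(Nat.cast_nonneg k : (0 : ℝ) ≤ k)])
  set g1 : ℕ → Vel d n → ℝ := fun k v => cutoff k v * u v with hg1
  set G1 : ℕ → Vel d n → Vel d n := fun k v => cutoff k v • G v + u v • grad (cutoff k) v with hG1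
  have hw : ∀ k, HasWeakGradient (g1 k) (G1 k) := fun k => h.smooth_mul (contDiff_cutoff k)
  have hsq : ∀ k v, g1 k v ^ 2 ≤ u v ^ 2 := fun k v => by
    rw [hg1, mul_pow]
    exact mul_le_of_le_one_left (sq_nonneg _)
      (pow_le_one₀ (cutoff_nonneg k v) (cutoff_le_one k v))
  have hb : Integrable (fun v => 2 * normSq (G v) + 2 * (n * C ^ 2) * u v ^ 2)
      (gaussMeasure β d n) :=
    ((integrable_normSq_of_memLp hG).const_mul 2).add (hu.integrable_sq.const_mul _)
  have hle : ∀ k v, normSq (G1 k v) ≤ 2 * normSq (G v) + 2 * (n * C ^ 2) * u v ^ 2 := fun k v => by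
    refine (normSq_add_le _ _).trans ?_
    rw [normSq_smul, normSq_smul]
    have h1 : cutoff k v ^ 2 * normSq (G v) ≤ normSq (G v) :=
      mul_le_of_le_one_left (normSq_nonneg _)
        (pow_le_one₀ (cutoff_nonneg k v) (cutoff_le_one k v))
    have h2 := mul_le_mul_of_nonneg_left (hC' k v) (sq_nonneg (u v))
    nlinarith
  have hm1 : ∀ k, AEStronglyMeasurable (g1 k) (gaussMeasure β d n) := fun k =>
    (hχc k).aestronglyMeasurable.mul hu.1
  have hm2 : ∀ k, AEStronglyMeasurable (G1 k) (gaussMeasure β d n) := fun k =>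
    aestronglyMeasurable_smul_add_smul (hχc k).aestronglyMeasurable hu.1 hG.1
      (hgc k).aestronglyMeasurable
  have hi1 : ∀ k, MemLp (g1 k) 2 (gaussMeasure β d n) := fun k => by
    rw [memLp_two_iff_integrable_sq (hm1 k)]
    refine hu.integrable_sq.mono' ((hm1 k).pow 2) (Eventually.of_forall fun v => ?_)
    rw [Real.norm_of_nonneg (sq_nonneg _)]
    exact hsq k v
  have hi2' : ∀ k, Integrable (fun v => normSq (G1 k v)) (gaussMeasure β d n) := fun k => by
    refine hb.mono' (continuous_normSq.comp_aestronglyMeasurable (hm2 k))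
      (Eventually.of_forall fun v => ?_)
    rw [Real.norm_of_nonneg (normSq_nonneg _)]
    exact hle k v
  have hi2 : ∀ k, MemLp (G1 k) 2 (gaussMeasure β d n) := fun k =>
    memLp_of_integrable_normSq (hm2 k) (hi2' k)
  have hc1 : ∀ k, HasCompactSupport (g1 k) := fun k => (hasCompactSupport_cutoff k).mul_right
  have hc2 : ∀ k, HasCompactSupport (G1 k) := fun k =>
    hasCompactSupport_smul_add_smul (hasCompactSupport_cutoff k)
      (hasCompactSupport_grad (hasCompactSupport_cutoff k)) G u
  have e := fun k => (hw k).entropy_sq_add_one_le hβ (hi1 k) (hi2 k) (hc1 k) (hc2 k)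
  -- Only a bound that is uniform in the cutoff is needed here, as finiteness is the sole aim; the
  -- gradients of the cutoffs need not be small.
  have hint : ∀ k, ∫ v, (g1 k v ^ 2 + 1) * Real.log (g1 k v ^ 2 + 1) ∂gaussMeasure β d n ≤
      (∫ v, u v ^ 2 ∂gaussMeasure β d n + 1) *
      Real.log (∫ v, u v ^ 2 ∂gaussMeasure β d n + 1) + Real.pi / 2 / β * (4 *
        ∫ v, (2 * normSq (G v) + 2 * (n * C ^ 2) * u v ^ 2) ∂gaussMeasure β d n) := fun k => by
    have a1 : ∫ v, g1 k v ^ 2 ∂gaussMeasure β d n ≤ ∫ v, u v ^ 2 ∂gaussMeasure β d n :=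
      integral_mono (hi1 k).integrable_sq hu.integrable_sq (hsq k)
    have a2 : ∫ v, normSq (G1 k v) ∂gaussMeasure β d n ≤
        ∫ v, (2 * normSq (G v) + 2 * (n * C ^ 2) * u v ^ 2) ∂gaussMeasure β d n :=
      integral_mono (hi2' k) hb (hle k)
    have a3 : 0 ≤ ∫ v, g1 k v ^ 2 ∂gaussMeasure β d n := integral_nonneg fun v => sq_nonneg _
    refine (e k).2.trans (add_le_add (mul_log_mono (by linarith) (by linarith)) ?_)
    exact mul_le_mul_of_nonneg_left (by linarith) (by positivity)
  have hlim : ∀ v, Tendsto (fun k => g1 k v ^ 2 + 1) atTop (𝓝 (u v ^ 2 + 1)) := fun v => by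
    have := ((tendsto_cutoff v).mul_const (u v)).pow 2
    rw [one_mul] at this
    exact this.add_const 1
  have hmeas : AEStronglyMeasurable (fun v => u v ^ 2 + 1) (gaussMeasure β d n) :=
    (hu.integrable_sq.add (integrable_const 1)).1
  have hi : ∀ k, Integrable (fun v => (g1 k v ^ 2 + 1) * Real.log (g1 k v ^ 2 + 1))
    (gaussMeasure β d n) := fun k => (e k).1
  clear_value g1 G1
  have hfin := entropy_le_of_tendsto (u := fun k v => g1 k v ^ 2 + 1) hi
    (fun k => Eventually.of_forall fun v => by positivity) hmeas (Eventually.of_forall hlim)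
    hint tendsto_const_nhds
  exact integrable_mul_log_of_add_one (fun v => sq_nonneg (u v)) hu.integrable_sq.1 hfin.1

end initial

end KacModel

namespace KacModel

/-! ### Finite information of the initial density relative to the Gaussian. -/

section initialdata

variable {d n : ℕ} {β : ℝ}

/-- The function `γ^{-1/2}`. -/
noncomputable def invSqrtMaxwell (β : ℝ) {d n : ℕ} (v : Vel d n) : ℝ := (Real.sqrt (maxwell β v))⁻¹

theorem contDiff_invSqrtMaxwell (hβ : 0 < β) :
    ContDiff ℝ ∞ (invSqrtMaxwell β : Vel d n → ℝ) :=
  (contDiff_maxwell.sqrt fun v => (maxwell_pos hβ v).ne').inv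
    fun v => (Real.sqrt_pos.2 (maxwell_pos hβ v)).ne'

theorem maxwell_mul_invSqrtMaxwell_sq (hβ : 0 < β) (v : Vel d n) :
    maxwell β v * invSqrtMaxwell β v ^ 2 = 1 := by
  rw [invSqrtMaxwell, inv_pow, Real.sq_sqrt (maxwell_pos hβ v).le,
    mul_inv_cancel₀ (maxwell_pos hβ v).ne']

/-- The logarithmic gradient of `γ^{-1/2}` is linear in `v`; this is why second moments of `f₀` are
needed. -/
theorem grad_invSqrtMaxwell (hβ : 0 < β) (v : Vel d n) :
    grad (invSqrtMaxwell β) v = (β / 2 * invSqrtMaxwell β v) • v := by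
  have hm := maxwell_pos hβ v
  have hs := Real.sqrt_pos.2 hm
  have h1 : HasFDerivAt (maxwell β) (fderiv ℝ (maxwell β) v) v :=
    (contDiff_maxwell.differentiable (by simp) v).hasFDerivAt
  have h2 : HasFDerivAt (invSqrtMaxwell β) _ v :=
    (hasDerivAt_inv hs.ne').comp_hasFDerivAt v (h1.sqrt hm.ne')
  funext k
  ext a
  simp only [grad, riesz_apply, Pi.smul_apply, PiLp.smul_apply, smul_eq_mul]
  rw [h2.fderiv]
  simp only [smul_apply, fderiv_maxwell, smul_eq_mul]
  rw [dot_comm, dot_basisVec, invSqrtMaxwell, Real.sq_sqrt hm.le]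
  simp only
  field_simp

/-- The total energy dominates that of the first `N` particles, and integrating out the others
contributes the factor one. -/
theorem integrable_normSq_mul_of_kineticEnergy (hβ : 0 < β) {N M : ℕ} {f₀ : Vel d N → ℝ}
    (hf₀ : IsDensity f₀) (hE : kineticEnergy (initialDensity β M f₀) < ⊤) :
    Integrable fun v => normSq v * f₀ v := by
  have hm : AEStronglyMeasurable f₀ volume := hf₀.integrable.1
  have hmm : AEStronglyMeasurable (fun v => normSq v * f₀ v) volume :=
    continuous_normSq.aestronglyMeasurable.mul hm
  refine ⟨hmm, ?_⟩
  rw [hasFiniteIntegral_iff_ofReal (by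
    filter_upwards [hf₀.nonneg] with v hv
    exact mul_nonneg (normSq_nonneg _) hv)]
  have hE' : ∫⁻ u : Vel d (N + M), ENNReal.ofReal (normSq u * initialDensity β M f₀ u) < ⊤ := by
    by_contra h
    rw [not_lt_top_iff] at h
    have h2 : kineticEnergy (initialDensity β M f₀) =
      2⁻¹ * ∫⁻ u : Vel d (N + M), ENNReal.ofReal (normSq u * initialDensity β M f₀ u) := rfl
    rw [h2, h, ENNReal.mul_top (by simp)] at hE
    exact lt_irrefl _ hE
  have hp := measurePreserving_split d N M
  have e1 := lintegral_prod_mul (μ := (volume : Measure (Vel d N)))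
    (ν := (volume : Measure (Vel d M))) (f := fun v => ENNReal.ofReal (normSq v * f₀ v))
    (g := fun w => ENNReal.ofReal (maxwell β w)) hmm.aemeasurable.ennreal_ofReal
    measurable_ofReal_maxwell.aemeasurable
  rw [lintegral_maxwell hβ, mul_one] at e1
  have hae : AEMeasurable (fun p : Vel d N × Vel d M =>
      ENNReal.ofReal (normSq p.1 * f₀ p.1) * ENNReal.ofReal (maxwell β p.2))
      (volume.prod volume) :=
    (hmm.aemeasurable.ennreal_ofReal.comp_quasiMeasurePreserving
      Measure.quasiMeasurePreserving_fst).mul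
      (measurable_ofReal_maxwell.comp measurable_snd).aemeasurable
  rw [← e1, ← hp.map_eq, lintegral_map' (by rw [hp.map_eq]; exact hae) hp.measurable.aemeasurable]
  refine lt_of_le_of_lt (lintegral_mono fun u => ?_) hE'
  simp only
  -- The density is nonnegative only almost everywhere. At a point where it is negative the
  -- truncation to `[0, ∞]` makes the left side zero, so the comparison holds everywhere.
  rcases lt_or_ge (f₀ fun k => u (Fin.castAdd M k)) 0 with h | h
  · rw [ENNReal.ofReal_of_nonpos (mul_nonpos_of_nonneg_of_nonpos (normSq_nonneg _) h.le), zero_mul]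
    exact zero_le
  · rw [← ENNReal.ofReal_mul (mul_nonneg (normSq_nonneg _) h)]
    refine ENNReal.ofReal_le_ofReal ?_
    have hw := maxwell_pos hβ fun k => u (Fin.natAdd N k)
    have hsum : normSq u = normSq (fun k => u (Fin.castAdd M k)) +
        normSq (fun k => u (Fin.natAdd N k)) := by simp [normSq, Fin.sum_univ_add]
    rw [initialDensity, hsum, mul_assoc]
    refine mul_le_mul_of_nonneg_right ?_ (mul_nonneg h hw.le)
    linarith [normSq_nonneg fun k => u (Fin.natAdd N k)]

/-- The square root of the initial density relative to the Gaussian is in `H¹(γ)`. -/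
theorem exists_weakGradient_initial (hβ : 0 < β) {f₀ : Vel d n → ℝ} (hf₀ : IsDensity f₀)
    (hH1 : MemH1 (fun v => Real.sqrt (f₀ v)) volume)
    (h2 : Integrable fun v => normSq v * f₀ v) :
    ∃ G : Vel d n → Vel d n,
      HasWeakGradient (fun v => invSqrtMaxwell β v * Real.sqrt (f₀ v)) G ∧
      MemLp (fun v => invSqrtMaxwell β v * Real.sqrt (f₀ v)) 2 (gaussMeasure β d n) ∧
      MemLp G 2 (gaussMeasure β d n) := by
  obtain ⟨hu, G, hw, hG⟩ := hH1
  have hcχ : Continuous (invSqrtMaxwell β : Vel d n → ℝ) := (contDiff_invSqrtMaxwell hβ).continuous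
  have hcg : Continuous (grad (invSqrtMaxwell β : Vel d n → ℝ)) :=
    continuous_grad ((contDiff_invSqrtMaxwell hβ).of_le (by norm_cast))
  refine ⟨_, hw.smooth_mul (contDiff_invSqrtMaxwell hβ), ?_, ?_⟩
  · have hm : AEStronglyMeasurable (fun v => invSqrtMaxwell β v * Real.sqrt (f₀ v))
        (gaussMeasure β d n) := (aestronglyMeasurable_gaussMeasure_iff hβ).2
      (hcχ.aestronglyMeasurable.mul hu.1)
    rw [memLp_two_iff_integrable_sq hm, integrable_gaussMeasure_iff hβ]
    refine hu.integrable_sq.congr (Eventually.of_forall fun v => ?_)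
    simp only [smul_eq_mul]
    rw [mul_pow, ← mul_assoc, maxwell_mul_invSqrtMaxwell_sq hβ, one_mul]
  · have hm := aestronglyMeasurable_smul_add_smul hcχ.aestronglyMeasurable hu.1 hG.1
      hcg.aestronglyMeasurable
    refine memLp_of_integrable_normSq ((aestronglyMeasurable_gaussMeasure_iff hβ).2 hm) ?_
    rw [integrable_gaussMeasure_iff hβ]
    -- The product rule gives `γ^{-1/2} (G + (β / 2) √f₀ v)`. With `|x + y|² ≤ 2 |x|² + 2 |y|²` the
    -- second coefficient is `2 (β / 2)²`.
    refine Integrable.mono' (((integrable_normSq_of_memLp hG).const_mul 2).add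
      (h2.const_mul (β ^ 2 / 2))) (continuous_maxwell.aestronglyMeasurable.smul
        (continuous_normSq.comp_aestronglyMeasurable hm)) ?_
    filter_upwards [hf₀.nonneg] with v hv
    rw [smul_eq_mul, Real.norm_of_nonneg (mul_nonneg (maxwell_pos hβ v).le (normSq_nonneg _))]
    refine (mul_le_mul_of_nonneg_left (normSq_add_le _ _) (maxwell_pos hβ v).le).trans
      (le_of_eq ?_)
    rw [grad_invSqrtMaxwell hβ, normSq_smul, normSq_smul, normSq_smul, mul_pow, Real.sq_sqrt hv,
      Pi.add_apply]
    linear_combination (2 * normSq (G v) + β ^ 2 / 2 * (normSq v * f₀ v)) *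
      maxwell_mul_invSqrtMaxwell_sq hβ v

theorem sq_invSqrtMaxwell_mul_sqrt (hβ : 0 < β) {f₀ : Vel d n → ℝ} {v : Vel d n}
    (hv : 0 ≤ f₀ v) : (invSqrtMaxwell β v * Real.sqrt (f₀ v)) ^ 2 = f₀ v / maxwell β v := by
  rw [mul_pow, Real.sq_sqrt hv, invSqrtMaxwell, inv_pow, Real.sq_sqrt (maxwell_pos hβ v).le]
  ring

/-- The information and the entropy of the square of a function in `H¹(γ)` are finite. -/
theorem fisherInfo_lt_top (hβ : 0 < β) {u h : Vel d n → ℝ} {G : Vel d n → Vel d n}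
    (hw : HasWeakGradient u G) (hu : MemLp u 2 (gaussMeasure β d n))
    (hG : MemLp G 2 (gaussMeasure β d n)) (hh : (fun v => u v ^ 2) =ᵐ[volume] h) :
    fisherInfo β h < ⊤ := by
  have h1 : HasWeakGradient h (fun v => (2 * u v) • G v) :=
    (hw.sq hβ hu hG).congr hh (ae_eq_refl _)
  refine lt_of_le_of_lt (iInf₂_le _ h1) ?_
  have h2 := (integrable_normSq_of_memLp hG).const_mul 4
  have h3 := h2.2
  rw [hasFiniteIntegral_iff_ofReal (Eventually.of_forall fun v =>
    mul_nonneg (by norm_num) (normSq_nonneg _))] at h3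
  refine lt_of_le_of_lt (lintegral_mono_ae ?_) h3
  rw [ae_gaussMeasure_iff hβ]
  filter_upwards [hh] with v hv
  have e : ∑ k, ‖((2 * u v) • G v) k‖ ^ 2 = 4 * normSq (G v) * u v ^ 2 := by
    change normSq ((2 * u v) • G v) = _
    rw [normSq_smul]; ring
  rw [e, ← hv]
  -- Where `u = 0` the gradient `2 u G` vanishes too, and `0 / 0 = 0`; elsewhere the quotient equals
  -- `4 |G|²`.
  rcases (sq_nonneg (u v)).eq_or_lt with h4 | h4
  · rw [← h4, mul_zero, ENNReal.ofReal_zero, ENNReal.zero_div]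
    exact zero_le
  · rw [← ENNReal.ofReal_div_of_pos h4, mul_div_cancel_right₀ _ h4.ne']

end initialdata

end KacModel

namespace KacModel

/-! ### Collisions as symmetric orthogonal maps. -/

section collisions

variable {d n : ℕ}

theorem angle_inner_self (σ : Angle d) : inner ℝ σ.1 σ.1 = (1 : ℝ) := by
  have := σ.2
  rw [mem_sphere_zero_iff_norm] at this
  rw [real_inner_self_eq_norm_sq, this]; norm_num

/-- The collision map as a continuous linear map. -/
noncomputable def collideCLM {d n : ℕ} (i j : Fin n) (σ : Angle d) : Vel d n →L[ℝ] Vel d n :=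
  LinearMap.toContinuousLinearMap
    { toFun := collide i j σ
      map_add' := by
        intro u v
        funext k
        simp only [collide, Pi.add_apply]
        split_ifs
        · rw [show u i + v i - (u j + v j) = (u i - u j) + (v i - v j) by abel, inner_add_right,
            add_smul]; abel
        · rw [show u i + v i - (u j + v j) = (u i - u j) + (v i - v j) by abel, inner_add_right,
            add_smul]; abel
        · rfl
      map_smul' := by
        intro c u
        funext k
        simp only [collide, Pi.smul_apply, RingHom.id_apply]
        split_ifs
        · rw [← smul_sub, inner_smul_right, smul_sub, smul_smul]
        · rw [← smul_sub, inner_smul_right, smul_add, smul_smul]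
        · rfl }

@[simp]
theorem collideCLM_apply (i j : Fin n) (σ : Angle d) (u : Vel d n) :
    collideCLM i j σ u = collide i j σ u := rfl

theorem continuous_collide_left (i j : Fin n) (u : Vel d n) :
    Continuous fun σ : Angle d => collide i j σ u := by
  refine continuous_pi fun k => ?_
  unfold collide
  split_ifs <;> fun_prop

theorem continuous_collideCLM (i j : Fin n) :
    Continuous (collideCLM i j : Angle d → Vel d n →L[ℝ] Vel d n) :=
  continuous_clm_apply.2 fun u => continuous_collide_left i j u

theorem sum_eq_pair {i j : Fin n} (hij : i ≠ j) (f : Fin n → ℝ) :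
    ∑ k, f k = f i + f j + ∑ k ∈ Finset.univ \ {i, j}, f k := by
  rw [← Finset.sum_sdiff (Finset.subset_univ ({i, j} : Finset (Fin n))), Finset.sum_pair hij]
  ring

theorem sum_collide {i j : Fin n} (hij : i ≠ j) (σ : Angle d) (u : Vel d n)
    (g : Fin n → EuclideanSpace ℝ (Fin d) → ℝ) :
    ∑ k, g k (collide i j σ u k) = g i (u i - inner ℝ σ.1 (u i - u j) • σ.1) +
      g j (u j + inner ℝ σ.1 (u i - u j) • σ.1) + ∑ k ∈ Finset.univ \ {i, j}, g k (u k) := by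
  rw [sum_eq_pair hij]
  have h1 : collide i j σ u i = u i - inner ℝ σ.1 (u i - u j) • σ.1 := by simp [collide]
  have h2 : collide i j σ u j = u j + inner ℝ σ.1 (u i - u j) • σ.1 := by
    simp [collide, hij.symm]
  rw [h1, h2]
  congr 1
  refine Finset.sum_congr rfl fun k hk => ?_
  simp only [Finset.mem_sdiff, Finset.mem_univ, true_and, Finset.mem_insert,
    Finset.mem_singleton, not_or] at hk
  simp [collide, hk.1, hk.2]

/-- A collision is the reflection in the hyperplane orthogonal to the unit vector with entries `σ /
√2` at `i` and `-σ / √2` at `j`; hence it is its own adjoint. -/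
theorem dot_collide {i j : Fin n} (hij : i ≠ j) (σ : Angle d) (u v : Vel d n) :
    dot (collide i j σ u) v = dot u (collide i j σ v) := by
  have h1 := sum_collide hij σ u fun k x => inner ℝ x (v k)
  have h2 := sum_collide hij σ v fun k x => inner ℝ (u k) x
  have e1 : dot (collide i j σ u) v = ∑ k, inner ℝ (collide i j σ u k) (v k) := by unfold dot; rfl
  have e2 : dot u (collide i j σ v) = ∑ k, inner ℝ (u k) (collide i j σ v k) := by unfold dot; rfl
  rw [e1, e2, h1, h2]
  simp only [inner_sub_left, inner_add_left, inner_sub_right, inner_add_right, inner_smul_left,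
    inner_smul_right, conj_trivial, real_inner_comm σ.1]
  ring

/-- The kinetic energy of the particles after a collision, with weights. -/
theorem sum_mul_normSq_collide {i j : Fin n} (hij : i ≠ j) (σ : Angle d) (u : Vel d n)
    (κ : Fin n → ℝ) : ∑ k, κ k * ‖collide i j σ u k‖ ^ 2 = ∑ k, κ k * ‖u k‖ ^ 2 +
      (κ i - κ j) * (inner ℝ σ.1 (u j) ^ 2 - inner ℝ σ.1 (u i) ^ 2) := by
  rw [sum_collide hij σ u fun k x => κ k * ‖x‖ ^ 2, sum_eq_pair hij]
  simp only [← real_inner_self_eq_norm_sq, inner_sub_left, inner_add_left, inner_sub_right,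
    inner_add_right, inner_smul_left, inner_smul_right, conj_trivial, real_inner_comm σ.1,
    angle_inner_self]
  ring

theorem normSq_collide {i j : Fin n} (hij : i ≠ j) (σ : Angle d) (u : Vel d n) :
    normSq (collide i j σ u) = normSq u := by
  have := sum_mul_normSq_collide hij σ u fun _ => 1
  simpa [normSq] using this

theorem ext_dot {x y : Vel d n} (h : ∀ z, dot x z = dot y z) : x = y := by
  funext k
  ext a
  have := h (basisVec (k, a))
  rwa [dot_basisVec, dot_basisVec] at this

theorem adj_comp {l m : ℕ} (L : Vel d n →L[ℝ] Vel d m) (K : Vel d l →L[ℝ] Vel d n)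
    (y : Vel d m) : adj (L.comp K) y = adj K (adj L y) :=
  ext_dot fun z => by simp only [dot_adj]; rfl

theorem adj_collideCLM {i j : Fin n} (hij : i ≠ j) (σ : Angle d) (y : Vel d n) :
    adj (collideCLM i j σ) y = collide i j σ y :=
  ext_dot fun z => by rw [dot_adj, collideCLM_apply, dot_collide hij]

/-! ### Orthogonal maps -/

/-- Orthogonal linear maps of `ℝ^{dn}`. -/
def IsOrth {d n : ℕ} (O : Vel d n →L[ℝ] Vel d n) : Prop :=
  ∀ u, normSq (O u) = normSq u ∧ normSq (adj O u) = normSq u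

theorem measurableSet_isOrth : MeasurableSet {O : Vel d n →L[ℝ] Vel d n | IsOrth O} := by
  refine IsClosed.measurableSet ?_
  unfold IsOrth
  simp only [ofPred_forall]
  refine isClosed_iInter fun u => ?_
  have h1 : Continuous fun O : Vel d n →L[ℝ] Vel d n => normSq (O u) :=
    continuous_normSq.comp (ContinuousLinearMap.apply ℝ _ u).continuous
  have h2 : Continuous fun O : Vel d n →L[ℝ] Vel d n => normSq (adj O u) :=
    continuous_normSq.comp
      (continuous_adj.comp (continuous_id.prodMk (continuous_const (y := u))))
  exact (isClosed_eq h1 continuous_const).inter (isClosed_eq h2 continuous_const)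

theorem isOrth_id : IsOrth (ContinuousLinearMap.id ℝ (Vel d n)) := fun u => by
  have : adj (ContinuousLinearMap.id ℝ (Vel d n)) u = u := ext_dot fun z => by
    rw [dot_adj]; rfl
  rw [this]
  exact ⟨rfl, rfl⟩

theorem IsOrth.comp_collide {O : Vel d n →L[ℝ] Vel d n} (hO : IsOrth O) {i j : Fin n}
    (hij : i ≠ j) (σ : Angle d) : IsOrth (O.comp (collideCLM i j σ)) := fun u => by
  rw [adj_comp, adj_collideCLM hij, normSq_collide hij, (hO u).2]
  refine ⟨?_, rfl⟩
  change normSq (O (collide i j σ u)) = _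
  rw [(hO _).1, normSq_collide hij]

theorem eq_zero_of_normSq {x : Vel d n} (h : normSq x = 0) : x = 0 := by
  have := sq_norm_le_normSq x
  rw [h] at this
  exact norm_eq_zero.1 (pow_eq_zero_iff two_ne_zero |>.1 (le_antisymm this (sq_nonneg _)))

theorem IsOrth.norm_le {O : Vel d n →L[ℝ] Vel d n} (hO : IsOrth O) : ‖O‖ ≤ n + 1 := by
  refine O.opNorm_le_bound (by positivity) fun u => ?_
  refine abs_le_of_sq_le_sq' ?_ (by positivity) |>.2
  calc ‖O u‖ ^ 2 ≤ normSq (O u) := sq_norm_le_normSq _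
    _ = normSq u := (hO u).1
    _ ≤ n * ‖u‖ ^ 2 := normSq_le_sq_norm u
    _ ≤ _ := by
      rw [mul_pow]
      refine mul_le_mul_of_nonneg_right ?_ (sq_nonneg _)
      nlinarith [(Nat.cast_nonneg n : (0 : ℝ) ≤ n)]

/-- A linear map scales volume by a constant. The Euclidean unit ball, of positive finite volume, is
its own preimage, so the constant is one. -/
theorem IsOrth.measurePreserving {O : Vel d n →L[ℝ] Vel d n} (hO : IsOrth O) :
    MeasurePreserving O (volume : Measure (Vel d n)) volume := by
  have hinj : Function.Injective O := (injective_iff_map_eq_zero O).2 fun u hu =>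
    eq_zero_of_normSq (by rw [← (hO u).1, hu]; simp [normSq])
  have hdet : LinearMap.det (O : Vel d n →ₗ[ℝ] Vel d n) ≠ 0 := by
    have := LinearEquiv.isUnit_det' (LinearEquiv.ofInjectiveEndo (O : Vel d n →ₗ[ℝ] Vel d n) hinj)
    exact this.ne_zero
  have hmap := Measure.map_linearMap_addHaar_eq_smul_addHaar (volume : Measure (Vel d n)) hdet
  set a : ℝ≥0∞ := ENNReal.ofReal |(LinearMap.det (O : Vel d n →ₗ[ℝ] Vel d n))⁻¹| with ha
  refine ⟨O.continuous.measurable, hmap.trans ?_⟩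
  set s : Set (Vel d n) := {u | normSq u < 1} with hs
  have hso : IsOpen s := isOpen_lt continuous_normSq continuous_const
  have hpre : O ⁻¹' s = s := by
    ext u
    simp only [hs, mem_preimage, mem_ofPred_eq, (hO u).1]
  have h0 : volume s ≠ 0 := (hso.measure_pos volume ⟨0, by simp [hs, normSq]⟩).ne'
  have ht : volume s ≠ ⊤ := by
    refine ((measure_mono fun u (hu : normSq u < 1) => ?_).trans_lt
      (measure_ball_lt_top (x := (0 : Vel d n)) (r := 2))).ne
    rw [Metric.mem_ball, dist_zero_right]
    have := sq_norm_le_normSq u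
    nlinarith [norm_nonneg u]
  have h1 := congrArg (fun ν : Measure (Vel d n) => ν s) hmap
  simp only [Measure.smul_apply, smul_eq_mul] at h1
  rw [Measure.map_apply (by exact O.continuous.measurable) hso.measurableSet] at h1
  change volume (O ⁻¹' s) = _ at h1
  rw [hpre] at h1
  have h2 : a = 1 := by
    have : a * volume s = 1 * volume s := by rw [one_mul, ← h1]
    exact (ENNReal.mul_left_inj h0 ht).1 this
  rw [h2, one_smul]

theorem maxwell_eq_of_normSq {β : ℝ} {u v : Vel d n} (h : normSq u = normSq v) :
    maxwell β u = maxwell β v := by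
  rw [maxwell_eq, maxwell_eq, h]

theorem IsOrth.measurePreserving_gauss (β : ℝ) {O : Vel d n →L[ℝ] Vel d n} (hO : IsOrth O) :
    MeasurePreserving O (gaussMeasure β d n) (gaussMeasure β d n) := by
  have h := MeasurePreserving.withDensity_comp hO.measurePreserving
    (measurable_ofReal_maxwell (β := β))
  have e : (fun v : Vel d n => ENNReal.ofReal (maxwell β v)) ∘ O =
      fun v => ENNReal.ofReal (maxwell β v) := by
    funext v
    simp only [Function.comp]
    rw [maxwell_eq_of_normSq (hO v).1]
  rw [e] at h
  exact h

/-! ### Averages over the collisions -/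

theorem integrable_coord_mul (ρ : Measure (Angle d)) [IsProbabilityMeasure ρ] (a b : Fin d) :
    Integrable (fun σ : Angle d => σ.1 a * σ.1 b) ρ := by
  refine Integrable.of_bound (by fun_prop) 1 (Eventually.of_forall fun σ => ?_)
  have h1 : ∀ a, ‖σ.1 a‖ ≤ 1 := fun a => by
    refine (PiLp.norm_apply_le σ.1 a).trans (le_of_eq ?_)
    exact mem_sphere_zero_iff_norm.1 σ.2
  rw [norm_mul]
  exact mul_le_one₀ (h1 a) (norm_nonneg _) (h1 b)

theorem sq_inner_eq (σ : Angle d) (x : EuclideanSpace ℝ (Fin d)) :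
    inner ℝ σ.1 x ^ 2 = ∑ a, ∑ b, x a * x b * (σ.1 a * σ.1 b) := by
  rw [PiLp.inner_apply, sq, Finset.sum_mul_sum]
  refine Finset.sum_congr rfl fun a _ => Finset.sum_congr rfl fun b _ => ?_
  simp
  ring

theorem integrable_sq_inner (ρ : Measure (Angle d)) [IsProbabilityMeasure ρ]
    (x : EuclideanSpace ℝ (Fin d)) : Integrable (fun σ : Angle d => inner ℝ σ.1 x ^ 2) ρ := by
  simp only [sq_inner_eq]
  exact integrable_finsetSum _ fun a _ => integrable_finsetSum _ fun b _ =>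
    (integrable_coord_mul ρ a b).const_mul _

/-- Isotropy of `ρ` enters the argument here: the mean energy carried by the scattering direction is
the fraction `1 / d` of the energy of a particle. -/
theorem integral_sq_inner {ρ : Measure (Angle d)} [IsProbabilityMeasure ρ]
    (hρ : SymmetryCondition ρ) (x : EuclideanSpace ℝ (Fin d)) :
    ∫ σ : Angle d, inner ℝ σ.1 x ^ 2 ∂ρ = ‖x‖ ^ 2 / d := by
  simp only [sq_inner_eq]
  rw [integral_finsetSum _ fun a _ => integrable_finsetSum _ fun b _ =>
    (integrable_coord_mul ρ a b).const_mul _]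
  simp_rw [integral_finsetSum Finset.univ fun b _ =>
    (integrable_coord_mul ρ _ b).const_mul (x _ * x b)]
  simp only [integral_const_mul, hρ _ _, mul_ite, mul_zero, Finset.sum_ite_eq, Finset.mem_univ,
    if_true]
  rw [EuclideanSpace.norm_sq_eq, Finset.sum_div]
  refine Finset.sum_congr rfl fun a _ => ?_
  rw [Real.norm_eq_abs, sq_abs]
  ring

theorem integral_sum_mul_normSq_collide {ρ : Measure (Angle d)} [IsProbabilityMeasure ρ]
    (hρ : SymmetryCondition ρ) {i j : Fin n} (hij : i ≠ j) (u : Vel d n) (κ : Fin n → ℝ) :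
    ∫ σ, ∑ k, κ k * ‖collide i j σ u k‖ ^ 2 ∂ρ = ∑ k, κ k * ‖u k‖ ^ 2 +
      (κ i - κ j) * (‖u j‖ ^ 2 - ‖u i‖ ^ 2) / d := by
  simp only [sum_mul_normSq_collide hij]
  have hs : Integrable (fun σ : Angle d => inner ℝ σ.1 (u j) ^ 2 - inner ℝ σ.1 (u i) ^ 2) ρ :=
    (integrable_sq_inner ρ _).sub (integrable_sq_inner ρ _)
  rw [integral_add (integrable_const _) (hs.const_mul _), integral_const_mul,
    integral_sub (integrable_sq_inner ρ _) (integrable_sq_inner ρ _), integral_sq_inner hρ,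
    integral_sq_inner hρ]
  simp only [integral_const, probReal_univ, one_smul]
  ring

theorem two_mul_sum_Ioi (g : Fin n → Fin n → ℝ) (hs : ∀ i j, g i j = g j i)
    (h0 : ∀ i, g i i = 0) :
    2 * ∑ i, ∑ j ∈ Finset.Ioi i, g i j = ∑ i, ∑ j, g i j := by
  have h := Finset.sum_sum_Ioi_add_eq_sum_sum_off_diag g
  have h1 : ∑ i, ∑ j ∈ Finset.Ioi i, (g j i + g i j) = 2 * ∑ i, ∑ j ∈ Finset.Ioi i, g i j := by
    simp only [Finset.mul_sum]
    refine Finset.sum_congr rfl fun i _ => Finset.sum_congr rfl fun j _ => ?_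
    rw [hs j i]; ring
  rw [← h1, h]
  refine Finset.sum_congr rfl fun i _ => ?_
  rw [← Finset.sum_compl_add_sum {i}, Finset.sum_singleton, h0, add_zero]
  exact Finset.sum_congr rfl fun j _ => hs j i

theorem sum_Ioi_one (n : ℕ) : ∑ i : Fin n, ∑ _j ∈ Finset.Ioi i, (1 : ℝ) = n * (n - 1) / 2 := by
  have h := two_mul_sum_Ioi (n := n) (fun i j => if i = j then 0 else 1)
    (fun i j => by simp only [eq_comm]) (fun i => by simp)
  have h1 : ∑ i : Fin n, ∑ j ∈ Finset.Ioi i, (if i = j then (0 : ℝ) else 1) =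
      ∑ i : Fin n, ∑ _j ∈ Finset.Ioi i, (1 : ℝ) :=
    Finset.sum_congr rfl fun i _ => Finset.sum_congr rfl fun j hj => by
      rw [if_neg (Finset.mem_Ioi.1 hj).ne]
  have h2 : ∑ i : Fin n, ∑ j : Fin n, (if i = j then (0 : ℝ) else 1) = n * (n - 1) := by
    have : ∀ i j : Fin n, (if i = j then (0 : ℝ) else 1) = 1 - if i = j then 1 else 0 :=
      fun i j => by split_ifs <;> norm_num
    simp only [this, Finset.sum_sub_distrib, Finset.sum_ite_eq, Finset.mem_univ, if_true]
    simp
    ring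
  rw [h1, h2] at h
  linarith

/-- Over ordered pairs the mixed sums factor through `∑ κ = 0`, while each of the two diagonal sums
gives `-n ∑ κ q`. Unordered pairs carry half of this. -/
theorem sum_Ioi_mul_sub {κ q : Fin n → ℝ} (hκ : ∑ k, κ k = 0) :
    ∑ i, ∑ j ∈ Finset.Ioi i, (κ i - κ j) * (q j - q i) = -n * ∑ k, κ k * q k := by
  have h := two_mul_sum_Ioi (fun i j => (κ i - κ j) * (q j - q i)) (fun i j => by ring)
    (fun i => by ring)
  have h2 : ∑ i, ∑ j, (κ i - κ j) * (q j - q i) = -2 * n * ∑ k, κ k * q k := by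
    have e : ∀ i j, (κ i - κ j) * (q j - q i) =
        κ i * q j - κ i * q i - κ j * q j + κ j * q i := fun i j => by ring
    have e1 : ∑ i, ∑ j, κ i * q j = 0 := by rw [← Finset.sum_mul_sum, hκ, zero_mul]
    have e2 : ∑ i, ∑ j, κ j * q i = 0 := by rw [Finset.sum_comm, e1]
    have e3 : ∑ i, ∑ _j : Fin n, κ i * q i = n * ∑ k, κ k * q k := by simp [Finset.mul_sum]
    have e4 : ∑ _i : Fin n, ∑ j, κ j * q j = n * ∑ k, κ k * q k := by simp
    simp only [e, Finset.sum_add_distrib, Finset.sum_sub_distrib]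
    rw [e1, e2, e3, e4]
    ring
  rw [h2] at h
  linarith

end collisions

end KacModel

namespace KacModel

/-! ### Random products of collisions. -/

section representation

variable {d n : ℕ}

/-- Each `O` preserves `ν`, so the point `O u` has law `ν` and stays independent of `O`. This
independence later allows the moments of `O` to be computed at a fixed vector. -/
theorem measurePreserving_skew {ν : Measure (Vel d n)} [SFinite ν]
    {μ : Measure (Vel d n →L[ℝ] Vel d n)} [SFinite μ]
    (h : ∀ᵐ O : Vel d n →L[ℝ] Vel d n ∂μ, MeasurePreserving O ν ν) :
    MeasurePreserving (fun p : (Vel d n →L[ℝ] Vel d n) × Vel d n => (p.1, p.1 p.2))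
      (μ.prod ν) (μ.prod ν) :=
  (MeasurePreserving.id μ).skew_product
    (g := fun (O : Vel d n →L[ℝ] Vel d n) (u : Vel d n) => O u)
    (continuous_fst.clm_apply continuous_snd).measurable
    (by filter_upwards [h] with O hO using hO.map_eq)

/-- The average of a function over a random linear map. -/
noncomputable def linAvg {d n : ℕ} (μ : Measure (Vel d n →L[ℝ] Vel d n)) (F : Vel d n → ℝ)
    (u : Vel d n) : ℝ := ∫ O, F (O u) ∂μ

section

variable {μ : Measure (Vel d n →L[ℝ] Vel d n)} [IsFiniteMeasure μ]

theorem integrable_linAvg_prod (h : ∀ᵐ O ∂μ, IsOrth O) {F : Vel d n → ℝ} (hF : Integrable F) :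
    Integrable (fun p : (Vel d n →L[ℝ] Vel d n) × Vel d n => F (p.1 p.2)) (μ.prod volume) :=
  (measurePreserving_skew (ν := volume)
    (by filter_upwards [h] with O hO using hO.measurePreserving)).integrable_comp_of_integrable
    (hF.comp_snd μ)

theorem ae_integrable_linAvg (h : ∀ᵐ O ∂μ, IsOrth O) {F : Vel d n → ℝ} (hF : Integrable F) :
    ∀ᵐ u, Integrable (fun O : Vel d n →L[ℝ] Vel d n => F (O u)) μ :=
  (integrable_linAvg_prod h hF).prod_left_ae

theorem linAvg_congr (h : ∀ᵐ O ∂μ, IsOrth O) {F G : Vel d n → ℝ} (hFG : F =ᵐ[volume] G) :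
    linAvg μ F =ᵐ[volume] linAvg μ G := by
  have hp := measurePreserving_skew (ν := (volume : Measure (Vel d n)))
    (μ := μ) (by filter_upwards [h] with O hO using hO.measurePreserving)
  have h2 : ∀ᵐ p ∂(μ.prod (volume : Measure (Vel d n))), F p.2 = G p.2 :=
    Measure.quasiMeasurePreserving_snd.ae hFG
  have h3 := Measure.ae_ae_of_ae_prod
    ((Measure.measurePreserving_swap (μ := volume) (ν := μ)).quasiMeasurePreserving.ae
      (hp.quasiMeasurePreserving.ae h2))
  filter_upwards [h3] with u hu
  exact integral_congr_ae hu

end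

/-- The law of a random linear map after a further collision of the particles `i` and `j`. -/
noncomputable def collisionStep {d n : ℕ} (ρ : Measure (Angle d)) (i j : Fin n)
    (μ : Measure (Vel d n →L[ℝ] Vel d n)) : Measure (Vel d n →L[ℝ] Vel d n) :=
  (μ.prod ρ).map fun p => p.1.comp (collideCLM i j p.2)

/-- The law of the product of `m` collisions of random pairs. -/
noncomputable def collisionMeasure {d n : ℕ} (ρ : Measure (Angle d)) :
    ℕ → Measure (Vel d n →L[ℝ] Vel d n)
  | 0 => Measure.dirac (ContinuousLinearMap.id ℝ (Vel d n))
  | m + 1 => ENNReal.ofReal (2 / ((n : ℝ) * (n - 1))) •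
      ∑ i : Fin n, ∑ j ∈ Finset.Ioi i, collisionStep ρ i j (collisionMeasure ρ m)

theorem measurable_comp_collide (i j : Fin n) :
    Measurable fun p : (Vel d n →L[ℝ] Vel d n) × Angle d => p.1.comp (collideCLM i j p.2) :=
  (continuous_fst.clm_comp ((continuous_collideCLM i j).comp continuous_snd)).measurable

section

variable (ρ : Measure (Angle d)) [IsProbabilityMeasure ρ]

theorem isProbabilityMeasure_collisionStep (i j : Fin n) (μ : Measure (Vel d n →L[ℝ] Vel d n))
    [IsProbabilityMeasure μ] : IsProbabilityMeasure (collisionStep ρ i j μ) :=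
  Measure.isProbabilityMeasure_map (measurable_comp_collide i j).aemeasurable

theorem ae_isOrth_collisionStep {i j : Fin n} (hij : i ≠ j)
    {μ : Measure (Vel d n →L[ℝ] Vel d n)} (h : ∀ᵐ O ∂μ, IsOrth O) :
    ∀ᵐ O ∂collisionStep ρ i j μ, IsOrth O := by
  rw [collisionStep, ae_map_iff (measurable_comp_collide i j).aemeasurable measurableSet_isOrth]
  have := Measure.quasiMeasurePreserving_fst (μ := μ) (ν := ρ).ae h
  filter_upwards [this] with p hp
  exact hp.comp_collide hij p.2

theorem pairWeight_nonneg {n : ℕ} (hn : 2 ≤ n) : 0 ≤ 2 / ((n : ℝ) * (n - 1)) := by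
  have : (2 : ℝ) ≤ n := by exact_mod_cast hn
  have : (0 : ℝ) ≤ n - 1 := by linarith
  positivity

theorem pairWeight_mul {n : ℕ} (hn : 2 ≤ n) :
    2 / ((n : ℝ) * (n - 1)) * (n * (n - 1) / 2) = 1 := by
  have h1 : (2 : ℝ) ≤ n := by exact_mod_cast hn
  have h2 : (n : ℝ) - 1 ≠ 0 := by linarith
  field_simp

theorem isProbabilityMeasure_collisionMeasure (hn : 2 ≤ n) (m : ℕ) :
    IsProbabilityMeasure (collisionMeasure ρ m : Measure (Vel d n →L[ℝ] Vel d n)) := by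
  induction m with
  | zero => exact Measure.dirac.isProbabilityMeasure
  | succ m ih =>
    refine ⟨?_⟩
    have h1 : ∀ i j : Fin n, collisionStep ρ i j (collisionMeasure ρ m) univ = 1 := fun i j =>
      (isProbabilityMeasure_collisionStep ρ i j _).measure_univ
    simp only [collisionMeasure, Measure.smul_apply, Measure.finsetSum_apply, h1, smul_eq_mul]
    have h2 : ∑ i : Fin n, ∑ _j ∈ Finset.Ioi i, (1 : ℝ≥0∞) =
        ENNReal.ofReal (n * (n - 1) / 2) := by
      rw [← sum_Ioi_one, ENNReal.ofReal_sum_of_nonneg fun i _ => Finset.sum_nonneg fun _ _ =>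
        zero_le_one]
      refine Finset.sum_congr rfl fun i _ => ?_
      rw [ENNReal.ofReal_sum_of_nonneg fun _ _ => zero_le_one, ENNReal.ofReal_one]
    rw [h2, ← ENNReal.ofReal_mul (pairWeight_nonneg hn), pairWeight_mul hn, ENNReal.ofReal_one]

theorem ae_isOrth_collisionMeasure (m : ℕ) :
    ∀ᵐ O ∂(collisionMeasure ρ m : Measure (Vel d n →L[ℝ] Vel d n)), IsOrth O := by
  induction m with
  | zero =>
    rw [collisionMeasure, ae_dirac_iff measurableSet_isOrth]
    exact isOrth_id
  | succ m ih =>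
    rw [collisionMeasure]
    refine Measure.ae_smul_measure ?_ _
    simp only [ae_finsetSum_measure_iff]
    intro i _ j hj
    exact ae_isOrth_collisionStep ρ (Finset.mem_Ioi.1 hj).ne ih

theorem integral_collisionMeasure_succ (hn : 2 ≤ n) (m : ℕ) {f : (Vel d n →L[ℝ] Vel d n) → ℝ}
    (hf : ∀ i j : Fin n, i < j →
      Integrable f (collisionStep ρ i j (collisionMeasure ρ m))) :
    ∫ O, f O ∂collisionMeasure ρ (m + 1) = 2 / ((n : ℝ) * (n - 1)) *
      ∑ i : Fin n, ∑ j ∈ Finset.Ioi i, ∫ O, f O ∂collisionStep ρ i j (collisionMeasure ρ m) := by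
  rw [collisionMeasure, integral_smul_measure, ENNReal.toReal_ofReal (pairWeight_nonneg hn),
    smul_eq_mul]
  congr 1
  rw [integral_finsetSum_measure]
  · refine Finset.sum_congr rfl fun i _ => ?_
    rw [integral_finsetSum_measure]
    exact fun j hj => hf i j (Finset.mem_Ioi.1 hj)
  · intro i _
    rw [integrable_finsetSum_measure]
    exact fun j hj => hf i j (Finset.mem_Ioi.1 hj)

theorem integral_collisionStep (i j : Fin n) {μ : Measure (Vel d n →L[ℝ] Vel d n)} [SFinite μ]
    {f : (Vel d n →L[ℝ] Vel d n) → ℝ} (hfm : StronglyMeasurable f)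
    (hf : Integrable f (collisionStep ρ i j μ)) :
    ∫ O, f O ∂collisionStep ρ i j μ = ∫ O, ∫ σ, f (O.comp (collideCLM i j σ)) ∂ρ ∂μ ∧
    ∫ O, f O ∂collisionStep ρ i j μ = ∫ σ, ∫ O, f (O.comp (collideCLM i j σ)) ∂μ ∂ρ := by
  have h1 := (integrable_map_measure hfm.aestronglyMeasurable
    (measurable_comp_collide i j).aemeasurable).1 hf
  rw [collisionStep, integral_map (measurable_comp_collide i j).aemeasurable
    hfm.aestronglyMeasurable]
  exact ⟨integral_prod _ h1, integral_prod_symm _ h1⟩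

/-! ### Second moments -/

theorem weighted_le (κ : Fin n → ℝ) (z : Vel d n) :
    |∑ k, κ k * ‖z k‖ ^ 2| ≤ (∑ k, |κ k|) * normSq z := by
  refine (Finset.abs_sum_le_sum_abs _ _).trans ?_
  rw [Finset.sum_mul]
  refine Finset.sum_le_sum fun k _ => ?_
  rw [abs_mul, abs_of_nonneg (by positivity : 0 ≤ ‖z k‖ ^ 2)]
  refine mul_le_mul_of_nonneg_left ?_ (abs_nonneg _)
  exact Finset.single_le_sum (f := fun k => ‖z k‖ ^ 2) (fun _ _ => by positivity)
    (Finset.mem_univ k)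

theorem continuous_weighted_adj (κ : Fin n → ℝ) (x : Vel d n) :
    Continuous fun O : Vel d n →L[ℝ] Vel d n => ∑ k, κ k * ‖adj O x k‖ ^ 2 := by
  have h : Continuous fun O : Vel d n →L[ℝ] Vel d n => adj O x :=
    continuous_adj.comp (continuous_id.prodMk (continuous_const (y := x)))
  exact continuous_finsetSum _ fun k _ => continuous_const.mul
    (((continuous_apply k).comp h).norm.pow 2)

theorem integrable_weighted_adj {μ : Measure (Vel d n →L[ℝ] Vel d n)} [IsFiniteMeasure μ]
    (h : ∀ᵐ O ∂μ, IsOrth O) (κ : Fin n → ℝ) (x : Vel d n) :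
    Integrable (fun O : Vel d n →L[ℝ] Vel d n => ∑ k, κ k * ‖adj O x k‖ ^ 2) μ := by
  refine Integrable.of_bound (continuous_weighted_adj κ x).aestronglyMeasurable
    ((∑ k, |κ k|) * normSq x) ?_
  filter_upwards [h] with O hO
  rw [Real.norm_eq_abs, ← (hO x).2]
  exact weighted_le κ _

variable {ρ}

/-- The adjoint of `O ∘ C` is `C` after the adjoint of `O`, so the newest collision acts last on
`adj O x`. Averaged over `σ` and over all pairs it changes a weighted energy with `∑ κ = 0` by `-2 /
(n (n - 1)) · n / d` times itself; such energies are eigenvectors with eigenvalue `1 - 2 / (d (n -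
1))`. -/
theorem integral_weighted_collisionMeasure (hd : 1 ≤ d) (hn : 2 ≤ n) (hρ : SymmetryCondition ρ)
    {κ : Fin n → ℝ} (hκ : ∑ k, κ k = 0) (x : Vel d n) (m : ℕ) :
    ∫ O, ∑ k, κ k * ‖adj O x k‖ ^ 2 ∂collisionMeasure ρ m =
      (1 - 2 / (d * ((n : ℝ) - 1))) ^ m * ∑ k, κ k * ‖x k‖ ^ 2 := by
  have hn1 : ((n : ℝ) - 1) ≠ 0 := by
    have : (2 : ℝ) ≤ n := by exact_mod_cast hn
    linarith
  have hn0 : (n : ℝ) ≠ 0 := by positivity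
  have hd0 : (d : ℝ) ≠ 0 := by positivity
  induction m with
  | zero =>
    rw [collisionMeasure, integral_dirac, pow_zero, one_mul]
    have : adj (ContinuousLinearMap.id ℝ (Vel d n)) x = x := ext_dot fun z => by
      rw [dot_adj]; rfl
    rw [this]
  | succ m ih =>
    have hpm := isProbabilityMeasure_collisionMeasure ρ hn m
    have hom := ae_isOrth_collisionMeasure (n := n) ρ m
    have hstep : ∀ i j : Fin n, i < j → Integrable
        (fun O : Vel d n →L[ℝ] Vel d n => ∑ k, κ k * ‖adj O x k‖ ^ 2)
        (collisionStep ρ i j (collisionMeasure ρ m)) := fun i j hij => by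
      have := isProbabilityMeasure_collisionStep ρ i j (collisionMeasure ρ m)
      exact integrable_weighted_adj (ae_isOrth_collisionStep ρ hij.ne hom) κ x
    rw [integral_collisionMeasure_succ ρ hn m hstep]
    have e1 : ∀ i : Fin n, ∀ j ∈ Finset.Ioi i,
        ∫ O, ∑ k, κ k * ‖adj O x k‖ ^ 2 ∂collisionStep ρ i j (collisionMeasure ρ m) =
        ∫ O, (∑ k, κ k * ‖adj O x k‖ ^ 2 +
          (κ i - κ j) * (‖adj O x j‖ ^ 2 - ‖adj O x i‖ ^ 2) / d) ∂collisionMeasure ρ m :=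
      fun i j hj => by
      have hij := Finset.mem_Ioi.1 hj
      rw [(integral_collisionStep ρ i j (continuous_weighted_adj κ x).stronglyMeasurable
        (hstep i j hij)).1]
      refine integral_congr_ae (Eventually.of_forall fun O => ?_)
      simp only [adj_comp, adj_collideCLM hij.ne]
      exact integral_sum_mul_normSq_collide hρ hij.ne _ κ
    rw [Finset.sum_congr rfl fun i _ => Finset.sum_congr rfl (e1 i)]
    have hsq : ∀ k : Fin n, Integrable
        (fun O : Vel d n →L[ℝ] Vel d n => ‖adj O x k‖ ^ 2) (collisionMeasure ρ m) := fun k => by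
      refine (integrable_weighted_adj hom (fun l => if l = k then 1 else 0) x).congr
        (Eventually.of_forall fun O => ?_)
      simp
    have hi : ∀ i j : Fin n, Integrable (fun O : Vel d n →L[ℝ] Vel d n =>
        ∑ k, κ k * ‖adj O x k‖ ^ 2 +
          (κ i - κ j) * (‖adj O x j‖ ^ 2 - ‖adj O x i‖ ^ 2) / d) (collisionMeasure ρ m) :=
      fun i j => (integrable_weighted_adj hom κ x).add
        ((((hsq j).sub (hsq i)).const_mul _).div_const _)
    -- The number of pairs `n (n - 1) / 2` comes from the unchanged energy, and `-n / d` from the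
    -- exchange terms.
    have e2 : ∑ i : Fin n, ∑ j ∈ Finset.Ioi i, ∫ O, (∑ k, κ k * ‖adj O x k‖ ^ 2 +
          (κ i - κ j) * (‖adj O x j‖ ^ 2 - ‖adj O x i‖ ^ 2) / d) ∂collisionMeasure ρ m =
        ∫ O, (n * (n - 1) / 2 - n / d) * ∑ k, κ k * ‖adj O x k‖ ^ 2 ∂collisionMeasure ρ m := by
      simp_rw [← integral_finsetSum (Finset.Ioi _) fun j _ => hi _ j]
      rw [← integral_finsetSum _ fun i _ => integrable_finsetSum _ fun j _ => hi i j]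
      refine integral_congr_ae (Eventually.of_forall fun O => ?_)
      simp only [Finset.sum_add_distrib, ← Finset.sum_div]
      rw [sum_Ioi_mul_sub (q := fun k => ‖adj O x k‖ ^ 2) hκ]
      have : ∀ S : ℝ, ∑ i : Fin n, ∑ _j ∈ Finset.Ioi i, S = n * (n - 1) / 2 * S := fun S => by
        rw [← sum_Ioi_one]
        simp only [Finset.sum_mul, one_mul]
      rw [this]
      ring
    rw [e2, integral_const_mul, ih]
    rw [pow_succ]
    field_simp

end

end representation

end KacModel

namespace KacModel

/-! ### The evolution as a Poisson mixture of random collisions. -/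

section semigroup

variable {d n : ℕ} (ρ : Measure (Angle d)) [IsProbabilityMeasure ρ]

/-- The operator evaluates its argument at the collided point, so the new collision is composed on
the right of `O`, as in `collisionStep`. -/
theorem collisionAverage_linAvg {i j : Fin n} (hij : i ≠ j)
    {μ : Measure (Vel d n →L[ℝ] Vel d n)} [IsProbabilityMeasure μ] (h : ∀ᵐ O ∂μ, IsOrth O)
    {F : Vel d n → ℝ} (hFm : StronglyMeasurable F) (hF : Integrable F) :
    collisionAverage ρ i j (linAvg μ F) =ᵐ[volume] linAvg (collisionStep ρ i j μ) F := by
  have := isProbabilityMeasure_collisionStep ρ i j μ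
  filter_upwards [ae_integrable_linAvg (ae_isOrth_collisionStep ρ hij h) hF] with u hu
  have hm : StronglyMeasurable fun O : Vel d n →L[ℝ] Vel d n => F (O u) :=
    hFm.comp_measurable (ContinuousLinearMap.apply ℝ _ u).continuous.measurable
  exact ((integral_collisionStep ρ i j hm hu).2).symm

/-- The average of the collision operators over all pairs. -/
noncomputable def meanCollisionOp {d : ℕ} (ρ : Measure (Angle d)) [IsProbabilityMeasure ρ] (n : ℕ) :
    State d n →L[ℝ] State d n :=
  (2 / ((n : ℝ) * (n - 1))) • ∑ i : Fin n, ∑ j ∈ Finset.Ioi i, collisionOp ρ i j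

theorem meanCollisionOp_coeFn (F : State d n) :
    meanCollisionOp ρ n F =ᵐ[volume] fun u => 2 / ((n : ℝ) * (n - 1)) *
      ∑ i : Fin n, ∑ j ∈ Finset.Ioi i, collisionAverage ρ i j F u := by
  have h1 : meanCollisionOp ρ n F = (2 / ((n : ℝ) * (n - 1))) •
      ∑ i : Fin n, ∑ j ∈ Finset.Ioi i, collisionOp ρ i j F := by
    simp [meanCollisionOp, sum_apply]
  have h2 : ∀ i : Fin n, ∀ᵐ u : Vel d n, (∑ j ∈ Finset.Ioi i, collisionOp ρ i j F : State d n) u =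
      ∑ j ∈ Finset.Ioi i, collisionAverage ρ i j F u := fun i => by
    have h3 : ∀ j : Fin n, ∀ᵐ u : Vel d n, collisionOp ρ i j F u = collisionAverage ρ i j F u :=
      fun j => collisionOp_coeFn ρ i j F
    filter_upwards [Lp.coeFn_fun_finsetSum (Finset.Ioi i) fun j => collisionOp ρ i j F,
      ae_all_iff.2 h3] with u hu1 hu2
    rw [hu1]
    exact Finset.sum_congr rfl fun j _ => hu2 j
  rw [h1]
  filter_upwards [Lp.coeFn_smul (2 / ((n : ℝ) * (n - 1)))
    (∑ i : Fin n, ∑ j ∈ Finset.Ioi i, collisionOp ρ i j F : State d n),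
    Lp.coeFn_fun_finsetSum Finset.univ fun i => (∑ j ∈ Finset.Ioi i, collisionOp ρ i j F : State d n),
    ae_all_iff.2 h2] with u hu1 hu2 hu3
  rw [hu1, Pi.smul_apply, hu2, smul_eq_mul]
  congr 1
  exact Finset.sum_congr rfl fun i _ => hu3 i

theorem pow_meanCollisionOp_coeFn (hn : 2 ≤ n) (F : State d n) (m : ℕ) :
    (meanCollisionOp ρ n ^ m) F =ᵐ[volume] linAvg (collisionMeasure ρ m) F := by
  induction m with
  | zero =>
    refine Eventually.of_forall fun u => ?_
    rw [linAvg, collisionMeasure, integral_dirac, pow_zero]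
    rfl
  | succ m ih =>
    have hpm := isProbabilityMeasure_collisionMeasure (d := d) ρ hn m
    have hom := ae_isOrth_collisionMeasure (n := n) ρ m
    have hF : Integrable F := L1.integrable_coeFn F
    have hFm : StronglyMeasurable F := Lp.stronglyMeasurable F
    have e1 : (meanCollisionOp ρ n ^ (m + 1)) F =
        meanCollisionOp ρ n ((meanCollisionOp ρ n ^ m) F) := by rw [pow_succ']; rfl
    have h2 : ∀ i j : Fin n, ∀ᵐ u : Vel d n, i < j →
        collisionAverage ρ i j ((meanCollisionOp ρ n ^ m) F) u =
          linAvg (collisionStep ρ i j (collisionMeasure ρ m)) F u ∧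
        Integrable (fun O : Vel d n →L[ℝ] Vel d n => F (O u))
          (collisionStep ρ i j (collisionMeasure ρ m)) := fun i j => by
      by_cases hij : i < j
      · have := isProbabilityMeasure_collisionStep ρ i j (collisionMeasure (n := n) ρ m)
        filter_upwards [collisionAverage_congr ρ i j ih,
          collisionAverage_linAvg ρ hij.ne hom hFm hF,
          ae_integrable_linAvg (ae_isOrth_collisionStep ρ hij.ne hom) hF] with u h1 h2 h3 _
        exact ⟨h1.trans h2, h3⟩
      · exact Eventually.of_forall fun u h => absurd h hij
    rw [e1]
    filter_upwards [meanCollisionOp_coeFn ρ ((meanCollisionOp ρ n ^ m) F),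
      ae_all_iff.2 fun i => ae_all_iff.2 (h2 i)] with u hu1 hu2
    rw [hu1, linAvg, integral_collisionMeasure_succ ρ hn m fun i j hij => (hu2 i j hij).2]
    congr 1
    exact Finset.sum_congr rfl fun i _ => Finset.sum_congr rfl fun j hj =>
      (hu2 i j (Finset.mem_Ioi.1 hj)).1

theorem norm_pow_meanCollisionOp_le (hn : 2 ≤ n) (F : State d n) (m : ℕ) :
    ‖(meanCollisionOp ρ n ^ m) F‖ ≤ ‖F‖ := by
  have h1 : ∀ i j : Fin n, ‖collisionOp ρ i j‖ ≤ 1 := fun i j =>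
    LinearMap.mkContinuous_norm_le _ zero_le_one _
  have h2 : ‖meanCollisionOp ρ n‖ ≤ 1 := by
    rw [meanCollisionOp, norm_smul, Real.norm_of_nonneg (pairWeight_nonneg hn)]
    refine le_trans ?_ (pairWeight_mul hn).le
    refine mul_le_mul_of_nonneg_left ?_ (pairWeight_nonneg hn)
    rw [← sum_Ioi_one]
    refine (norm_sum_le _ _).trans (Finset.sum_le_sum fun i _ => ?_)
    exact (norm_sum_le _ _).trans (Finset.sum_le_sum fun j _ => h1 i j)
  induction m with
  | zero => rw [pow_zero]; rfl
  | succ m ih =>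
    have e1 : (meanCollisionOp ρ n ^ (m + 1)) F =
        meanCollisionOp ρ n ((meanCollisionOp ρ n ^ m) F) := by rw [pow_succ']; rfl
    rw [e1]
    calc _ ≤ ‖meanCollisionOp ρ n‖ * ‖(meanCollisionOp ρ n ^ m) F‖ :=
          ContinuousLinearMap.le_opNorm _ _
      _ ≤ 1 * ‖F‖ := by gcongr
      _ = _ := one_mul _

/-- The prefactor `2 / (n - 1)` is `n` times the weight of a uniformly chosen pair: collisions occur
at total rate `n`. -/
theorem classicGenerator_eq (hn : 2 ≤ n) :
    classicGenerator ρ n = (n : ℝ) • (meanCollisionOp ρ n - 1) := by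
  have h1 : (2 : ℝ) ≤ n := by exact_mod_cast hn
  have h2 : (n : ℝ) - 1 ≠ 0 := by linarith
  have h3 : (n : ℝ) ≠ 0 := by linarith
  have h4 : ∑ i : Fin n, ∑ _j ∈ Finset.Ioi i, (1 : State d n →L[ℝ] State d n) =
      (n * (n - 1) / 2 : ℝ) • (1 : State d n →L[ℝ] State d n) := by
    rw [← sum_Ioi_one]
    simp only [Finset.sum_smul, one_smul]
  rw [classicGenerator, meanCollisionOp]
  simp only [Finset.sum_sub_distrib]
  rw [h4, smul_sub, smul_sub, smul_smul, smul_smul]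
  congr 2
  · field_simp
  · rw [show 2 / ((n : ℝ) - 1) * (n * (n - 1) / 2) = n by field_simp]

/-- The weights of the Poisson distribution. -/
noncomputable def poissonWeight (a : ℝ) (m : ℕ) : ℝ := Real.exp (-a) * (a ^ m / m.factorial)

theorem poissonWeight_nonneg {a : ℝ} (ha : 0 ≤ a) (m : ℕ) : 0 ≤ poissonWeight a m := by
  unfold poissonWeight; positivity

/-- The generating function of the Poisson law. At the eigenvalue `r` of one collision step it
produces the exponential decay in time. -/
theorem hasSum_poissonWeight_mul_pow (a r : ℝ) :
    HasSum (fun m => poissonWeight a m * r ^ m) (Real.exp (-(a * (1 - r)))) := by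
  have h := (NormedSpace.expSeries_div_hasSum_exp (a * r)).mul_left (Real.exp (-a))
  rw [← Real.exp_eq_exp_ℝ, ← Real.exp_add] at h
  have e : -a + a * r = -(a * (1 - r)) := by ring
  rw [e] at h
  refine h.congr_fun fun m => ?_
  rw [poissonWeight, mul_pow]
  ring

theorem hasSum_poissonWeight (a : ℝ) : HasSum (poissonWeight a) 1 := by
  simpa using hasSum_poissonWeight_mul_pow a 1

/-- The scalar `-a` commutes with `a Q`, so the exponential factorises. -/
theorem hasSum_exp_smul_sub_one {A : Type*} [NormedRing A] [NormedAlgebra ℝ A] [CompleteSpace A]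
    (a : ℝ) (Q : A) :
    HasSum (fun m => poissonWeight a m • Q ^ m) (NormedSpace.exp (a • (Q - 1))) := by
  let : NormedAlgebra ℚ A := NormedAlgebra.restrictScalars ℚ ℝ A
  have e1 : a • (Q - 1) = algebraMap ℝ A (-a) + a • Q := by
    rw [Algebra.algebraMap_eq_smul_one, smul_sub, neg_smul]; abel
  have h1 : NormedSpace.exp (a • (Q - 1)) = Real.exp (-a) • NormedSpace.exp (a • Q) := by
    rw [e1, NormedSpace.exp_add_of_commute (Algebra.commutes (-a) (a • Q)),
      ← NormedSpace.algebraMap_exp_comm, ← Real.exp_eq_exp_ℝ, ← Algebra.smul_def]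
  rw [h1]
  have h2 := (NormedSpace.exp_series_hasSum_exp' (𝕂 := ℝ) (a • Q)).const_smul (Real.exp (-a))
  refine h2.congr_fun fun m => ?_
  rw [smul_pow, smul_smul, smul_smul, poissonWeight]
  congr 1
  ring

/-- The law of the product of a Poisson number of collisions. -/
noncomputable def poissonCollisionMeasure {d n : ℕ} (ρ : Measure (Angle d)) (a : ℝ) :
    Measure (Vel d n →L[ℝ] Vel d n) :=
  Measure.sum fun m => ENNReal.ofReal (poissonWeight a m) • collisionMeasure ρ m

theorem isProbabilityMeasure_poissonCollisionMeasure (hn : 2 ≤ n) {a : ℝ} (ha : 0 ≤ a) :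
    IsProbabilityMeasure (poissonCollisionMeasure ρ a : Measure (Vel d n →L[ℝ] Vel d n)) := by
  refine ⟨?_⟩
  have h1 : ∀ m, collisionMeasure (n := n) ρ m univ = 1 := fun m =>
    (isProbabilityMeasure_collisionMeasure ρ hn m).measure_univ
  rw [poissonCollisionMeasure, Measure.sum_apply _ MeasurableSet.univ]
  simp only [Measure.smul_apply, h1, smul_eq_mul, mul_one]
  rw [← ENNReal.ofReal_tsum_of_nonneg (poissonWeight_nonneg ha) (hasSum_poissonWeight a).summable,
    (hasSum_poissonWeight a).tsum_eq, ENNReal.ofReal_one]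

theorem ae_isOrth_poissonCollisionMeasure (a : ℝ) :
    ∀ᵐ O ∂(poissonCollisionMeasure ρ a : Measure (Vel d n →L[ℝ] Vel d n)), IsOrth O := by
  rw [poissonCollisionMeasure, Measure.ae_sum_iff]
  exact fun m => Measure.ae_smul_measure (ae_isOrth_collisionMeasure ρ m) _

/-- The classic Kac evolution is an average over random orthogonal maps. -/
theorem exp_classicGenerator_coeFn (hn : 2 ≤ n) {t : ℝ} (ht : 0 ≤ t) (F : State d n) :
    NormedSpace.exp (t • classicGenerator ρ n) F =ᵐ[volume]
      linAvg (poissonCollisionMeasure ρ (n * t)) F := by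
  have ha : 0 ≤ (n : ℝ) * t := by positivity
  set a : ℝ := n * t with hadef
  set Q := meanCollisionOp (d := d) ρ n with hQ
  have h1 : NormedSpace.exp (t • classicGenerator ρ n) F =
      ∑' m, poissonWeight a m • (Q ^ m) F := by
    have h2 := hasSum_exp_smul_sub_one a Q
    have e : t • classicGenerator ρ n = a • (Q - 1) := by
      rw [classicGenerator_eq ρ hn, smul_smul, mul_comm]
    rw [e]
    exact ((h2.mapL (ContinuousLinearMap.apply ℝ (State d n) F)).tsum_eq).symm
  have hp := poissonWeight_nonneg ha
  have hle : ∀ m, ‖poissonWeight a m • (Q ^ m) F‖ ≤ poissonWeight a m * ‖F‖ := fun m => by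
    rw [norm_smul, Real.norm_of_nonneg (hp m)]
    exact mul_le_mul_of_nonneg_left (norm_pow_meanCollisionOp_le ρ hn F m) (hp m)
  have hsum : Summable fun m => ‖poissonWeight a m • (Q ^ m) F‖ :=
    Summable.of_nonneg_of_le (fun _ => norm_nonneg _) hle
      ((hasSum_poissonWeight a).summable.mul_right _)
  -- Each `Q ^ m` is a contraction, so the series converges absolutely in `L¹` and therefore also
  -- pointwise almost everywhere. This identifies the exponential of operators with the pointwise
  -- average.
  have h3 := Lp.hasSum_coeFn_tsum (f := fun m => poissonWeight a m • (Q ^ m) F) (by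
    simp only [← ofReal_norm]
    rw [← ENNReal.ofReal_tsum_of_nonneg (fun _ => norm_nonneg _) hsum]
    exact ENNReal.ofReal_ne_top)
  have h4 : ∀ m, ∀ᵐ u : Vel d n, (poissonWeight a m • (Q ^ m) F : State d n) u =
      poissonWeight a m * linAvg (collisionMeasure ρ m) F u := fun m => by
    filter_upwards [Lp.coeFn_smul (poissonWeight a m) ((Q ^ m) F),
      pow_meanCollisionOp_coeFn ρ hn F m] with u h5 h6
    rw [h5, Pi.smul_apply, h6, smul_eq_mul]
  have hpr := isProbabilityMeasure_poissonCollisionMeasure (d := d) ρ hn ha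
  have h5 := ae_integrable_linAvg (ae_isOrth_poissonCollisionMeasure (n := n) ρ a)
    (L1.integrable_coeFn F)
  rw [h1]
  filter_upwards [h3, ae_all_iff.2 h4, h5] with u hu1 hu2 hu3
  have h6 := hasSum_integral_measure hu3
  simp only [hu2] at hu1
  refine hu1.unique ?_
  refine h6.congr_fun fun m => ?_
  rw [integral_smul_measure, ENNReal.toReal_ofReal (hp m), smul_eq_mul, linAvg]

/-- The second moments of the random orthogonal maps. -/
theorem lintegral_weighted_poisson (hd : 1 ≤ d) (hn : 2 ≤ n) (hρ : SymmetryCondition ρ)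
    {a : ℝ} (ha : 0 ≤ a) {κ : Fin n → ℝ} (hκ0 : ∀ k, 0 ≤ κ k) {r : ℝ} (hκ : ∑ k, κ k = n * r)
    (x : Vel d n) :
    ∫⁻ O, ENNReal.ofReal (∑ k, κ k * ‖adj O x k‖ ^ 2) ∂poissonCollisionMeasure ρ a =
      ENNReal.ofReal (r * normSq x + Real.exp (-(a * (2 / (d * ((n : ℝ) - 1))))) *
        (∑ k, κ k * ‖x k‖ ^ 2 - r * normSq x)) := by
  set l : ℝ := 1 - 2 / (d * ((n : ℝ) - 1)) with hl
  have h1 : ∀ m, ∫ O, ∑ k, κ k * ‖adj O x k‖ ^ 2 ∂collisionMeasure ρ m =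
      r * normSq x + l ^ m * (∑ k, κ k * ‖x k‖ ^ 2 - r * normSq x) := fun m => by
    have hpm := isProbabilityMeasure_collisionMeasure (d := d) ρ hn m
    have hom := ae_isOrth_collisionMeasure (n := n) ρ m
    -- The weights are split into their mean `r` and a part of sum zero. The mean multiplies the
    -- total energy, which orthogonality conserves; the other part decays.
    have h2 := integral_weighted_collisionMeasure hd hn hρ (κ := fun k => κ k - r)
      (by simp [Finset.sum_sub_distrib, hκ]) x m
    have e : ∀ z : Vel d n, ∑ k, (κ k - r) * ‖z k‖ ^ 2 =
        ∑ k, κ k * ‖z k‖ ^ 2 - r * normSq z := fun z => by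
      simp only [sub_mul, Finset.sum_sub_distrib, normSq, Finset.mul_sum]
    simp only [e] at h2
    have h3 : ∫ O, (∑ k, κ k * ‖adj O x k‖ ^ 2 - r * normSq (adj O x)) ∂collisionMeasure ρ m =
        ∫ O, (∑ k, κ k * ‖adj O x k‖ ^ 2 - r * normSq x) ∂collisionMeasure ρ m := by
      refine integral_congr_ae ?_
      filter_upwards [hom] with O hO
      rw [(hO x).2]
    rw [h3, integral_sub (integrable_weighted_adj hom κ x) (integrable_const _)] at h2
    simp only [integral_const, probReal_univ, one_smul] at h2
    linarith
  have h0 : ∀ z : Vel d n, 0 ≤ ∑ k, κ k * ‖z k‖ ^ 2 := fun z =>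
    Finset.sum_nonneg fun k _ => mul_nonneg (hκ0 k) (sq_nonneg _)
  have h2 : ∀ m, ∫⁻ O, ENNReal.ofReal (∑ k, κ k * ‖adj O x k‖ ^ 2)
      ∂(ENNReal.ofReal (poissonWeight a m) • collisionMeasure ρ m) =
      ENNReal.ofReal (poissonWeight a m *
        (r * normSq x + l ^ m * (∑ k, κ k * ‖x k‖ ^ 2 - r * normSq x))) := fun m => by
    have hpm := isProbabilityMeasure_collisionMeasure (d := d) ρ hn m
    have hom := ae_isOrth_collisionMeasure (n := n) ρ m
    rw [lintegral_smul_measure, ← ofReal_integral_eq_lintegral_ofReal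
      (integrable_weighted_adj hom κ x) (Eventually.of_forall fun O => h0 _), h1, smul_eq_mul,
      ← ENNReal.ofReal_mul (poissonWeight_nonneg ha m)]
  have h3 : HasSum (fun m => poissonWeight a m *
      (r * normSq x + l ^ m * (∑ k, κ k * ‖x k‖ ^ 2 - r * normSq x)))
      (r * normSq x + Real.exp (-(a * (2 / (d * ((n : ℝ) - 1))))) *
        (∑ k, κ k * ‖x k‖ ^ 2 - r * normSq x)) := by
    have h4 := ((hasSum_poissonWeight a).mul_right (r * normSq x)).add
      ((hasSum_poissonWeight_mul_pow a l).mul_right (∑ k, κ k * ‖x k‖ ^ 2 - r * normSq x))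
    rw [one_mul, hl, sub_sub_cancel] at h4
    refine h4.congr_fun fun m => ?_
    ring
  rw [poissonCollisionMeasure, lintegral_sum_measure]
  simp only [h2]
  rw [← ENNReal.ofReal_tsum_of_nonneg _ h3.summable, h3.tsum_eq]
  intro m
  refine mul_nonneg (poissonWeight_nonneg ha m) ?_
  rw [← h1]
  exact integral_nonneg fun O => h0 _

end semigroup

end KacModel

namespace KacModel

/-! ### The flow of the first `N` particles. -/

section marginalflow

variable {d N M : ℕ}

/-- The velocities of the first `N` particles. -/
noncomputable def fstCLM (d N M : ℕ) : Vel d (N + M) →L[ℝ] Vel d N :=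
  ContinuousLinearMap.pi fun k => ContinuousLinearMap.proj (R := ℝ)
    (φ := fun _ : Fin (N + M) => EuclideanSpace ℝ (Fin d)) (Fin.castAdd M k)

/-- The embedding of the velocities of the first `N` particles. -/
noncomputable def inlCLM (d N M : ℕ) : Vel d N →L[ℝ] Vel d (N + M) :=
  ContinuousLinearMap.pi fun i => Fin.addCases (motive := fun _ => Vel d N →L[ℝ] _)
    (fun k => ContinuousLinearMap.proj (R := ℝ) (φ := fun _ : Fin N => EuclideanSpace ℝ (Fin d)) k)
    (fun _ => 0) i

/-- The embedding of the velocities of the last `M` particles. -/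
noncomputable def inrCLM (d N M : ℕ) : Vel d M →L[ℝ] Vel d (N + M) :=
  ContinuousLinearMap.pi fun i => Fin.addCases (motive := fun _ => Vel d M →L[ℝ] _) (fun _ => 0)
    (fun k => ContinuousLinearMap.proj (R := ℝ) (φ := fun _ : Fin M => EuclideanSpace ℝ (Fin d)) k)
    i

theorem fstCLM_apply (u : Vel d (N + M)) : fstCLM d N M u = fun k => u (Fin.castAdd M k) := rfl

theorem inlCLM_castAdd (v : Vel d N) (k : Fin N) : inlCLM d N M v (Fin.castAdd M k) = v k := by
  simp [inlCLM]

theorem inlCLM_natAdd (v : Vel d N) (k : Fin M) : inlCLM d N M v (Fin.natAdd N k) = 0 := by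
  simp [inlCLM]

theorem inrCLM_castAdd (w : Vel d M) (k : Fin N) : inrCLM d N M w (Fin.castAdd M k) = 0 := by
  simp [inrCLM]

theorem inrCLM_natAdd (w : Vel d M) (k : Fin M) : inrCLM d N M w (Fin.natAdd N k) = w k := by
  simp [inrCLM]

theorem append_eq (v : Vel d N) (w : Vel d M) :
    (Fin.append v w : Vel d (N + M)) = inlCLM d N M v + inrCLM d N M w := by
  funext i
  refine Fin.addCases (fun k => ?_) (fun k => ?_) i
  · simp [inlCLM_castAdd, inrCLM_castAdd]
  · simp [inlCLM_natAdd, inrCLM_natAdd]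

theorem continuous_append :
    Continuous fun p : Vel d N × Vel d M => (Fin.append p.1 p.2 : Vel d (N + M)) := by
  simp only [append_eq]
  fun_prop

theorem dot_inlCLM (y : Vel d N) (u : Vel d (N + M)) :
    dot (inlCLM d N M y) u = dot y (fstCLM d N M u) := by
  have e1 : dot (inlCLM d N M y) u = ∑ k, inner ℝ (inlCLM d N M y k) (u k) := by unfold dot; rfl
  have e2 : dot y (fstCLM d N M u) = ∑ k, inner ℝ (y k) (fstCLM d N M u k) := by unfold dot; rfl
  rw [e1, e2, Fin.sum_univ_add]
  simp [inlCLM_castAdd, inlCLM_natAdd, fstCLM_apply]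

/-- Restriction and embedding are adjoint to each other. Thus `|Aᵀ y|²` is the energy of the first
`N` particles of `Oᵀ (y, 0)`, a weighted energy to which the moment formula applies. -/
theorem adj_fst_comp_inl (O : Vel d (N + M) →L[ℝ] Vel d (N + M)) (y : Vel d N) :
    adj ((fstCLM d N M).comp (O.comp (inlCLM d N M))) y =
      fstCLM d N M (adj O (inlCLM d N M y)) := by
  refine ext_dot fun z => ?_
  rw [dot_adj]
  change dot y (fstCLM d N M (O (inlCLM d N M z))) = _
  rw [← dot_inlCLM, ← dot_adj, dot_comm, dot_inlCLM, dot_comm]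

/-- The indicator of the first `N` particles. -/
noncomputable def firstWeight (N M : ℕ) (i : Fin (N + M)) : ℝ :=
  Fin.addCases (motive := fun _ => ℝ) (fun _ => 1) (fun _ => 0) i

theorem firstWeight_nonneg (i : Fin (N + M)) : 0 ≤ firstWeight N M i := by
  refine Fin.addCases (fun k => ?_) (fun k => ?_) i <;> simp [firstWeight]

theorem sum_firstWeight : ∑ i, firstWeight N M i = N := by
  rw [Fin.sum_univ_add]
  simp [firstWeight]

theorem normSq_fstCLM (u : Vel d (N + M)) :
    normSq (fstCLM d N M u) = ∑ i, firstWeight N M i * ‖u i‖ ^ 2 := by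
  rw [Fin.sum_univ_add]
  simp [firstWeight, normSq, fstCLM_apply]

theorem fst_inlCLM (y : Vel d N) : fstCLM d N M (inlCLM d N M y) = y := by
  funext k
  exact inlCLM_castAdd y k

theorem normSq_inlCLM (y : Vel d N) : normSq (inlCLM d N M y) = normSq y := by
  rw [normSq_eq_dot, dot_inlCLM, fst_inlCLM, ← normSq_eq_dot]

/-- The splitting of the particles into two groups. -/
noncomputable def appendEquiv (d N M : ℕ) : Vel d N × Vel d M ≃ᵐ Vel d (N + M) where
  toFun p := Fin.append p.1 p.2
  invFun u := (fun k => u (Fin.castAdd M k), fun k => u (Fin.natAdd N k))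
  left_inv p := by ext1 <;> funext k <;> simp
  right_inv u := Fin.append_castAdd_natAdd
  measurable_toFun := continuous_append.measurable
  measurable_invFun := (measurePreserving_split d N M).measurable

theorem measurePreserving_append (d N M : ℕ) :
    MeasurePreserving (fun p : Vel d N × Vel d M => (Fin.append p.1 p.2 : Vel d (N + M)))
      (volume.prod volume) volume :=
  MeasurePreserving.symm (appendEquiv d N M).symm (measurePreserving_split d N M)

theorem measurePreserving_append_gauss {β : ℝ} (hβ : 0 < β) (d N M : ℕ) :
    MeasurePreserving (fun p : Vel d N × Vel d M => (Fin.append p.1 p.2 : Vel d (N + M)))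
      ((gaussMeasure β d N).prod (gaussMeasure β d M)) (gaussMeasure β d (N + M)) :=
  MeasurePreserving.symm (appendEquiv d N M).symm (measurePreserving_split_gauss hβ d N M)

theorem measurePreserving_fst_gauss {β : ℝ} (hβ : 0 < β) (d N M : ℕ) :
    MeasurePreserving (fstCLM d N M) (gaussMeasure β d (N + M)) (gaussMeasure β d N) := by
  have := isProbabilityMeasure_gaussMeasure hβ d M
  exact measurePreserving_fst.comp (measurePreserving_split_gauss hβ d N M)

/-- The linear part of the flow of the first `N` particles. -/
noncomputable def margLin (d N M : ℕ) (e : (Vel d (N + M) →L[ℝ] Vel d (N + M)) × Vel d M) :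
    Vel d N →L[ℝ] Vel d N := (fstCLM d N M).comp (e.1.comp (inlCLM d N M))

/-- The contribution of the last `M` particles to the flow of the first `N` particles. -/
noncomputable def margShift (d N M : ℕ) (e : (Vel d (N + M) →L[ℝ] Vel d (N + M)) × Vel d M) :
    Vel d N := fstCLM d N M (e.1 (inrCLM d N M e.2))

theorem margLin_add_margShift (e : (Vel d (N + M) →L[ℝ] Vel d (N + M)) × Vel d M) (v : Vel d N) :
    margLin d N M e v + margShift d N M e = fstCLM d N M (e.1 (Fin.append v e.2)) := by
  rw [append_eq, map_add, map_add]
  rfl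

theorem continuous_margLin : Continuous (margLin d N M) := by
  unfold margLin
  exact continuous_const.clm_comp (continuous_fst.clm_comp continuous_const)

theorem continuous_margShift : Continuous (margShift d N M) := by
  unfold margShift
  fun_prop

/-- The factors are rearranged and the velocities joined; then `O` acts on a Gaussian vector
independent of it. As a result `O` and `O (v, w)` are independent. -/
theorem measurePreserving_flow {β : ℝ} (hβ : 0 < β)
    (μ : Measure (Vel d (N + M) →L[ℝ] Vel d (N + M))) [IsProbabilityMeasure μ]
    (hμ : ∀ᵐ O ∂μ, IsOrth O) :
    MeasurePreserving (fun p : ((Vel d (N + M) →L[ℝ] Vel d (N + M)) × Vel d M) × Vel d N =>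
      (p.1.1, p.1.1 (Fin.append p.2 p.1.2)))
      ((μ.prod (gaussMeasure β d M)).prod (gaussMeasure β d N))
      (μ.prod (gaussMeasure β d (N + M))) := by
  have h1 := isProbabilityMeasure_gaussMeasure hβ d M
  have h2 := isProbabilityMeasure_gaussMeasure hβ d N
  have h3 := isProbabilityMeasure_gaussMeasure hβ d (N + M)
  have a1 := measurePreserving_prodAssoc μ (gaussMeasure β d M) (gaussMeasure β d N)
  have a2 := (MeasurePreserving.id μ).prod ((measurePreserving_append_gauss hβ d N M).comp
    (Measure.measurePreserving_swap (μ := gaussMeasure β d M) (ν := gaussMeasure β d N)))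
  have a3 := measurePreserving_skew (ν := gaussMeasure β d (N + M)) (μ := μ)
    (by filter_upwards [hμ] with O hO using hO.measurePreserving_gauss β)
  exact a3.comp (a2.comp a1)

theorem measurable_adj_marg {y : Vel d N → Vel d N} (hy : Measurable y) :
    Measurable fun q : (Vel d (N + M) →L[ℝ] Vel d (N + M)) × Vel d (N + M) =>
      adj ((fstCLM d N M).comp (q.1.comp (inlCLM d N M))) (y (fstCLM d N M q.2)) := by
  refine measurable_adj_comp (Continuous.measurable ?_) ?_
  · exact continuous_const.clm_comp (continuous_fst.clm_comp continuous_const)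
  · exact hy.comp ((fstCLM d N M).continuous.measurable.comp measurable_snd)

/-- The weights are the indicator of the first `N` particles, of mean `N / (N + M)`. The vector `(y,
0)` has all its energy there, so the decaying part starts from the fraction `M / (N + M)`. The rate
is the number `(N + M) t` of expected collisions times `2 / (d (N + M - 1))`. -/
theorem lintegral_normSq_adj_marg {ρ : Measure (Angle d)} [IsProbabilityMeasure ρ] (hd : 1 ≤ d)
    (hN : 1 ≤ N) (hM : 1 ≤ M) (hρ : SymmetryCondition ρ) {t : ℝ} (ht : 0 ≤ t) (y : Vel d N) :
    ∫⁻ O, ENNReal.ofReal (normSq (adj ((fstCLM d N M).comp (O.comp (inlCLM d N M))) y))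
      ∂poissonCollisionMeasure ρ (((N + M : ℕ) : ℝ) * t) =
      ENNReal.ofReal (decayFactor d N M t) * ENNReal.ofReal (normSq y) := by
  have hn0 : (N : ℝ) + M ≠ 0 := by positivity
  have hd0 : (d : ℝ) ≠ 0 := by positivity
  have hn1 : (N : ℝ) + M - 1 ≠ 0 := by
    have h1 : (1 : ℝ) ≤ N := by exact_mod_cast hN
    have h2 : (1 : ℝ) ≤ M := by exact_mod_cast hM
    linarith
  have hc : 0 ≤ decayFactor d N M t := by unfold decayFactor; positivity
  simp only [adj_fst_comp_inl, normSq_fstCLM]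
  rw [lintegral_weighted_poisson ρ hd (by omega) hρ (by positivity) firstWeight_nonneg
    (r := N / (N + M)) (by rw [sum_firstWeight]; push_cast; field_simp),
    ← ENNReal.ofReal_mul hc, ← normSq_fstCLM, fst_inlCLM, normSq_inlCLM]
  congr 1
  have e : ((N + M : ℕ) : ℝ) * t * (2 / (d * (((N + M : ℕ) : ℝ) - 1))) =
      2 * (N + M) / (d * (N + M - 1)) * t := by
    push_cast
    field_simp
  rw [e, decayFactor]
  field_simp
  ring

/-- Independence in integrated form: the inner integral is taken over the random map at a fixed
image point. -/
theorem lintegral_comp_prod {X Y Z W : Type*} [MeasurableSpace X] [MeasurableSpace Y]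
    [MeasurableSpace Z] [MeasurableSpace W] {P : Measure X} {μ : Measure Y} {ν : Measure Z}
    {ν' : Measure W} [SFinite μ] [SFinite ν] {J : X → Y × Z} (hJ : MeasurePreserving J P (μ.prod ν))
    {π : Z → W} (hπ : MeasurePreserving π ν ν') {K : Y → W → ℝ≥0∞}
    (hK : Measurable fun q : Y × Z => K q.1 (π q.2)) {c : ℝ≥0∞} {g : W → ℝ≥0∞} (hg : Measurable g)
    (h : ∀ w, ∫⁻ y, K y w ∂μ = c * g w) :
    ∫⁻ x, K (J x).1 (π (J x).2) ∂P = c * ∫⁻ w, g w ∂ν' := by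
  rw [hJ.lintegral_comp hK, lintegral_prod_symm _ hK.aemeasurable, ← hπ.lintegral_comp hg,
    ← lintegral_const_mul (f := fun z => g (π z)) _ (hg.comp hπ.measurable)]
  simp only [h]

theorem lintegral_normSq_adj_marg_mul {ρ : Measure (Angle d)} [IsProbabilityMeasure ρ] (hd : 1 ≤ d)
    (hN : 1 ≤ N) (hM : 1 ≤ M) (hρ : SymmetryCondition ρ) {t : ℝ} (ht : 0 ≤ t) (y : Vel d N)
    (c : ℝ≥0∞) :
    ∫⁻ O, ENNReal.ofReal (normSq (adj ((fstCLM d N M).comp (O.comp (inlCLM d N M))) y)) * c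
      ∂poissonCollisionMeasure ρ (((N + M : ℕ) : ℝ) * t) =
      ENNReal.ofReal (decayFactor d N M t) * (ENNReal.ofReal (normSq y) * c) := by
  have hm : Measurable fun O : Vel d (N + M) →L[ℝ] Vel d (N + M) =>
      adj ((fstCLM d N M).comp (O.comp (inlCLM d N M))) y :=
    measurable_adj_comp (Continuous.measurable
      (continuous_const.clm_comp (continuous_id.clm_comp continuous_const))) measurable_const
  have hm2 : Measurable fun O : Vel d (N + M) →L[ℝ] Vel d (N + M) =>
      ENNReal.ofReal (normSq (adj ((fstCLM d N M).comp (O.comp (inlCLM d N M))) y)) :=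
    (continuous_normSq.measurable.comp hm).ennreal_ofReal
  rw [lintegral_mul_const _ hm2,
    lintegral_normSq_adj_marg hd hN hM hρ ht, mul_assoc]

/-- Everything follows from the joint law of `O` and `O (v, w)`: the first part of `O (v, w)` is
Gaussian, and by independence `E |Aᵀ y|²` may be inserted at each of its values. The flow inequality
is in fact an equality. -/
theorem isFlow_marg {ρ : Measure (Angle d)} [IsProbabilityMeasure ρ] {β : ℝ} (hβ : 0 < β)
    (hd : 1 ≤ d) (hN : 1 ≤ N) (hM : 1 ≤ M) (hρ : SymmetryCondition ρ) {t : ℝ} (ht : 0 ≤ t) :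
    IsFlow ((poissonCollisionMeasure ρ (((N + M : ℕ) : ℝ) * t)).prod (gaussMeasure β d M)) β
      (margLin d N M) (margShift d N M) (decayFactor d N M t) := by
  have hμp := isProbabilityMeasure_poissonCollisionMeasure (d := d) ρ (n := N + M)
    (by omega) (a := ((N + M : ℕ) : ℝ) * t) (by positivity)
  have hμ := ae_isOrth_poissonCollisionMeasure (n := N + M) ρ (((N + M : ℕ) : ℝ) * t)
  set μ : Measure (Vel d (N + M) →L[ℝ] Vel d (N + M)) :=
    poissonCollisionMeasure ρ (((N + M : ℕ) : ℝ) * t) with hμdef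
  have h1 := isProbabilityMeasure_gaussMeasure hβ d M
  have h2 := isProbabilityMeasure_gaussMeasure hβ d N
  have h3 := isProbabilityMeasure_gaussMeasure hβ d (N + M)
  have hJ := measurePreserving_flow hβ μ hμ
  refine ⟨continuous_margLin.measurable, continuous_margShift.measurable, ?_, ?_, ?_⟩
  · refine ⟨‖fstCLM d N M‖ * (((N + M : ℕ) + 1) * ‖inlCLM d N M‖), ?_⟩
    have := Measure.quasiMeasurePreserving_fst (μ := μ) (ν := gaussMeasure β d M).ae hμ
    filter_upwards [this] with e he
    refine (ContinuousLinearMap.opNorm_comp_le _ _).trans ?_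
    refine mul_le_mul_of_nonneg_left ?_ (norm_nonneg _)
    refine (ContinuousLinearMap.opNorm_comp_le _ _).trans ?_
    exact mul_le_mul_of_nonneg_right he.norm_le (norm_nonneg _)
  · simp only [margLin_add_margShift]
    exact ((measurePreserving_fst_gauss hβ d N M).comp
      (measurePreserving_snd.comp hJ)).map_eq
  · intro y hy r hr
    simp only [margLin_add_margShift]
    have hk : Measurable fun q : (Vel d (N + M) →L[ℝ] Vel d (N + M)) × Vel d (N + M) =>
        ENNReal.ofReal (normSq (adj ((fstCLM d N M).comp (q.1.comp (inlCLM d N M)))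
          (y (fstCLM d N M q.2)))) * r (fstCLM d N M q.2) :=
      (continuous_normSq.measurable.comp (measurable_adj_marg hy)).ennreal_ofReal.mul
        (hr.comp ((fstCLM d N M).continuous.measurable.comp measurable_snd))
    have hz : Measurable fun z => ENNReal.ofReal (normSq (y z)) * r z :=
      ((continuous_normSq.measurable.comp hy).ennreal_ofReal).mul hr
    exact (lintegral_comp_prod hJ (measurePreserving_fst_gauss hβ d N M)
      (K := fun O z => ENNReal.ofReal (normSq (adj ((fstCLM d N M).comp
        (O.comp (inlCLM d N M))) (y z))) * r z) hk hz
      fun z => lintegral_normSq_adj_marg_mul hd hN hM hρ ht (y z) (r z)).le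

end marginalflow

end KacModel

namespace KacModel

/-! ### Commutation with the Ornstein–Uhlenbeck flow. -/

section commute

variable {d N M : ℕ} {β : ℝ}

theorem integral_comp_measurePreserving {X Y : Type*} [MeasurableSpace X] [MeasurableSpace Y]
    {μ : Measure X} {ν : Measure Y} {T : X → Y} (hT : MeasurePreserving T μ ν) {φ : Y → ℝ}
    (hφ : AEStronglyMeasurable φ ν) : ∫ x, φ (T x) ∂μ = ∫ y, φ y ∂ν := by
  rw [← hT.map_eq, integral_map hT.measurable.aemeasurable (by rwa [hT.map_eq])]

theorem integrable_of_continuous_of_bound {X : Type*} [TopologicalSpace X] [MeasurableSpace X]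
    [OpensMeasurableSpace X] {μ : Measure X} [IsFiniteMeasure μ] {f : X → ℝ} (hf : Continuous f)
    {K : ℝ} (hK : ∀ x, ‖f x‖ ≤ K) : Integrable f μ :=
  Integrable.of_bound hf.aestronglyMeasurable K (Eventually.of_forall hK)

/-- Rotations of a Gaussian vector commute with linear maps which preserve the Gaussian measure. -/
theorem integral_rotate_comp (hβ : 0 < β) {T : Vel d N × Vel d M →L[ℝ] Vel d N}
    (hT : MeasurePreserving T ((gaussMeasure β d N).prod (gaussMeasure β d M)) (gaussMeasure β d N))
    {h : Vel d N → ℝ} (hc : Continuous h) {K : ℝ} (hK : ∀ v, ‖h v‖ ≤ K) {c s : ℝ}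
    (hcs : c ^ 2 + s ^ 2 = 1) (v : Vel d N) :
    ∫ w, ∫ y, h (T (c • v + s • y, w)) ∂gaussMeasure β d N ∂gaussMeasure β d M =
      ∫ w, ∫ y, h (c • T (v, w) + s • y) ∂gaussMeasure β d N ∂gaussMeasure β d M := by
  have h1 := isProbabilityMeasure_gaussMeasure hβ d M
  have h2 := isProbabilityMeasure_gaussMeasure hβ d N
  -- The Gaussian `y` is realised as `T (y, y')` with independent Gaussians. Linearity merges both
  -- terms into one value of `T`, whose second argument `c w + s y'` is again Gaussian and can be
  -- renamed `w`.
  have e1 : ∀ w : Vel d M, ∫ y, h (c • T (v, w) + s • y) ∂gaussMeasure β d N =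
      ∫ y, ∫ y', h (T (c • v + s • y, c • w + s • y')) ∂gaussMeasure β d M
        ∂gaussMeasure β d N := fun w => by
    have hcont : Continuous fun y => h (c • T (v, w) + s • y) := by fun_prop
    rw [← integral_comp_measurePreserving hT hcont.aestronglyMeasurable]
    have e2 : ∀ q : Vel d N × Vel d M,
        c • T (v, w) + s • T q = T (c • v + s • q.1, c • w + s • q.2) := fun q => by
      rw [← map_smul, ← map_smul, ← map_add]; rfl
    simp only [e2]
    exact integral_prod (fun q : Vel d N × Vel d M => h (T (c • v + s • q.1, c • w + s • q.2)))
      (integrable_of_continuous_of_bound (by fun_prop) fun q => hK _)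
  simp only [e1]
  rw [integral_integral_swap (integrable_of_continuous_of_bound
    (f := fun p : Vel d M × Vel d N => h (T (c • v + s • p.2, p.1))) (by fun_prop) fun p => hK _)]
  have hcont3 : Continuous fun p : (Vel d M × Vel d N) × Vel d M =>
      h (T (c • v + s • p.1.2, c • p.1.1 + s • p.2)) := by fun_prop
  have i3 := (integrable_of_continuous_of_bound
    (μ := ((gaussMeasure β d M).prod (gaussMeasure β d N)).prod (gaussMeasure β d M))
    hcont3 fun p => hK _).integral_prod_left
  refine Eq.trans ?_ (integral_integral_swap (f := fun (w : Vel d M) (y : Vel d N) =>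
    ∫ y', h (T (c • v + s • y, c • w + s • y')) ∂gaussMeasure β d M) i3).symm
  congr 1
  funext y
  have hcont2 : Continuous fun w => h (T (c • v + s • y, w)) := by fun_prop
  rw [← integral_comp_measurePreserving (measurePreserving_rotate hβ d M hcs)
    hcont2.aestronglyMeasurable]
  exact integral_prod (fun q : Vel d M × Vel d M => h (T (c • v + s • y, c • q.1 + s • q.2)))
    (integrable_of_continuous_of_bound (by fun_prop) fun q => hK _)

/-- The velocities of the first `N` particles after a linear map. -/
noncomputable def fstComp {d N M : ℕ} (O : Vel d (N + M) →L[ℝ] Vel d (N + M)) :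
    Vel d N × Vel d M →L[ℝ] Vel d N :=
  (fstCLM d N M).comp (O.comp ((inlCLM d N M).comp (ContinuousLinearMap.fst ℝ _ _) +
    (inrCLM d N M).comp (ContinuousLinearMap.snd ℝ _ _)))

theorem fstComp_apply (O : Vel d (N + M) →L[ℝ] Vel d (N + M)) (v : Vel d N) (w : Vel d M) :
    fstComp O (v, w) = fstCLM d N M (O (Fin.append v w)) := by
  rw [append_eq]; rfl

theorem margLin_add_margShift_eq (e : (Vel d (N + M) →L[ℝ] Vel d (N + M)) × Vel d M)
    (v : Vel d N) : margLin d N M e v + margShift d N M e = fstComp e.1 (v, e.2) := by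
  rw [margLin_add_margShift, fstComp_apply]

theorem continuous_fstComp : Continuous
    (fstComp : (Vel d (N + M) →L[ℝ] Vel d (N + M)) → Vel d N × Vel d M →L[ℝ] Vel d N) := by
  unfold fstComp
  exact continuous_const.clm_comp (continuous_id.clm_comp continuous_const)

theorem measurePreserving_fstComp (hβ : 0 < β) {O : Vel d (N + M) →L[ℝ] Vel d (N + M)}
    (hO : IsOrth O) : MeasurePreserving (fstComp O)
      ((gaussMeasure β d N).prod (gaussMeasure β d M)) (gaussMeasure β d N) := by
  have h := (measurePreserving_fst_gauss hβ d N M).comp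
    ((hO.measurePreserving_gauss β).comp (measurePreserving_append_gauss hβ d N M))
  have e : ⇑(fstComp O) = fstCLM d N M ∘ O ∘
      fun p : Vel d N × Vel d M => (Fin.append p.1 p.2 : Vel d (N + M)) :=
    funext fun p => fstComp_apply O p.1 p.2
  rw [e]
  exact h

/-- Conditionally on `O`, the new velocities are a linear image of `(v, w)` which sends Gaussians to
Gaussians because `O` is orthogonal. The identity thus holds for almost every `O` before averaging.
-/
theorem ou_flowAvg_marg (hβ : 0 < β) {μ : Measure (Vel d (N + M) →L[ℝ] Vel d (N + M))}
    [IsProbabilityMeasure μ] (hμ : ∀ᵐ O ∂μ, IsOrth O) {h : Vel d N → ℝ} (hh : IsBddC1 h) (θ : ℝ) :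
    ou β θ (flowAvg (μ.prod (gaussMeasure β d M)) (margLin d N M) (margShift d N M) h) =
      flowAvg (μ.prod (gaussMeasure β d M)) (margLin d N M) (margShift d N M) (ou β θ h) := by
  have h1 := isProbabilityMeasure_gaussMeasure hβ d M
  have h2 := isProbabilityMeasure_gaussMeasure hβ d N
  obtain ⟨K, hK⟩ := hh.bdd
  have hc := hh.contDiff.continuous
  funext v
  simp only [ou_apply, flowAvg, margLin_add_margShift_eq]
  have c1 : Continuous fun p : Vel d N × ((Vel d (N + M) →L[ℝ] Vel d (N + M)) × Vel d M) =>
      h (fstComp p.2.1 (Real.cos θ • v + Real.sin θ • p.1, p.2.2)) :=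
    hc.comp ((continuous_fstComp.comp continuous_snd.fst).clm_apply (by fun_prop))
  have c2 : Continuous fun p : ((Vel d (N + M) →L[ℝ] Vel d (N + M)) × Vel d M) × Vel d N =>
      h (fstComp p.1.1 (Real.cos θ • v + Real.sin θ • p.2, p.1.2)) :=
    c1.comp continuous_swap
  have c3 : Continuous fun p : ((Vel d (N + M) →L[ℝ] Vel d (N + M)) × Vel d M) × Vel d N =>
      h (Real.cos θ • fstComp p.1.1 (v, p.1.2) + Real.sin θ • p.2) := by
    have c4 : Continuous fun p : ((Vel d (N + M) →L[ℝ] Vel d (N + M)) × Vel d M) × Vel d N =>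
        fstComp p.1.1 (v, p.1.2) :=
      (continuous_fstComp.comp continuous_fst.fst).clm_apply (by fun_prop)
    fun_prop
  rw [integral_integral_swap (integrable_of_continuous_of_bound c1 fun p => hK _)]
  have i2 := (integrable_of_continuous_of_bound
    (μ := (μ.prod (gaussMeasure β d M)).prod (gaussMeasure β d N)) c2
    fun p => hK _).integral_prod_left
  have i3 := (integrable_of_continuous_of_bound
    (μ := (μ.prod (gaussMeasure β d M)).prod (gaussMeasure β d N)) c3
    fun p => hK _).integral_prod_left
  rw [integral_prod _ i2, integral_prod _ i3]
  refine integral_congr_ae ?_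
  filter_upwards [hμ] with O hO
  exact integral_rotate_comp hβ (measurePreserving_fstComp hβ hO) hc hK
    (Real.cos_sq_add_sin_sq θ) v

end commute

/-! ### The marginal of the evolution as an average over the flow. -/

section marginal

variable {d N M : ℕ} {β : ℝ}

theorem maxwell_split (hβ : 0 < β) (u : Vel d (N + M)) :
    maxwell β u = maxwell β (fstCLM d N M u) * maxwell β (fun k => u (Fin.natAdd N k)) := by
  rw [maxwell_mul_maxwell, maxwell_eq]
  congr 2
  · rw [← Real.rpow_add (by positivity)]; congr 1; push_cast; ring
  · simp [normSq, Fin.sum_univ_add, fstCLM_apply]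

theorem quasiMeasurePreserving_fstCLM (d N M : ℕ) :
    Measure.QuasiMeasurePreserving (fstCLM d N M) volume volume :=
  Measure.quasiMeasurePreserving_fst.comp (measurePreserving_split d N M).quasiMeasurePreserving

theorem ae_append {p : Vel d (N + M) → Prop} (h : ∀ᵐ u, p u) :
    ∀ᵐ v : Vel d N, ∀ᵐ w : Vel d M, p (Fin.append v w) :=
  Measure.ae_ae_of_ae_prod ((measurePreserving_append d N M).quasiMeasurePreserving.ae h)

theorem initialState_coeFn (hβ : 0 < β) {f₀ : Vel d N → ℝ} (hf₀ : Integrable f₀) :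
    initialState hβ M hf₀ =ᵐ[volume] initialDensity β M f₀ :=
  Integrable.coeFn_toL1 _

theorem marginalAt_zero (ρ : Measure (Angle d)) [IsProbabilityMeasure ρ] (hβ : 0 < β)
    {f₀ : Vel d N → ℝ} (hf₀ : Integrable f₀) :
    marginalAt ρ hβ M hf₀ 0 =ᵐ[volume] f₀ := by
  have h0 : NormedSpace.exp ((0 : ℝ) • classicGenerator ρ (N + M)) (initialState hβ M hf₀) =
      initialState hβ M hf₀ := by
    rw [zero_smul, NormedSpace.exp_zero]; rfl
  filter_upwards [ae_append (initialState_coeFn (M := M) hβ hf₀)] with v hv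
  rw [marginalAt, marginal, h0, integral_congr_ae hv]
  simp only [initialDensity, Fin.append_left, Fin.append_right]
  rw [integral_const_mul]
  have : ∫ w : Vel d M, maxwell β (fun k => w k) = 1 := integral_maxwell hβ
  rw [this, mul_one]

/-- The marginal of the Kac evolution is the average over a flow. -/
theorem marginalAt_eq (ρ : Measure (Angle d)) [IsProbabilityMeasure ρ] (hβ : 0 < β) (hd : 1 ≤ d)
    (hN : 1 ≤ N) (hM : 1 ≤ M) (hρ : SymmetryCondition ρ) {f₀ h₀ : Vel d N → ℝ}
    (hf₀ : Integrable f₀) (hh : Integrable h₀ (gaussMeasure β d N))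
    (hfh : f₀ =ᵐ[volume] fun v => maxwell β v * h₀ v) {t : ℝ} (ht : 0 ≤ t) :
    marginalAt ρ hβ M hf₀ t =ᵐ[volume] fun v => maxwell β v *
      flowAvg ((poissonCollisionMeasure ρ (((N + M : ℕ) : ℝ) * t)).prod (gaussMeasure β d M))
        (margLin d N M) (margShift d N M) h₀ v := by
  have hflow := isFlow_marg (N := N) (M := M) hβ hd hN hM hρ ht
  have hn : 2 ≤ N + M := by omega
  have hμp := isProbabilityMeasure_poissonCollisionMeasure (d := d) ρ hn
    (a := ((N + M : ℕ) : ℝ) * t) (by positivity)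
  have hμ := ae_isOrth_poissonCollisionMeasure (n := N + M) ρ (((N + M : ℕ) : ℝ) * t)
  have hexp := exp_classicGenerator_coeFn ρ hn ht (initialState hβ M hf₀)
  set μ : Measure (Vel d (N + M) →L[ℝ] Vel d (N + M)) :=
    poissonCollisionMeasure ρ (((N + M : ℕ) : ℝ) * t) with hμdef
  have h1 := isProbabilityMeasure_gaussMeasure hβ d M
  have h2 := isProbabilityMeasure_gaussMeasure hβ d N
  have e1 : initialState hβ M hf₀ =ᵐ[volume] fun u => maxwell β u * h₀ (fstCLM d N M u) := by
    filter_upwards [initialState_coeFn (M := M) hβ hf₀,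
      (quasiMeasurePreserving_fstCLM d N M).ae hfh] with u h2 h3
    rw [h2, maxwell_split hβ, initialDensity]
    rw [fstCLM_apply] at h3 ⊢
    rw [h3]
    ring
  -- The Maxwellian depends only on the energy, which `O` conserves, so it can be taken out of the
  -- average.
  have e2 : linAvg μ (initialState hβ M hf₀) =ᵐ[volume]
      fun u => maxwell β u * ∫ O, h₀ (fstCLM d N M (O u)) ∂μ := by
    refine (linAvg_congr hμ e1).trans (Eventually.of_forall fun u => ?_)
    refine Eq.trans (integral_congr_ae ?_) (integral_const_mul _ _)
    filter_upwards [hμ] with O hO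
    rw [maxwell_eq_of_normSq (hO u).1]
  have i1 := (ae_gaussMeasure_iff hβ).1 (hflow.integrable_comp hh).prod_left_ae
  filter_upwards [ae_append (hexp.trans e2), i1] with v hv i2
  rw [marginalAt, marginal, integral_congr_ae hv, flowAvg, integral_prod_symm _ i2,
    integral_gaussMeasure hβ, ← integral_const_mul]
  congr 1
  funext w
  rw [maxwell_split hβ]
  simp only [Fin.append_right, margLin_add_margShift, smul_eq_mul]
  have : fstCLM d N M (Fin.append v w) = v := by
    funext k; simp [fstCLM_apply]
  rw [this, mul_assoc]

end marginal

end KacModel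

namespace KacModel

/-! ### From flows to densities, information and entropy. -/

section conclusion

variable {d n : ℕ} {β : ℝ}

theorem fisherInfo_le_of_ae_eq (hβ : 0 < β) {h h' : Vel d n → ℝ} (e : h =ᵐ[volume] h') :
    fisherInfo β h ≤ fisherInfo β h' := by
  refine le_iInf₂ fun G hG => (iInf₂_le G (hG.congr e.symm (ae_eq_refl G))).trans (le_of_eq ?_)
  refine lintegral_congr_ae ?_
  rw [EventuallyEq, ae_gaussMeasure_iff hβ]
  filter_upwards [e] with v hv
  rw [hv]

theorem fisherInfo_congr (hβ : 0 < β) {h h' : Vel d n → ℝ} (e : h =ᵐ[volume] h') :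
    fisherInfo β h = fisherInfo β h' :=
  le_antisymm (fisherInfo_le_of_ae_eq hβ e) (fisherInfo_le_of_ae_eq hβ e.symm)

theorem MemH1.congr (hβ : 0 < β) {g g' : Vel d n → ℝ} (h : MemH1 g (gaussMeasure β d n))
    (e : g =ᵐ[volume] g') : MemH1 g' (gaussMeasure β d n) := by
  obtain ⟨h1, G, h2, h3⟩ := h
  exact ⟨(memLp_congr_ae ((ae_gaussMeasure_iff hβ).2 e)).1 h1, G, h2.congr e (ae_eq_refl G), h3⟩

section

variable {E : Type*} [MeasurableSpace E] {P : Measure E} [IsProbabilityMeasure P]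
  {A : E → Vel d n →L[ℝ] Vel d n} {b : E → Vel d n} {c : ℝ}

/-- Averages over a flow contract the information at every weak gradient with finite information. -/
theorem IsFlow.exists_weakGradient_flowAvg (hβ : 0 < β) (hA : IsFlow P β A b c)
    {h : Vel d n → ℝ} {G : Vel d n → Vel d n} (hm : Measurable h) (h0 : ∀ v, 0 ≤ h v)
    (hh : Integrable h (gaussMeasure β d n)) (hG : HasWeakGradient h G)
    (hI : ∫⁻ v, ENNReal.ofReal (normSq (G v)) / ENNReal.ofReal (h v) ∂gaussMeasure β d n < ⊤) :
    ∃ G', HasWeakGradient (flowAvg P A b h) G' ∧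
      ∫⁻ v, ENNReal.ofReal (normSq (G' v)) / ENNReal.ofReal (flowAvg P A b h v)
        ∂gaussMeasure β d n ≤
      ENNReal.ofReal c * ∫⁻ v, ENNReal.ofReal (normSq (G v)) / ENNReal.ofReal (h v)
        ∂gaussMeasure β d n := by
  have hGm : AEStronglyMeasurable G volume := hG.locallyIntegrable_gradient.aestronglyMeasurable
  have e : G =ᵐ[volume] hGm.mk G := hGm.ae_eq_mk
  have e' := (ae_gaussMeasure_iff hβ).2 e
  have hm' : Measurable (hGm.mk G) := hGm.stronglyMeasurable_mk.measurable
  have hG' : HasWeakGradient h (hGm.mk G) := hG.congr (ae_eq_refl h) e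
  have hI' : ∫⁻ v, ENNReal.ofReal (normSq (G v)) / ENNReal.ofReal (h v) ∂gaussMeasure β d n =
      ∫⁻ v, ENNReal.ofReal (normSq (hGm.mk G v)) / ENNReal.ofReal (h v)
        ∂gaussMeasure β d n := by
    refine lintegral_congr_ae ?_
    filter_upwards [e'] with v hv
    rw [← hv]
  rw [hI'] at hI ⊢
  have hi : Integrable (hGm.mk G) (gaussMeasure β d n) :=
    integrable_of_fisher h0 hh hm'.aestronglyMeasurable hI
  exact ⟨_, hA.hasWeakGradient_flowAvg hβ hG' hh hi, hA.fisher_flowAvg_le hβ hm h0 hm' hh hi⟩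

theorem IsFlow.fisherInfo_flowAvg_le (hβ : 0 < β) (hA : IsFlow P β A b c) (hc : 0 < c)
    {h : Vel d n → ℝ} (hm : Measurable h) (h0 : ∀ v, 0 ≤ h v)
    (hh : Integrable h (gaussMeasure β d n)) :
    fisherInfo β (flowAvg P A b h) ≤ ENNReal.ofReal c * fisherInfo β h := by
  have hc' : ENNReal.ofReal c ≠ 0 := by simpa using hc
  unfold fisherInfo
  -- A positive finite constant passes through the infimum. The bound is then shown for each weak
  -- gradient separately, so their uniqueness plays no role; those of infinite information are
  -- trivial, again because the constant is positive.
  simp only [ENNReal.mul_iInf_of_ne hc' ENNReal.ofReal_ne_top]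
  refine le_iInf₂ fun G hG => ?_
  by_cases hI : ∫⁻ v, ENNReal.ofReal (∑ k, ‖G v k‖ ^ 2) / ENNReal.ofReal (h v)
      ∂gaussMeasure β d n < ⊤
  · obtain ⟨G', h1, h2⟩ := hA.exists_weakGradient_flowAvg hβ hm h0 hh hG hI
    exact (iInf₂_le G' h1).trans h2
  · rw [not_lt_top_iff.1 hI, ENNReal.mul_top hc']
    exact le_top

theorem IsFlow.memH1_sqrt_flowAvg (hβ : 0 < β) (hA : IsFlow P β A b c)
    {h : Vel d n → ℝ} (hm : Measurable h) (h0 : ∀ v, 0 ≤ h v)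
    (hh : Integrable h (gaussMeasure β d n)) (hI : fisherInfo β h < ⊤) :
    MemH1 (fun v => Real.sqrt (flowAvg P A b h v)) (gaussMeasure β d n) := by
  simp only [fisherInfo, iInf_lt_iff] at hI
  obtain ⟨G, hG, hI⟩ := hI
  obtain ⟨G', h1, h2⟩ := hA.exists_weakGradient_flowAvg hβ hm h0 hh hG hI
  exact memH1_sqrt hβ (fun v => integral_nonneg fun e => h0 _) (hA.integrable_flowAvg hβ hh) h1
    (h2.trans_lt (ENNReal.mul_lt_top ENNReal.ofReal_lt_top hI))

end

theorem decayFactor_pos {d N M : ℕ} (hN : 1 ≤ N) (t : ℝ) : 0 < decayFactor d N M t := by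
  have : (0 : ℝ) < N := by exact_mod_cast hN
  unfold decayFactor
  positivity

/-- The relative entropy in terms of the density with respect to the Gaussian. -/
theorem entropyIntegrand_ae_eq (hβ : 0 < β) {f h : Vel d n → ℝ}
    (e : f =ᵐ[volume] fun v => maxwell β v * h v) :
    entropyIntegrand f (maxwell β) =ᵐ[volume]
      fun v => maxwell β v • (h v * Real.log (h v)) := by
  filter_upwards [e] with v hv
  rw [entropyIntegrand, hv, mul_div_cancel_left₀ _ (maxwell_pos hβ v).ne', smul_eq_mul, mul_assoc]

theorem integrable_entropyIntegrand_iff (hβ : 0 < β) {f h : Vel d n → ℝ}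
    (e : f =ᵐ[volume] fun v => maxwell β v * h v) :
    Integrable (entropyIntegrand f (maxwell β)) ↔
      Integrable (fun v => h v * Real.log (h v)) (gaussMeasure β d n) := by
  rw [integrable_gaussMeasure_iff hβ]
  exact integrable_congr (entropyIntegrand_ae_eq hβ e)

theorem relEntropy_eq (hβ : 0 < β) {f h : Vel d n → ℝ}
    (e : f =ᵐ[volume] fun v => maxwell β v * h v) :
    relEntropy f (maxwell β) = ∫ v, h v * Real.log (h v) ∂gaussMeasure β d n := by
  rw [relEntropy, integral_gaussMeasure hβ]
  exact integral_congr_ae (entropyIntegrand_ae_eq hβ e)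

/-- A measurable version of the density with respect to the Gaussian. -/
theorem IsDensity.exists_density (hβ : 0 < β) {f : Vel d n → ℝ} (hf : IsDensity f) :
    ∃ h : Vel d n → ℝ, Measurable h ∧ (∀ v, 0 ≤ h v) ∧ Integrable h (gaussMeasure β d n) ∧
      ∫ v, h v ∂gaussMeasure β d n = 1 ∧ f =ᵐ[volume] fun v => maxwell β v * h v := by
  have hm := hf.integrable.1
  -- A measurable representative, truncated at zero: the flow estimates want nonnegativity at every
  -- point.
  have e : f =ᵐ[volume] fun v => maxwell β v * (max (hm.mk f v) 0 / maxwell β v) := by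
    filter_upwards [hm.ae_eq_mk, hf.nonneg] with v h1 h2
    rw [mul_div_cancel₀ _ (maxwell_pos hβ v).ne', ← h1, max_eq_left h2]
  refine ⟨fun v => max (hm.mk f v) 0 / maxwell β v,
    (hm.stronglyMeasurable_mk.measurable.max measurable_const).div continuous_maxwell.measurable,
    fun v => div_nonneg (le_max_right _ _) (maxwell_pos hβ v).le, ?_, ?_, e⟩
  · rw [integrable_gaussMeasure_iff hβ]
    exact hf.integrable.congr e
  · rw [integral_gaussMeasure hβ]
    exact (integral_congr_ae e).symm.trans hf.integral_eq_one

theorem isDensity_of_ae_eq (hβ : 0 < β) {f h : Vel d n → ℝ} (h0 : ∀ v, 0 ≤ h v)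
    (hi : Integrable h (gaussMeasure β d n)) (h1 : ∫ v, h v ∂gaussMeasure β d n = 1)
    (e : f =ᵐ[volume] fun v => maxwell β v * h v) : IsDensity f where
  integrable := ((integrable_gaussMeasure_iff hβ).1 hi).congr e.symm
  nonneg := by
    filter_upwards [e] with v hv
    rw [hv]
    exact mul_nonneg (maxwell_pos hβ v).le (h0 v)
  integral_eq_one := by
    rw [integral_gaussMeasure hβ] at h1
    exact (integral_congr_ae e).trans h1

theorem div_maxwell_ae_eq (hβ : 0 < β) {f h : Vel d n → ℝ}
    (e : f =ᵐ[volume] fun v => maxwell β v * h v) : (fun v => f v / maxwell β v) =ᵐ[volume] h := by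
  filter_upwards [e] with v hv
  rw [hv, mul_div_cancel_left₀ _ (maxwell_pos hβ v).ne']

end conclusion

end KacModel
theorem mainTheorem9 (d N M : ℕ) (hd : 1 ≤ d) (hN : 1 ≤ N) (hM : 1 ≤ M)
    (ρ : Measure (KacModel.Angle d)) [IsProbabilityMeasure ρ]
    (hρ : KacModel.SymmetryCondition ρ) (β : ℝ) (hβ : 0 < β)
    (f₀ : KacModel.Vel d N → ℝ) (hf₀ : KacModel.IsDensity f₀)
    (hH1 : KacModel.MemH1 (fun v => Real.sqrt (f₀ v)) volume)
    (hE : KacModel.kineticEnergy (KacModel.initialDensity β M f₀) < ⊤)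
    (f h : ℝ → KacModel.Vel d N → ℝ)
    (hf : ∀ t, f t = KacModel.marginalAt ρ hβ M hf₀.integrable t)
    (hh : ∀ t v, h t v = f t v / KacModel.maxwell β v) :
    f 0 =ᵐ[volume] f₀ ∧
    KacModel.fisherInfo β (h 0) < ⊤ ∧
    ∀ t : ℝ, 0 ≤ t →
      KacModel.IsDensity (f t) ∧
      KacModel.MemH1 (fun v => Real.sqrt (h t v)) (KacModel.gaussMeasure β d N) ∧
      KacModel.fisherInfo β (h t) ≤
        ENNReal.ofReal (KacModel.decayFactor d N M t) * KacModel.fisherInfo β (h 0) ∧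
      Integrable (KacModel.entropyIntegrand (f t) (KacModel.maxwell β)) ∧
      KacModel.relEntropy (f t) (KacModel.maxwell β) ≤
        KacModel.decayFactor d N M t * KacModel.relEntropy f₀ (KacModel.maxwell β) := by
  have hM1 := KacModel.marginalAt_zero (M := M) ρ hβ hf₀.integrable
  obtain ⟨h₀, hm, h0, hi, h1, e0⟩ := hf₀.exists_density hβ
  have hf0 : f 0 =ᵐ[volume] f₀ := by rw [hf 0]; exact hM1
  have hh0 : h 0 =ᵐ[volume] h₀ := by
    have e : h 0 = fun v => f 0 v / KacModel.maxwell β v := funext (hh 0)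
    rw [e]
    exact KacModel.div_maxwell_ae_eq hβ (hf0.trans e0)
  -- Finite energy and `√f₀ ∈ H¹` together put `√h₀` in `H¹(γ)`; finite initial information and
  -- entropy both follow from this.
  obtain ⟨G, hG, hu, hGL⟩ := KacModel.exists_weakGradient_initial hβ hf₀ hH1
    (KacModel.integrable_normSq_mul_of_kineticEnergy hβ hf₀ hE)
  have hsq : (fun v => (KacModel.invSqrtMaxwell β v * Real.sqrt (f₀ v)) ^ 2) =ᵐ[volume] h₀ := by
    filter_upwards [hf₀.nonneg, KacModel.div_maxwell_ae_eq hβ e0] with v hv hv2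
    rw [KacModel.sq_invSqrtMaxwell_mul_sqrt hβ hv, hv2]
  have hF : KacModel.fisherInfo β h₀ < ⊤ := KacModel.fisherInfo_lt_top hβ hG hu hGL hsq
  have hF0 : KacModel.fisherInfo β (h 0) = KacModel.fisherInfo β h₀ :=
    KacModel.fisherInfo_congr hβ hh0
  have hS : Integrable (fun v => h₀ v * Real.log (h₀ v)) (KacModel.gaussMeasure β d N) := by
    refine (hG.integrable_sq_mul_log hβ hu hGL).congr ?_
    filter_upwards [(KacModel.ae_gaussMeasure_iff hβ).2 hsq] with v hv
    rw [hv]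
  refine ⟨hf0, hF0 ▸ hF, fun t ht => ?_⟩
  have hflow := KacModel.isFlow_marg (N := N) (M := M) hβ hd hN hM hρ ht
  have hft := KacModel.marginalAt_eq (M := M) ρ hβ hd hN hM hρ hf₀.integrable hi e0 ht
  rw [← hf t] at hft
  have hμp := KacModel.isProbabilityMeasure_poissonCollisionMeasure (d := d) ρ (n := N + M)
    (by omega) (a := ((N + M : ℕ) : ℝ) * t) (by positivity)
  have hμ := KacModel.ae_isOrth_poissonCollisionMeasure (n := N + M) ρ (((N + M : ℕ) : ℝ) * t)
  have hg := KacModel.isProbabilityMeasure_gaussMeasure hβ d M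
  have hc := KacModel.decayFactor_pos (d := d) (M := M) hN t
  set T := KacModel.flowAvg ((KacModel.poissonCollisionMeasure ρ (((N + M : ℕ) : ℝ) * t)).prod
    (KacModel.gaussMeasure β d M)) (KacModel.margLin d N M) (KacModel.margShift d N M) h₀ with hT
  have hht : h t =ᵐ[volume] T := by
    have e : h t = fun v => f t v / KacModel.maxwell β v := funext (hh t)
    rw [e]
    exact KacModel.div_maxwell_ae_eq hβ hft
  -- The entropy bound is the only conclusion that needs commutation with `ou`; the information
  -- bound uses the flow property alone.
  have hent := hflow.entropy_flowAvg_le_of_integrable hβ hc.le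
    (fun g hgC θ => KacModel.ou_flowAvg_marg hβ hμ hgC θ) hm h0 hi h1 hS
  refine ⟨KacModel.isDensity_of_ae_eq hβ (h := T) (fun v => integral_nonneg fun e => h0 _)
    (hflow.integrable_flowAvg hβ hi) ((hflow.integral_flowAvg hβ hi).trans h1) hft, ?_, ?_, ?_, ?_⟩
  · refine (hflow.memH1_sqrt_flowAvg hβ hm h0 hi hF).congr hβ ?_
    filter_upwards [hht] with v hv
    rw [hv]
  · rw [KacModel.fisherInfo_congr hβ hht, hF0]
    exact hflow.fisherInfo_flowAvg_le hβ hc hm h0 hi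
  · rw [KacModel.integrable_entropyIntegrand_iff hβ hft]
    exact hent.1
  · rw [KacModel.relEntropy_eq hβ hft, KacModel.relEntropy_eq hβ e0]
    exact hent.2
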